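/- **Setting.** Let $\Gamma$ be an infinite countable group with a left-invariant metric $d$, and put $d(S,T)=\inf\{d(\gamma,\gamma'):\gamma\in S,\gamma'\in T\}$ for $S,T\subset\Gamma$ (so $+\infty$ if one of them is empty). For finite $\Omega\subset\Gamma$ and $r\ge 0$ let $\partial_r\Omega=\{\gamma : d(\gamma,\Omega)\le r,\ d(\gamma,\Gamma\setminus\Omega)\le r\}$, $\mathrm{int}_r\Omega=\Omega\setminus\partial_r\Omega$, and $\alpha(\Omega,\Omega_0)=|\partial_{\mathrm{diam}\,\Omega_0}\Omega|/|\Omega|$. An *amenable sequence* is an increasing sequence $(\Omega_i)$ of finite subsets exhausting $\Gamma$ with $|\partial_r\Omega_i|/|\Omega_i|\to 0$ for every $r\ge 0$. It is *tiling* if for every $\varepsilon>0$ and every subsequence there are finitely many members $T_1,\dots,T_s$ of the subsequence such that every finite $\Omega\subset\Gamma$ whose ratios $\alpha(\Omega,T_1),\dots,\alpha(\Omega,T_s)$ are sufficiently small contains pairwise disjoint left translates of the $T_j$ whose union has at least $(1-\varepsilon)|\Omega|$ elements. Fix a tiling amenable sequence $(\Omega_i)$. Let $X$ be a compact space on which $\Gamma$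 acts by homeomorphisms, let $f_o:X\to\mathbb R$ be continuous with $f_o(X)=[0,1]$, and let $f_\Omega(x)=|\Omega|^{-1}\sum_{\gamma\in\Omega}f_o(\gamma^{-1}x)$. Let $F$ be a field and let $H^\star(X;F)=\bigoplus_n H^n(X;F)$ be singular cohomology with the cup product $\wedge$. Subalgebras of $H^\star(X;F)$ are understood to be graded, and need not contain $1$. For a subalgebra $A$ and $S\subset\Gamma$, $A_S$ denotes the subalgebra generated by the translates $\gamma_*A=(\gamma^{-1})^*A$, $\gamma\in S$. Assume that the action is *product-like*: there are a subalgebra $\mathfrak a\subset H^\star(X;F)$ that contains a nonzero finite-dimensional subalgebra, and a number $N(A)\ge 0$ for every finite-dimensional subalgebra $A\subset\mathfrak a$, such that for all finite $\Omega,\Omega'\subset\Gamma$ with $d(\Omega,\Omega')>N(A)$ the cup product $A_\Omega\otimes A_{\Omega'}\to A_{\Omega\cup\Omega'}$ is injective. Choose moreover numbers $\rho(A)\ge 0$ such that, writing $\widetilde\Omega=\mathrm{int}_{\rho(A)}\Omega$, one has $d(\widetilde\Omega,\widetilde\Omega')>N(A)$ for all disjoint finite $\Omega,\Omega'\subset\Gamma$.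 (The choice $\rho(A)=N(A)$ is always possible; $\rho(A)=N(A)/2$ is possible whenever any two points of $\Gamma$ at distance at most $N(A)$ have a common point within distance $N(A)/2$ of both, for instance for a word metric and $N(A)$ an even integer.) **Entropy.** For $O\subset X$ open and $a\in H^\star(X;F)$ write $\mathrm{supp}\,a\subset O$ if $a|_{O'}=0$ for some open $O'$ with $X=O\cup O'$. For a finite-dimensional subalgebra $A\subset\mathfrak a$, finite $\Omega\subset\Gamma$, $\ell\ge 0$, $c\in[0,1]$ and $\nu,\delta>0$, let $b^{\ell,\nu}_{A,\Omega}(c,\delta)$ be the rank of the linear map $a\mapsto(b\mapsto a\wedge b)$, where $a$ runs over the classes in $A_{\widetilde\Omega}$ with $\mathrm{supp}\,a\subset f_\Omega^{-1}(-\infty,c+\delta)$ all of whose homogeneous components have degree in $\bigl((\ell-\nu)|\Omega|,(\ell+\nu)|\Omega|\bigr)$, and $b$ runs over the classes in $A_{\widetilde\Omega}$ with $\mathrm{supp}\,b\subset f_\Omega^{-1}(c-\delta,+\infty)$. With $\ln 0=-\infty$, put $$b^{\ell,\nu}_A(c,\delta)=\limsup_{i\to\infty}\frac{1}{|\Omega_i|}\ln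 b^{\ell,\nu}_{A,\Omega_i}(c,\delta),\qquad b^\ell_A(c)=\lim_{\nu\to0}\lim_{\delta\to0}b^{\ell,\nu}_A(c,\delta),\qquad b^\ell(c)=\sup_A b^\ell_A(c)\in[-\infty,+\infty],$$ the supremum being over all finite-dimensional subalgebras $A\subset\mathfrak a$. **Proposition.** The Betti number entropy $(\ell,c)\mapsto b^\ell(c)$ is jointly concave on $\mathbb R^+\times[0,1]$, $\mathbb R^+=[0,\infty)$: for all $\ell,\ell'\in\mathbb R^+$, all $c,c'\in[0,1]$ and all $\alpha\in[0,1]$, $$b^{\alpha\ell+(1-\alpha)\ell'}\bigl(\alpha c+(1-\alpha)c'\bigr)\ \ge\ \alpha\,b^{\ell}(c)+(1-\alpha)\,b^{\ell'}(c'),$$ with the conventions $0\cdot(\pm\infty)=0$ and $(+\infty)+(-\infty)=-\infty$ on the right-hand side. -/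

import Mathlib

open Finset Filter Topology
open scoped ENNReal NNReal Pointwise
universe u v
/-- Singular `n`-simplices `Δⁿ → X`. -/
abbrev SingularSimplex (X : Type u) [TopologicalSpace X] (n : ℕ) : Type u :=
  C(stdSimplex ℝ (Fin (n + 1)), X)

namespace SingularSimplex
variable {X : Type u} [TopologicalSpace X]

/-- The composition of `σ : Δⁿ → X` with the affine map `Δᵐ → Δⁿ` that sends the `i`-th vertex to
the `g i`-th vertex (all uses below have `g i ≤ n` for `i ≤ m`; otherwise `g i` is cut off). -/
noncomputable def reindex {n : ℕ} (σ : SingularSimplex X n) (m : ℕ) (g : ℕ → ℕ) :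
    SingularSimplex X m :=
  σ.comp ⟨stdSimplex.map (fun i : Fin (m + 1) => (⟨min (g i) n, by omega⟩ : Fin (n + 1))),
    stdSimplex.continuous_map _⟩

theorem reindex_congr {n : ℕ} (σ : SingularSimplex X n) {m : ℕ} {g h : ℕ → ℕ}
    (H : ∀ i ≤ m, min (g i) n = min (h i) n) : σ.reindex m g = σ.reindex m h := by
  have : (fun i : Fin (m + 1) => (⟨min (g i) n, by omega⟩ : Fin (n + 1))) =
      fun i : Fin (m + 1) => (⟨min (h i) n, by omega⟩ : Fin (n + 1)) := by
    funext i
    exact Fin.ext (H i (by omega))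
  simp only [reindex, this]

theorem reindex_reindex {n : ℕ} (σ : SingularSimplex X n) {m k : ℕ} (g h : ℕ → ℕ) :
    (σ.reindex m g).reindex k h = σ.reindex k (fun i => g (min (h i) m)) := by
  ext s
  simp only [reindex, ContinuousMap.comp_apply, ContinuousMap.coe_mk, stdSimplex.map_comp_apply]
  rfl

theorem reindex_id {n : ℕ} (σ : SingularSimplex X n) {g : ℕ → ℕ}
    (H : ∀ i ≤ n, g i = i) : σ.reindex n g = σ := by
  have : (fun i : Fin (n + 1) => (⟨min (g i) n, by omega⟩ : Fin (n + 1))) = id := by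
    funext i
    have := H i (by omega)
    exact Fin.ext (by simp [this]; omega)
  ext s
  simp [reindex, this]

/-- The `i`-th face, with the vertex `i` omitted. -/
noncomputable def face {n : ℕ} (σ : SingularSimplex X (n + 1)) (i : ℕ) : SingularSimplex X n :=
  σ.reindex n (fun k => if k < i then k else k + 1)

/-- The front `p`-face, with the vertices `0, …, p`. -/
noncomputable def front {n : ℕ} (σ : SingularSimplex X n) (p : ℕ) : SingularSimplex X p :=
  σ.reindex p (fun k => k)

/-- The back `q`-face, with the vertices `n - q, …, n`. -/
noncomputable def back {n : ℕ} (σ : SingularSimplex X n) (q : ℕ) : SingularSimplex X q :=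
  σ.reindex q (fun k => n - q + k)

end SingularSimplex

/-- Families of singular cochains in all degrees: a function on the `n`-simplices for each `n`. -/
def SingularCochain (F : Type v) (X : Type u) [TopologicalSpace X] : Type (max u v) :=
  ∀ n : ℕ, SingularSimplex X n → F

namespace SingularCochain

@[ext] theorem ext {F : Type v} {X : Type u} [TopologicalSpace X]
    {x y : SingularCochain F X} (h : ∀ n σ, x n σ = y n σ) : x = y :=
  funext fun n => funext (h n)

variable {F : Type v} [Field F] {X : Type u} [TopologicalSpace X]

noncomputable instance : AddCommGroup (SingularCochain F X) :=
  inferInstanceAs (AddCommGroup (∀ n : ℕ, SingularSimplex X n → F))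
noncomputable instance : Module F (SingularCochain F X) :=
  inferInstanceAs (Module F (∀ n : ℕ, SingularSimplex X n → F))

@[simp] theorem add_apply (x y : SingularCochain F X) (n : ℕ) (σ : SingularSimplex X n) :
    (x + y) n σ = x n σ + y n σ := rfl
@[simp] theorem zero_apply (n : ℕ) (σ : SingularSimplex X n) :
    (0 : SingularCochain F X) n σ = 0 := rfl
@[simp] theorem neg_apply (x : SingularCochain F X) (n : ℕ) (σ : SingularSimplex X n) :
    (-x) n σ = -x n σ := rfl
@[simp] theorem smul_apply (r : F) (x : SingularCochain F X) (n : ℕ) (σ : SingularSimplex X n) :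
    (r • x) n σ = r * x n σ := rfl
noncomputable instance : One (SingularCochain F X) := ⟨fun n _ => if n = 0 then 1 else 0⟩

/-- The cup product `(x y)(σ) = ∑_{p + q = n} x(front p-face of σ) y(back q-face of σ)`. -/
noncomputable instance : Mul (SingularCochain F X) :=
  ⟨fun x y n σ => ∑ pq ∈ antidiagonal n, x pq.1 (σ.front pq.1) * y pq.2 (σ.back pq.2)⟩

theorem one_apply (n : ℕ) (σ : SingularSimplex X n) :
    (1 : SingularCochain F X) n σ = if n = 0 then 1 else 0 := rfl
theorem mul_apply (x y : SingularCochain F X) (n : ℕ) (σ : SingularSimplex X n) :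
    (x * y) n σ =
      ∑ pq ∈ antidiagonal n, x pq.1 (σ.front pq.1) * y pq.2 (σ.back pq.2) := rfl

open SingularSimplex in
theorem mul_assoc' (x y z : SingularCochain F X) : x * y * z = x * (y * z) := by
  ext n σ
  simp only [mul_apply, sum_mul, mul_sum]
  rw [sum_sigma', sum_sigma']
  refine sum_nbij' (fun t => ⟨(t.2.1, t.2.2 + t.1.2), (t.2.2, t.1.2)⟩)
    (fun t => ⟨(t.1.1 + t.2.1, t.2.2), (t.1.1, t.2.1)⟩) ?_ ?_ ?_ ?_ ?_
  · rintro ⟨⟨p, r⟩, ⟨a, b⟩⟩ h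
    simp only [mem_sigma, HasAntidiagonal.mem_antidiagonal, and_true] at h ⊢
    omega
  · rintro ⟨⟨p, r⟩, ⟨a, b⟩⟩ h
    simp only [mem_sigma, HasAntidiagonal.mem_antidiagonal, and_true] at h ⊢
    omega
  · rintro ⟨⟨p, r⟩, ⟨a, b⟩⟩ h
    simp only [mem_sigma, HasAntidiagonal.mem_antidiagonal] at h
    obtain ⟨h1, rfl⟩ := h
    rfl
  · rintro ⟨⟨p, r⟩, ⟨a, b⟩⟩ h
    simp only [mem_sigma, HasAntidiagonal.mem_antidiagonal] at h
    obtain ⟨h1, rfl⟩ := h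
    rfl
  · rintro ⟨⟨p, r⟩, ⟨a, b⟩⟩ h
    simp only [mem_sigma, HasAntidiagonal.mem_antidiagonal] at h
    obtain ⟨rfl, rfl⟩ := h
    have e1 : (σ.front (a + b)).front a = σ.front a := by
      simp only [front, reindex_reindex]
      exact reindex_congr _ (by intros; omega)
    have e2 : (σ.front (a + b)).back b = (σ.back (b + r)).front b := by
      simp only [front, back, reindex_reindex]
      exact reindex_congr _ (by intros; omega)
    have e3 : (σ.back (b + r)).back r = σ.back r := by
      simp only [back, reindex_reindex]
      exact reindex_congr _ (by intros; omega)
    simp only [e1, e2, e3, mul_assoc]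

open SingularSimplex in
noncomputable instance : Ring (SingularCochain F X) where
  __ := (inferInstance : AddCommGroup (SingularCochain F X))
  mul_assoc := mul_assoc'
  one_mul x := by
    ext n σ
    rw [mul_apply, sum_eq_single (0, n)]
    · simp only [one_apply, if_true, one_mul, back]
      rw [reindex_id _ (by intros; omega)]
    · rintro ⟨p, q⟩ h hne
      have : p ≠ 0 := by
        rintro rfl
        simp at h
        simp [h] at hne
      simp [one_apply, this]
    · simp
  mul_one x := by
    ext n σ
    rw [mul_apply, sum_eq_single (n, 0)]
    · simp only [one_apply, if_true, mul_one, front]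
      rw [reindex_id _ (by intros; omega)]
    · rintro ⟨p, q⟩ h hne
      have : q ≠ 0 := by
        rintro rfl
        simp at h
        simp [h] at hne
      simp [one_apply, this]
    · simp
  left_distrib x y z := by ext n σ; simp [mul_apply, mul_add, sum_add_distrib]
  right_distrib x y z := by ext n σ; simp [mul_apply, add_mul, sum_add_distrib]
  zero_mul x := by ext n σ; simp [mul_apply]
  mul_zero x := by ext n σ; simp [mul_apply]

noncomputable instance : Algebra F (SingularCochain F X) :=
  Algebra.ofModule
    (fun r x y => by ext n σ; simp [mul_apply, mul_sum, mul_assoc])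
    (fun r x y => by ext n σ; simp [mul_apply, mul_sum, mul_left_comm])

/-- `(δx)(σ) = ∑ᵢ (-1)ⁱ x(i-th face of σ)`. -/
noncomputable def coboundaryFun (x : SingularCochain F X) : SingularCochain F X
  | 0 => fun _ => 0
  | n + 1 => fun σ => ∑ i ∈ range (n + 2), (-1) ^ i * x n (σ.face i)

/-- The coboundary operator `δ`. -/
noncomputable def coboundary : SingularCochain F X →ₗ[F] SingularCochain F X where
  toFun x := coboundaryFun x
  map_add' x y := by
    ext n σ
    rw [add_apply]
    rcases n with _ | n <;> simp [coboundaryFun, mul_add, sum_add_distrib]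
  map_smul' r x := by
    ext n σ
    rw [RingHom.id_apply, smul_apply]
    rcases n with _ | n <;> simp [coboundaryFun, mul_sum, mul_left_comm]

theorem coboundary_zero (x : SingularCochain F X) (σ) : coboundary x 0 σ = 0 := rfl
theorem coboundary_succ (x : SingularCochain F X) (n σ) : coboundary x (n + 1) σ =
    ∑ i ∈ range (n + 2), (-1) ^ i * x n (σ.face i) := rfl

/-- The sign `(-1)ⁿ` in degree `n`. -/
def sgn (x : SingularCochain F X) : SingularCochain F X := fun n σ => (-1) ^ n * x n σ

open SingularSimplex in
theorem coboundary_mul (x y : SingularCochain F X) :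
    coboundary (x * y) = coboundary x * y + sgn x * coboundary y := by
  ext n σ
  cases n with
  | zero => simp [mul_apply, coboundary_zero]
  | succ n =>
    rw [add_apply, mul_apply, mul_apply, Finset.Nat.sum_antidiagonal_succ,
      Finset.Nat.sum_antidiagonal_succ']
    simp only [coboundary_zero, zero_mul, mul_zero, zero_add, ← sum_add_distrib,
      coboundary_succ, mul_apply, mul_sum]
    rw [sum_comm]
    refine sum_congr rfl ?_
    rintro ⟨p, q⟩ h
    simp only [HasAntidiagonal.mem_antidiagonal] at h
    subst h
    have e1 : ∀ i ∈ range (p + 1), (-1) ^ i *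
        (x p ((σ.face i).front p) * y q ((σ.face i).back q)) =
        (-1) ^ i * x p ((σ.front (p + 1)).face i) * y q (σ.back q) := by
      intro i hi
      rw [mem_range] at hi
      simp only [face, front, back, reindex_reindex, mul_assoc]
      congr 2
      · exact congrArg _ (reindex_congr _ (by intros; split_ifs <;> omega))
      · exact congrArg _ (reindex_congr _ (by intros; split_ifs <;> omega))
    have e2 : ∀ j ∈ range (q + 1), (-1) ^ (p + 1 + j) *
        (x p ((σ.face (p + 1 + j)).front p) * y q ((σ.face (p + 1 + j)).back q)) =
        sgn x p (σ.front p) * ((-1) ^ (j + 1) * y q ((σ.back (q + 1)).face (j + 1))) := by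
      intro j hj
      rw [mem_range] at hj
      have f1 : (σ.face (p + 1 + j)).front p = σ.front p := by
        simp only [face, front, reindex_reindex]
        exact reindex_congr _ (by intros; split_ifs <;> omega)
      have f2 : (σ.face (p + 1 + j)).back q = (σ.back (q + 1)).face (j + 1) := by
        simp only [face, back, reindex_reindex]
        exact reindex_congr _ (by intros; split_ifs <;> omega)
      rw [f1, f2, sgn]
      ring
    have f3 : (σ.front (p + 1)).face (p + 1) = σ.front p := by
      simp only [face, front, reindex_reindex]
      exact reindex_congr _ (by intros; split_ifs <;> omega)
    have f4 : (σ.back (q + 1)).face 0 = σ.back q := by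
      simp only [face, back, reindex_reindex]
      exact reindex_congr _ (by intros; split_ifs <;> omega)
    have hr : p + q + 2 = (p + 1) + (q + 1) := by omega
    rw [hr, sum_range_add, sum_congr rfl e1, sum_congr rfl e2, sum_range_succ _ (p + 1),
      sum_range_succ' _ (q + 1), f3, f4, add_mul, sum_mul, sgn]
    ring

theorem coboundary_sgn (x : SingularCochain F X) : coboundary (sgn x) = -sgn (coboundary x) := by
  ext n σ
  rcases n with _ | n
  · simp [coboundary_zero, sgn]
  · simp only [coboundary_succ, sgn, neg_apply, mul_sum, ← sum_neg_distrib]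
    exact sum_congr rfl fun i _ => by ring

theorem coboundary_one : coboundary (1 : SingularCochain F X) = 0 := by
  ext n σ
  rcases n with _ | _ | n
  · rfl
  · simp [coboundary_succ, one_apply, sum_range_succ]
  · simp [coboundary_succ, one_apply]

/-- Pullback of singular cochains along a continuous map, `(φ^* x)(σ) = x(φ ∘ σ)`. -/
def comap {Y : Type u} [TopologicalSpace Y] (φ : C(X, Y)) (x : SingularCochain F Y) :
    SingularCochain F X := fun n σ => x n (φ.comp σ)

theorem coboundary_comap {Y : Type u} [TopologicalSpace Y] (φ : C(X, Y))
    (x : SingularCochain F Y) : coboundary (comap φ x) = comap φ (coboundary x) := by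
  ext n σ
  rcases n with _ | n
  · rfl
  · rfl

theorem comap_mul {Y : Type u} [TopologicalSpace Y] (φ : C(X, Y))
    (x y : SingularCochain F Y) : comap φ (x * y) = comap φ x * comap φ y := rfl

end SingularCochain

section Cohomology
variable (F : Type v) [Field F] (X : Type u) [TopologicalSpace X]

open SingularCochain

/-- Singular cocycles, with only finitely many nonzero homogeneous components. -/
noncomputable def singularCocycles : Subalgebra F (SingularCochain F X) where
  carrier := {x | coboundary x = 0 ∧ ∃ N : ℕ, ∀ n ≥ N, ∀ σ, x n σ = 0}
  mul_mem' := by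
    rintro x y ⟨hx, N, hN⟩ ⟨hy, M, hM⟩
    refine ⟨by rw [coboundary_mul, hx, hy, zero_mul, mul_zero, add_zero], N + M, ?_⟩
    intro n hn σ
    rw [mul_apply]
    refine sum_eq_zero ?_
    rintro ⟨p, q⟩ h
    rw [HasAntidiagonal.mem_antidiagonal] at h
    dsimp only at h ⊢
    by_cases hp : N ≤ p
    · rw [hN p hp, zero_mul]
    · rw [hM q (by omega), mul_zero]
  add_mem' := by
    rintro x y ⟨hx, N, hN⟩ ⟨hy, M, hM⟩
    refine ⟨by rw [map_add, hx, hy, add_zero], N + M, ?_⟩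
    intro n hn σ
    rw [SingularCochain.add_apply, hN n (by omega), hM n (by omega), add_zero]
  algebraMap_mem' r := by
    rw [Algebra.algebraMap_eq_smul_one]
    refine ⟨by rw [map_smul, coboundary_one, smul_zero], 1, fun n hn σ => ?_⟩
    rw [SingularCochain.smul_apply, one_apply, if_neg (by omega), mul_zero]

/-- The coboundaries, as an ideal of the algebra of cocycles. -/
noncomputable def singularCoboundaries : Ideal (singularCocycles F X) where
  carrier := {z | ∃ y : SingularCochain F X, coboundary y = z}
  add_mem' := by
    rintro a b ⟨y, hy⟩ ⟨y', hy'⟩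
    exact ⟨y + y', by rw [map_add, hy, hy']; rfl⟩
  zero_mem' := ⟨0, by simp⟩
  smul_mem' := by
    rintro c a ⟨y, hy⟩
    refine ⟨sgn c.1 * y, ?_⟩
    have hs : sgn (sgn c.1) = c.1 := by
      ext n σ
      simp only [sgn, ← mul_assoc, ← mul_pow]
      simp
    have h0 : sgn (0 : SingularCochain F X) = 0 := by
      ext n σ
      simp [sgn]
    rw [coboundary_mul, coboundary_sgn, c.2.1, h0, hs, hy, neg_zero, zero_mul, zero_add]
    rfl

noncomputable instance : (singularCoboundaries F X).IsTwoSided where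
  mul_mem_of_left := by
    rintro a b ⟨y, hy⟩
    refine ⟨y * b.1, ?_⟩
    rw [coboundary_mul, b.2.1, mul_zero, add_zero, hy]
    rfl

/-- The total singular cohomology `H^⋆(X; F) = ⨁ₙ Hⁿ(X; F)`, an `F`-algebra for the cup product. -/
def SingularCohomology : Type (max u v) := singularCocycles F X ⧸ singularCoboundaries F X

noncomputable instance : Ring (SingularCohomology F X) :=
  inferInstanceAs (Ring (singularCocycles F X ⧸ singularCoboundaries F X))

noncomputable instance : Algebra F (SingularCohomology F X) :=
  inferInstanceAs (Algebra F (singularCocycles F X ⧸ singularCoboundaries F X))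

/-- The cohomology class of a cocycle. -/
noncomputable def cohomologyClass : singularCocycles F X →ₐ[F] SingularCohomology F X :=
  Ideal.Quotient.mkₐ F (singularCoboundaries F X)

theorem cohomologyClass_surjective : Function.Surjective (cohomologyClass F X) :=
  Ideal.Quotient.mk_surjective

/-- The homogeneous part `Hⁿ(X; F)` of the total cohomology: the classes of cocycles that are
concentrated in degree `n`. -/
noncomputable def homogeneousPart (n : ℕ) : Submodule F (SingularCohomology F X) :=
  Submodule.map (cohomologyClass F X).toLinearMap
    { carrier := {z | ∀ m, m ≠ n → ∀ σ, z.1 m σ = 0}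
      add_mem' := fun {a b} ha hb m hm σ => by
        have := SingularCochain.add_apply a.1 b.1 m σ
        rw [ha m hm, hb m hm, add_zero] at this
        exact this
      zero_mem' := fun m _ σ => rfl
      smul_mem' := fun c a ha m hm σ => by
        have := SingularCochain.smul_apply c a.1 m σ
        rw [ha m hm, mul_zero] at this
        exact this }

variable {X} in
/-- The map `φ^* : H^⋆(Y; F) → H^⋆(X; F)` induced by a continuous map `φ : X → Y`. -/
noncomputable def cohomologyMap {Y : Type u} [TopologicalSpace Y] (φ : C(X, Y)) :
    SingularCohomology F Y →ₐ[F] SingularCohomology F X :=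
  Ideal.quotientMapₐ (singularCoboundaries F X)
    (AlgHom.ofLinearMap
      { toFun := fun z => (⟨comap φ z.1, by
          refine ⟨by rw [coboundary_comap, z.2.1]; rfl, ?_⟩
          obtain ⟨N, hN⟩ := z.2.2
          exact ⟨N, fun n hn σ => hN n hn _⟩⟩ : singularCocycles F X)
        map_add' := fun _ _ => rfl
        map_smul' := fun _ _ => rfl } rfl (fun _ _ => rfl))
    (by
      rintro z ⟨y, hy⟩
      exact ⟨comap φ y, by rw [coboundary_comap, hy]; rfl⟩)

variable {F X}

theorem cohomologyMap_comp {Y Z : Type u} [TopologicalSpace Y] [TopologicalSpace Z]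
    (ψ : C(Y, Z)) (φ : C(X, Y)) (a : SingularCohomology F Z) :
    cohomologyMap F (ψ.comp φ) a = cohomologyMap F φ (cohomologyMap F ψ a) := by
  obtain ⟨z, rfl⟩ := cohomologyClass_surjective F Z a
  rfl

/-- The restriction `H^⋆(X; F) → H^⋆(U; F)` to a subset `U`. -/
noncomputable def cohomologyRestrict (U : Set X) :
    SingularCohomology F X →ₐ[F] SingularCohomology F U :=
  cohomologyMap F ⟨((↑) : U → X), continuous_subtype_val⟩

theorem cohomologyRestrict_mono {U V : Set X} (h : U ⊆ V) {a : SingularCohomology F X}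
    (ha : cohomologyRestrict V a = 0) : cohomologyRestrict U a = 0 := by
  have h1 := cohomologyMap_comp (F := F) (⟨((↑) : V → X), continuous_subtype_val⟩ : C(V, X))
    (⟨Set.inclusion h, continuous_inclusion h⟩ : C(U, V)) a
  have h2 : cohomologyMap F (⟨((↑) : V → X), continuous_subtype_val⟩ : C(V, X)) a = 0 := ha
  rw [h2, map_zero] at h1
  exact h1

/-- The space of the classes `a` with `supp a ⊂ O`: for some open `O'` with `X = O ∪ O'`, the
restriction of `a` to `O'` vanishes. -/
noncomputable def supportedIn (O : Set X) : Submodule F (SingularCohomology F X) where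
  carrier := {a | ∃ O' : Set X, IsOpen O' ∧ O ∪ O' = Set.univ ∧ cohomologyRestrict O' a = 0}
  add_mem' := by
    rintro a b ⟨U, hU, hOU, ha⟩ ⟨V, hV, hOV, hb⟩
    refine ⟨U ∩ V, hU.inter hV, by rw [Set.union_inter_distrib_left, hOU, hOV, Set.inter_self], ?_⟩
    rw [map_add, cohomologyRestrict_mono Set.inter_subset_left ha,
      cohomologyRestrict_mono Set.inter_subset_right hb, add_zero]
  zero_mem' := ⟨Set.univ, isOpen_univ, Set.union_univ _, map_zero _⟩
  smul_mem' := by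
    rintro c a ⟨U, hU, hOU, ha⟩
    exact ⟨U, hU, hOU, by rw [map_smul, ha, smul_zero]⟩

/-- A (not necessarily unital) subalgebra of `H^⋆(X; F)` is graded if it is spanned by its
homogeneous elements. -/
def IsGradedSubalgebra (A : NonUnitalSubalgebra F (SingularCohomology F X)) : Prop :=
  A.toSubmodule ≤ ⨆ n : ℕ, A.toSubmodule ⊓ homogeneousPart F X n

end Cohomology

section MetricGroup
variable {Γ : Type*} [MetricSpace Γ]

/-- `d(S, T) = inf {d(γ, γ') ; γ ∈ S, γ' ∈ T}`, equal to `∞` if `S` or `T` is empty. -/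
noncomputable def setDist (S T : Set Γ) : ℝ≥0∞ := ⨅ γ ∈ S, ⨅ γ' ∈ T, edist γ γ'

/-- The `r`-boundary `∂_r Ω = {γ ; d(γ, Ω) ≤ r and d(γ, Γ - Ω) ≤ r}`. -/
def rBoundary (r : ℝ≥0) (Ω : Set Γ) : Set Γ := {γ | setDist {γ} Ω ≤ r ∧ setDist {γ} Ωᶜ ≤ r}

/-- The `r`-interior `int_r Ω = Ω - ∂_r Ω`. -/
def rInterior (r : ℝ≥0) (Ω : Set Γ) : Set Γ := Ω \ rBoundary r Ω

/-- A point of the `r`-interior of `Ω` is at distance more than `r` from every point outside. -/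
theorem lt_edist_of_mem_rInterior {r : ℝ≥0} {Ω : Set Γ} {γ γ' : Γ} (hγ : γ ∈ rInterior r Ω)
    (hγ' : γ' ∉ Ω) : (r : ℝ≥0∞) < edist γ γ' := by
  by_contra hle
  refine hγ.2 ⟨?_, ?_⟩
  · have : setDist {γ} Ω ≤ edist γ γ :=
      (iInf₂_le (f := fun x (_ : x ∈ ({γ} : Set Γ)) => ⨅ y ∈ Ω, edist x y) γ rfl).trans
        (iInf₂_le (f := fun y (_ : y ∈ Ω) => edist γ y) γ hγ.1)
    rw [edist_self] at this
    exact this.trans zero_le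
  · have : setDist {γ} Ωᶜ ≤ edist γ γ' :=
      (iInf₂_le (f := fun x (_ : x ∈ ({γ} : Set Γ)) => ⨅ y ∈ Ωᶜ, edist x y) γ rfl).trans
        (iInf₂_le (f := fun y (_ : y ∈ Ωᶜ) => edist γ y) γ' hγ')
    exact this.trans (not_lt.mp hle)

theorem lt_setDist_of_forall {N : ℝ≥0} {S T : Set Γ} (hS : S.Finite) (hT : T.Finite)
    (h : ∀ x ∈ S, ∀ y ∈ T, (N : ℝ≥0∞) < edist x y) : (N : ℝ≥0∞) < setDist S T := by
  have h1 : (N : ℝ≥0∞) < hS.toFinset.inf fun x => hT.toFinset.inf fun y => edist x y := by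
    rw [Finset.lt_inf_iff ENNReal.coe_lt_top]
    intro x hx
    rw [Finset.lt_inf_iff ENNReal.coe_lt_top]
    intro y hy
    exact h x (hS.mem_toFinset.mp hx) y (hT.mem_toFinset.mp hy)
  exact h1.trans_le (le_iInf₂ fun x hx => (Finset.inf_le (hS.mem_toFinset.mpr hx)).trans
    (le_iInf₂ fun y hy => Finset.inf_le (hT.mem_toFinset.mpr hy)))

theorem finite_rInterior (r : ℝ≥0) (Ω : Finset Γ) : (rInterior r (Ω : Set Γ)).Finite :=
  Ω.finite_toSet.subset fun _ h => h.1

/-- The `r`-interiors of two disjoint finite sets are at distance more than `r`. -/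
theorem lt_setDist_rInterior (r : ℝ≥0) (Ω Ω' : Finset Γ) (h : Disjoint Ω Ω') :
    (r : ℝ≥0∞) < setDist (rInterior r (Ω : Set Γ)) (rInterior r (Ω' : Set Γ)) :=
  lt_setDist_of_forall (finite_rInterior r Ω) (finite_rInterior r Ω') fun _ hx _ hy =>
    lt_edist_of_mem_rInterior hx fun hm =>
      Finset.disjoint_left.mp h (Finset.mem_coe.mp hm) (Finset.mem_coe.mp hy.1)

theorem lt_setDist_rInterior_of_midpoint (N r : ℝ≥0)
    (hmid : ∀ x y : Γ, edist x y ≤ N → ∃ z, edist x z ≤ r ∧ edist y z ≤ r)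
    (Ω Ω' : Finset Γ) (h : Disjoint Ω Ω') :
    (N : ℝ≥0∞) < setDist (rInterior r (Ω : Set Γ)) (rInterior r (Ω' : Set Γ)) := by
  refine lt_setDist_of_forall (finite_rInterior r Ω) (finite_rInterior r Ω') fun x hx y hy => ?_
  by_contra hle
  obtain ⟨z, hxz, hyz⟩ := hmid x y (not_lt.mp hle)
  have h1 : z ∈ (Ω : Set Γ) := by
    by_contra hz
    exact absurd hxz (not_le.mpr (lt_edist_of_mem_rInterior hx hz))
  have h2 : z ∈ (Ω' : Set Γ) := by
    by_contra hz
    exact absurd hyz (not_le.mpr (lt_edist_of_mem_rInterior hy hz))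
  exact Finset.disjoint_left.mp h (Finset.mem_coe.mp h1) (Finset.mem_coe.mp h2)

/-- The amenability ratio `α(Ω, Ω₀) = |∂_{D} Ω| / |Ω|`, where `D` is the diameter of `Ω₀`. -/
noncomputable def amenabilityRatio (Ω Ω₀ : Finset Γ) : ℝ≥0∞ :=
  ((rBoundary (Metric.diam (Ω₀ : Set Γ)).toNNReal (Ω : Set Γ)).encard : ℝ≥0∞) / (Ω.card : ℝ≥0∞)

/-- An amenable sequence: an increasing sequence of finite subsets that exhausts `Γ`, such that
`|∂_r Ω_i| / |Ω_i| → 0` for every `r ≥ 0`. -/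
structure IsAmenableSequence (Ω : ℕ → Finset Γ) : Prop where
  mono : Monotone Ω
  exhausts : ∀ γ : Γ, ∃ i, γ ∈ Ω i
  tendsto : ∀ r : ℝ≥0, Tendsto
    (fun i => ((rBoundary r (Ω i : Set Γ)).encard : ℝ≥0∞) / ((Ω i).card : ℝ≥0∞)) atTop (𝓝 0)

variable [Group Γ]

/-- The finite set `Ω` is disjointly `ε`-tiled by left translates of the sets `T j`, `j ∈ J`; the
set of centers of the translates of `T j` is `C j`. -/
def IsDisjointlyTiled [DecidableEq Γ] (ε : ℝ) (T : ℕ → Finset Γ) (J : Finset ℕ)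
    (Ω : Finset Γ) : Prop :=
  ∃ C : ℕ → Finset Γ,
    (∀ j ∈ J, ∀ γ ∈ C j, γ • T j ⊆ Ω) ∧
    (∀ j ∈ J, ∀ γ ∈ C j, ∀ j' ∈ J, ∀ γ' ∈ C j', (j, γ) ≠ (j', γ') →
      Disjoint (γ • T j) (γ' • T j')) ∧
    (1 - ε) * (Ω.card : ℝ) ≤ ((J.biUnion fun j => (C j).biUnion fun γ => γ • T j).card : ℝ)

/-- A tiling amenable sequence: for all `ε > 0` and every subsequence there are finitely many
members of the subsequence such that every finite set whose amenability ratios with respect to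
them are small enough is disjointly `ε`-tiled by their translates. -/
structure IsTilingAmenableSequence [DecidableEq Γ] (Ω : ℕ → Finset Γ) : Prop
    extends IsAmenableSequence Ω where
  tiles : ∀ ε : ℝ, 0 < ε → ∀ φ : ℕ → ℕ, StrictMono φ → ∃ J : Finset ℕ, ∃ η : ℝ≥0∞, 0 < η ∧
    ∀ S : Finset Γ, (∀ j ∈ J, amenabilityRatio S (Ω (φ j)) < η) →
      IsDisjointlyTiled ε (fun j => Ω (φ j)) J S

end MetricGroup

section Entropy
variable {Γ : Type*} [MetricSpace Γ] {X : Type u} [TopologicalSpace X] {F : Type v} [Field F]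

/-- The finite-dimensional graded subalgebras contained in `𝔞`. -/
structure IsFiniteGradedIn (𝔞 A : NonUnitalSubalgebra F (SingularCohomology F X)) : Prop where
  le : A ≤ 𝔞
  graded : IsGradedSubalgebra A
  finite : FiniteDimensional F A.toSubmodule

variable (Γ) in
/-- Radii `ρ(A)` such that the `ρ(A)`-interiors of disjoint finite sets are at distance more than
`N(A)`. By `lt_setDist_rInterior`, `ρ(A) = N(A)` is always possible; `ρ(A) = N(A) / 2` is possible
if any two points at distance at most `N(A)` have a point within `N(A) / 2` of both. -/
def IsSeparatingRadius (𝔞 : NonUnitalSubalgebra F (SingularCohomology F X))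
    (N ρ : NonUnitalSubalgebra F (SingularCohomology F X) → ℝ≥0) : Prop :=
  ∀ A, IsFiniteGradedIn 𝔞 A → ∀ Ω Ω' : Finset Γ, Disjoint Ω Ω' →
    (N A : ℝ≥0∞) < setDist (rInterior (ρ A) (Ω : Set Γ)) (rInterior (ρ A) (Ω' : Set Γ))

theorem isSeparatingRadius_self (𝔞 : NonUnitalSubalgebra F (SingularCohomology F X))
    (N : NonUnitalSubalgebra F (SingularCohomology F X) → ℝ≥0) :
    IsSeparatingRadius Γ 𝔞 N N :=
  fun A _ Ω Ω' h => lt_setDist_rInterior (N A) Ω Ω' h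

theorem isSeparatingRadius_half (𝔞 : NonUnitalSubalgebra F (SingularCohomology F X))
    (N : NonUnitalSubalgebra F (SingularCohomology F X) → ℝ≥0)
    (hmid : ∀ A, IsFiniteGradedIn 𝔞 A → ∀ x y : Γ, edist x y ≤ N A →
      ∃ z, edist x z ≤ (N A / 2 : ℝ≥0) ∧ edist y z ≤ (N A / 2 : ℝ≥0)) :
    IsSeparatingRadius Γ 𝔞 N (fun A => N A / 2) :=
  fun A hA Ω Ω' h => lt_setDist_rInterior_of_midpoint (N A) (N A / 2) (hmid A hA) Ω Ω' h

variable [Group Γ] [MulAction Γ X] [ContinuousConstSMul Γ X]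

/-- The average `f_Ω(x) = |Ω|⁻¹ ∑_{γ ∈ Ω} f(γ⁻¹ x)`. -/
noncomputable def orbitAverage (f : X → ℝ) (Ω : Finset Γ) (x : X) : ℝ :=
  (∑ γ ∈ Ω, f (γ⁻¹ • x)) / (Ω.card : ℝ)

/-- The left action `γ_* = (γ⁻¹)^*` of `Γ` on `H^⋆(X; F)`. -/
noncomputable def cohomologyPush (γ : Γ) : SingularCohomology F X →ₐ[F] SingularCohomology F X :=
  cohomologyMap F ⟨fun x => γ⁻¹ • x, continuous_const_smul γ⁻¹⟩

/-- `A_S`: the subalgebra generated by the translates `γ_* A`, `γ ∈ S`. -/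
noncomputable def translatesAlgebra (A : NonUnitalSubalgebra F (SingularCohomology F X))
    (S : Set Γ) : NonUnitalSubalgebra F (SingularCohomology F X) :=
  NonUnitalAlgebra.adjoin F (⋃ γ ∈ S, cohomologyPush γ '' (A : Set (SingularCohomology F X)))

variable (Γ) in
/-- The graded subalgebra `𝔞` and the numbers `N(A)` witness that the action of `Γ` on `X` is
product-like: `𝔞` contains a nonzero finite-dimensional algebra, and for every finite-dimensional
`A ⊂ 𝔞` the cup product `A_Ω ⊗ A_Ω' → H^⋆(X; F)` is injective as soon as `d(Ω, Ω') > N(A)`. -/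
structure IsProductLike (𝔞 : NonUnitalSubalgebra F (SingularCohomology F X))
    (N : NonUnitalSubalgebra F (SingularCohomology F X) → ℝ≥0) : Prop where
  graded : IsGradedSubalgebra 𝔞
  nontrivial : ∃ A, IsFiniteGradedIn 𝔞 A ∧ A ≠ ⊥
  injective : ∀ A, IsFiniteGradedIn 𝔞 A → ∀ Ω Ω' : Finset Γ,
    (N A : ℝ≥0∞) < setDist (Ω : Set Γ) (Ω' : Set Γ) →
      Function.Injective (Submodule.mulMap (translatesAlgebra A (Ω : Set Γ)).toSubmodule
        (translatesAlgebra A (Ω' : Set Γ)).toSubmodule)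

/-- The classes of `A_S` that are supported in `O`. -/
noncomputable def supportedClasses (A : NonUnitalSubalgebra F (SingularCohomology F X))
    (S : Set Γ) (O : Set X) : Submodule F (SingularCohomology F X) :=
  (translatesAlgebra A S).toSubmodule ⊓ supportedIn O

/-- The classes all of whose homogeneous components have degree in `(p, q)`. -/
noncomputable def degreeBetween (p q : ℝ) : Submodule F (SingularCohomology F X) :=
  ⨆ (n : ℕ) (_ : p < n ∧ n < q), homogeneousPart F X n

/-- The homological measure: the rank of the map `a ↦ (b ↦ a ∧ b)`. Here `S` is the interior of
`Ω` that is used, `a` runs over the classes of `A_S` supported in `{f_Ω < c + δ}` with degrees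
in `((ℓ - ν)|Ω|, (ℓ + ν)|Ω|)`, and `b` over the classes of `A_S` supported in `{c - δ < f_Ω}`.
(Enlarging the target of `b ↦ a ∧ b` to `H^⋆(X; F)` does not change the rank.) -/
noncomputable def homologicalMeasure (f : X → ℝ)
    (A : NonUnitalSubalgebra F (SingularCohomology F X)) (S : Set Γ) (Ω : Finset Γ)
    (ℓ ν c δ : ℝ) : ℕ :=
  Module.finrank F (LinearMap.range
    ((LinearMap.mul F (SingularCohomology F X)).domRestrict₁₂
      (supportedClasses A S (orbitAverage f Ω ⁻¹' Set.Iio (c + δ)) ⊓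
        degreeBetween ((ℓ - ν) * (Ω.card : ℝ)) ((ℓ + ν) * (Ω.card : ℝ)))
      (supportedClasses A S (orbitAverage f Ω ⁻¹' Set.Ioi (c - δ)))))

/-- The exponential growth rate `lim |Ω_i|⁻¹ ln b_{A, Ω_i}` at given `ν, δ`, with values in
`[-∞, ∞]` and with `ln 0 = -∞`; the classes are taken in `A_S` for `S = int_ρ Ω_i`. -/
noncomputable def measureGrowth (f : X → ℝ) (A : NonUnitalSubalgebra F (SingularCohomology F X))
    (ρ : ℝ≥0) (Ω : ℕ → Finset Γ) (ℓ ν c δ : ℝ) : EReal :=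
  limsup (fun i => ENNReal.log
    (homologicalMeasure f A (rInterior ρ (Ω i : Set Γ)) (Ω i) ℓ ν c δ : ℝ≥0∞) /
      ((Ω i).card : EReal)) atTop

/-- The `ℓ`-th Betti number entropy `b^ℓ(c)` of `f`. As `measureGrowth` increases with `ν` and
`δ`, the limits as `ν, δ → 0` are infima. -/
noncomputable def bettiEntropy (f : X → ℝ) (𝔞 : NonUnitalSubalgebra F (SingularCohomology F X))
    (ρ : NonUnitalSubalgebra F (SingularCohomology F X) → ℝ≥0) (Ω : ℕ → Finset Γ)
    (ℓ c : ℝ) : EReal :=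
  ⨆ (A : NonUnitalSubalgebra F (SingularCohomology F X)) (_ : IsFiniteGradedIn 𝔞 A),
    ⨅ (ν : ℝ) (_ : 0 < ν) (δ : ℝ) (_ : 0 < δ), measureGrowth f A (ρ A) Ω ℓ ν c δ

end Entropy

/-!
The entropy is concave because homological measures are supermultiplicative over separated sets,
and because a large set of a tiling amenable sequence is almost a disjoint union of translates of
smaller sets.

*Products.* Let `S`, `T` be finite sets at a distance greater than `N(A)`, let `aᵢ ∈ A_S` be classes
whose functionals `b ↦ aᵢ ∧ b` on a space of classes `R ⊆ A_S` are independent, and let `a'ⱼ ∈ A_T`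
and `R' ⊆ A_T` be likewise. For homogeneous classes, `(aᵢ ∧ a'ⱼ) ∧ (b ∧ b')` and
`(aᵢ ∧ b) ∧ (a'ⱼ ∧ b')` agree up to sign, and the cup product is injective on `A_S ⊗ A_T`; so the
products `aᵢ ∧ a'ⱼ` are independent as functionals on the products `b ∧ b'`
(`PairingIndependent.mul`), and the ranks multiply (`HasPairing.mul`, `HasPairing.prod`). Supports
are intersected and degrees are added. When the tiles `T₁, …, Tₘ` nearly fill `Ω`, the average
`f_Ω` is close to the average of the `f_{Tₖ}` weighted by `|Tₖ|`, so levels, degrees and logarithms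
of ranks on `Ω` are, up to a small error, weighted averages of those on the tiles
(`HasGrowth.of_tiles`).

*Tilings.* What is to be tiled is the interior of `Ωᵢ` for the radius that belongs to the algebra on
`Ωᵢ`, which by amenability still makes up most of `Ωᵢ`. The tiles have bounded size, so a large
`Ωᵢ` admits a division of them into two families with volumes close to `α |Ωᵢ|` and `(1 - α) |Ωᵢ|`.
Classes of the first kind are placed on one family and classes of the second kind on the other
(`eventually_hasGrowth_mixture`). This is used twice. With a single kind, it turns growth on a
subsequence into growth on all large `Ωᵢ`, so that the upper limits in the two entropies can be
attained simultaneously; it also replaces the algebras `A`, `A'` that approach the two suprema by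
`A ⊔ A'` (`eventually_hasGrowth_of_lt`). Then the two kinds are mixed.

*Cohomology.* Two properties of singular cohomology are needed. The cup product of classes that
vanish on open sets `U` and `V` vanishes on `U ∪ V` (`cohomologyRestrict_union_mul`): for suitable
representatives, the product of the cochains vanishes on all simplices that lie in `U` or in `V`,
and iterated barycentric subdivision shows that such a cocycle is a coboundary
(`SingularCochain.exists_coboundary_eq_of_vanishing`). The cup product is graded commutative
(`mul_comm_of_mem_homogeneousPart`), by the cup-one product. Besides the signs above, this gives
that two finite-dimensional graded subalgebras generate a finite-dimensional one
(`toSubmodule_sup_of_isGraded`), so that the algebras `A_S` of finite sets `S` and the join `A ⊔ A'`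
have finite dimension.
-/

/-! ### Chains of tuples and barycentric subdivision -/

namespace TupleChain
variable {F : Type v} [Field F] {K L : Type*}

/-- The augmented simplicial boundary on chains of tuples: a tuple with `n + 1` entries has
degree `n`, and the empty tuple spans degree `-1`. -/
noncomputable def boundary : (List K →₀ F) →ₗ[F] (List K →₀ F) :=
  Finsupp.linearCombination F
    fun v => ∑ i : Fin v.length, (-1 : F) ^ (i : ℕ) • Finsupp.single (v.eraseIdx i) 1

/-- The cone with apex `b`. -/
noncomputable def cone (b : K) : (List K →₀ F) →ₗ[F] (List K →₀ F) :=
  Finsupp.lmapDomain F F (List.cons b)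

theorem cone_single (b : K) (v : List K) (r : F) :
    cone b (Finsupp.single v r) = Finsupp.single (b :: v) r := by
  simp [cone, Finsupp.mapDomain_single]

theorem boundary_single (v : List K) :
    boundary (Finsupp.single v (1 : F)) =
      ∑ i : Fin v.length, (-1 : F) ^ (i : ℕ) • Finsupp.single (v.eraseIdx i) 1 := by
  simp [boundary]

theorem boundary_single_cons (b : K) (v : List K) :
    boundary (Finsupp.single (b :: v) (1 : F)) =
      Finsupp.single v 1 - cone b (boundary (Finsupp.single v 1)) := by
  rw [boundary_single, boundary_single, map_sum]
  change ∑ i : Fin (v.length + 1), _ = _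
  rw [Fin.sum_univ_succ, sub_eq_add_neg, ← Finset.sum_neg_distrib]
  congr 1
  · simp
  · refine Finset.sum_congr rfl fun i _ => ?_
    rw [map_smul, cone_single]
    simp [pow_succ]

theorem boundary_cone (b : K) (c : List K →₀ F) :
    boundary (cone b c) = c - cone b (boundary c) := by
  induction c using Finsupp.induction_linear with
  | zero => simp
  | add x y hx hy => simp only [map_add, hx, hy]; abel
  | single v r =>
    have h : Finsupp.single v r = r • Finsupp.single v (1 : F) := by simp
    rw [h, map_smul, map_smul, map_smul, map_smul, cone_single, boundary_single_cons, smul_sub]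

theorem boundary_boundary (c : List K →₀ F) : boundary (boundary c) = 0 := by
  induction c using Finsupp.induction_linear with
  | zero => simp
  | add x y hx hy => simp only [map_add, hx, hy, add_zero]
  | single v r =>
    have h : Finsupp.single v r = r • Finsupp.single v (1 : F) := by simp
    rw [h, map_smul, map_smul]
    suffices boundary (boundary (Finsupp.single v (1 : F))) = 0 by rw [this, smul_zero]
    clear h
    induction v with
    | nil => simp [boundary_single]
    | cons b v ih => rw [boundary_single_cons, map_sub, boundary_cone, ih]; simp

/-- The subdivision of a tuple `v`: the cone over the subdivided boundary of `v` with apex `β v`.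
For the barycenter `β v` of `v` this is the barycentric subdivision. -/
noncomputable def subdivide (β : List K → K) : List K → (List K →₀ F)
  | [] => Finsupp.single [] 1
  | a :: w => cone (β (a :: w))
      (∑ i : Fin (a :: w).length, (-1 : F) ^ (i : ℕ) • subdivide β ((a :: w).eraseIdx i))
termination_by v => v.length
decreasing_by rw [List.length_eraseIdx_of_lt i.2]; simp

/-- The chain homotopy between the subdivision and the identity. -/
noncomputable def homotopy (β : List K → K) : List K → (List K →₀ F)
  | [] => 0
  | a :: w => cone (β (a :: w)) (Finsupp.single (a :: w) 1 -
      ∑ i : Fin (a :: w).length, (-1 : F) ^ (i : ℕ) • homotopy β ((a :: w).eraseIdx i))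
termination_by v => v.length
decreasing_by rw [List.length_eraseIdx_of_lt i.2]; simp

/-- The linear extension of `subdivide`. -/
noncomputable def subdivideL (β : List K → K) : (List K →₀ F) →ₗ[F] (List K →₀ F) :=
  Finsupp.linearCombination F (subdivide β)

/-- The linear extension of `homotopy`. -/
noncomputable def homotopyL (β : List K → K) : (List K →₀ F) →ₗ[F] (List K →₀ F) :=
  Finsupp.linearCombination F (homotopy β)

theorem subdivideL_single (β : List K → K) (v : List K) :
    subdivideL β (Finsupp.single v (1 : F)) = subdivide β v := by simp [subdivideL]

theorem homotopyL_single (β : List K → K) (v : List K) :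
    homotopyL β (Finsupp.single v (1 : F)) = homotopy β v := by simp [homotopyL]

theorem subdivide_of_ne (β : List K → K) {v : List K} (hv : v ≠ []) :
    subdivide β v = cone (β v) (subdivideL β (boundary (Finsupp.single v (1 : F)))) := by
  obtain ⟨a, w, rfl⟩ := List.exists_cons_of_ne_nil hv
  rw [subdivide, boundary_single]
  simp only [map_sum, map_smul, subdivideL_single]

theorem homotopy_of_ne (β : List K → K) {v : List K} (hv : v ≠ []) :
    homotopy β v = cone (β v) (Finsupp.single v (1 : F) -
      homotopyL β (boundary (Finsupp.single v (1 : F)))) := by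
  obtain ⟨a, w, rfl⟩ := List.exists_cons_of_ne_nil hv
  rw [homotopy, boundary_single]
  simp only [map_sum, map_smul, homotopyL_single]

/-- Two linear maps that agree on all the faces of `v` agree on its boundary. -/
theorem boundary_single_congr {M : Type*} [AddCommGroup M] [Module F M]
    (f g : (List K →₀ F) →ₗ[F] M) (v : List K)
    (h : ∀ w : List K, w.length < v.length → f (Finsupp.single w 1) = g (Finsupp.single w 1)) :
    f (boundary (Finsupp.single v 1)) = g (boundary (Finsupp.single v 1)) := by
  rw [boundary_single, map_sum, map_sum]
  refine Finset.sum_congr rfl fun i _ => ?_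
  rw [map_smul, map_smul, h]
  rw [List.length_eraseIdx_of_lt i.2]
  have := i.2
  omega

theorem boundary_subdivide (β : List K → K) (c : List K →₀ F) :
    boundary (subdivideL β c) = subdivideL β (boundary c) := by
  have key : ∀ n : ℕ, ∀ v : List K, v.length = n →
      boundary (subdivideL β (Finsupp.single v (1 : F))) =
        subdivideL β (boundary (Finsupp.single v (1 : F))) := by
    intro n
    induction n using Nat.strong_induction_on with
    | _ n ih =>
      intro v hv
      by_cases h0 : v = []
      · subst h0
        rw [subdivideL_single, subdivide, boundary_single]
        simp
      · rw [subdivideL_single, subdivide_of_ne β h0, boundary_cone]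
        have := boundary_single_congr (boundary.comp (subdivideL (F := F) β))
          ((subdivideL β).comp boundary) v (fun w hw => ih w.length (hv ▸ hw) w rfl)
        simp only [LinearMap.comp_apply] at this
        rw [this, boundary_boundary, map_zero, map_zero, sub_zero]
  have : boundary.comp (subdivideL β) = (subdivideL β).comp (boundary (F := F)) :=
    Finsupp.lhom_ext' fun v => LinearMap.ext_ring (key _ v rfl)
  exact LinearMap.congr_fun this c

theorem boundary_homotopy (β : List K → K) (c : List K →₀ F) :
    boundary (homotopyL β c) + homotopyL β (boundary c) = c - subdivideL β c := by
  have key : ∀ n : ℕ, ∀ v : List K, v.length = n →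
      boundary (homotopyL β (Finsupp.single v (1 : F))) +
        homotopyL β (boundary (Finsupp.single v (1 : F))) =
      Finsupp.single v 1 - subdivideL β (Finsupp.single v (1 : F)) := by
    intro n
    induction n using Nat.strong_induction_on with
    | _ n ih =>
      intro v hv
      by_cases h0 : v = []
      · subst h0
        rw [homotopyL_single, homotopy, subdivideL_single, subdivide, boundary_single]
        simp
      · rw [homotopyL_single, homotopy_of_ne β h0, subdivideL_single, subdivide_of_ne β h0,
          boundary_cone, map_sub]
        have := boundary_single_congr
          (boundary.comp (homotopyL (F := F) β) + (homotopyL β).comp boundary)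
          (LinearMap.id - subdivideL (F := F) β) v (fun w hw => ih w.length (hv ▸ hw) w rfl)
        simp only [LinearMap.comp_apply, LinearMap.add_apply, LinearMap.sub_apply,
          LinearMap.id_apply] at this
        rw [boundary_boundary, map_zero, add_zero] at this
        rw [this, sub_sub_cancel]
        abel
  have : boundary.comp (homotopyL β) + (homotopyL β).comp boundary =
      LinearMap.id - subdivideL (F := F) β :=
    Finsupp.lhom_ext' fun v => LinearMap.ext_ring (key _ v rfl)
  exact LinearMap.congr_fun this c

/-- The chain map induced by a map of points. -/
noncomputable def map (g : K → L) : (List K →₀ F) →ₗ[F] (List L →₀ F) :=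
  Finsupp.lmapDomain F F (List.map g)

theorem map_single (g : K → L) (v : List K) (r : F) :
    map g (Finsupp.single v r) = Finsupp.single (v.map g) r := by
  simp [map, Finsupp.mapDomain_single]

theorem map_cone (g : K → L) (b : K) (c : List K →₀ F) :
    map g (cone b c) = cone (g b) (map g c) := by
  induction c using Finsupp.induction_linear with
  | zero => simp
  | add x y hx hy => simp only [map_add, hx, hy]
  | single v r => simp [cone_single, map_single]

theorem map_boundary_single (g : K → L) (v : List K) :
    map g (boundary (Finsupp.single v (1 : F))) = boundary (Finsupp.single (v.map g) 1) := by
  induction v with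
  | nil => simp [boundary_single]
  | cons b v ih =>
    rw [List.map_cons, boundary_single_cons, boundary_single_cons, map_sub, map_cone, ih,
      map_single]

theorem map_subdivide {β : List K → K} {β' : List L → L} (g : K → L)
    (h : ∀ v ≠ [], g (β v) = β' (v.map g)) (c : List K →₀ F) :
    map g (subdivideL β c) = subdivideL β' (map g c) := by
  have key : ∀ n : ℕ, ∀ v : List K, v.length = n →
      map g (subdivideL β (Finsupp.single v (1 : F))) =
        subdivideL β' (map g (Finsupp.single v (1 : F))) := by
    intro n
    induction n using Nat.strong_induction_on with
    | _ n ih =>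
      intro v hv
      by_cases h0 : v = []
      · subst h0
        simp [map_single, subdivideL_single, subdivide]
      · rw [map_single, subdivideL_single, subdivideL_single, subdivide_of_ne β h0,
          subdivide_of_ne β' (by simpa using h0), map_cone, h v h0, ← map_boundary_single]
        congr 1
        exact boundary_single_congr ((map g).comp (subdivideL (F := F) β))
          ((subdivideL β').comp (map g)) v (fun w hw => ih w.length (hv ▸ hw) w rfl)
  have : (map g).comp (subdivideL β) = (subdivideL β').comp (map (F := F) g) :=
    Finsupp.lhom_ext' fun v => LinearMap.ext_ring (key _ v rfl)
  exact LinearMap.congr_fun this c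

theorem map_homotopy {β : List K → K} {β' : List L → L} (g : K → L)
    (h : ∀ v ≠ [], g (β v) = β' (v.map g)) (c : List K →₀ F) :
    map g (homotopyL β c) = homotopyL β' (map g c) := by
  have key : ∀ n : ℕ, ∀ v : List K, v.length = n →
      map g (homotopyL β (Finsupp.single v (1 : F))) =
        homotopyL β' (map g (Finsupp.single v (1 : F))) := by
    intro n
    induction n using Nat.strong_induction_on with
    | _ n ih =>
      intro v hv
      by_cases h0 : v = []
      · subst h0
        simp [map_single, homotopyL_single, homotopy]
      · rw [map_single, homotopyL_single, homotopyL_single, homotopy_of_ne β h0,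
          homotopy_of_ne β' (by simpa using h0), map_cone, h v h0, ← map_boundary_single,
          map_sub, map_single]
        congr 2
        exact boundary_single_congr ((map g).comp (homotopyL (F := F) β))
          ((homotopyL β').comp (map g)) v (fun w hw => ih w.length (hv ▸ hw) w rfl)
  have : (map g).comp (homotopyL β) = (homotopyL β').comp (map (F := F) g) :=
    Finsupp.lhom_ext' fun v => LinearMap.ext_ring (key _ v rfl)
  exact LinearMap.congr_fun this c

/-- A linear map carries chains spanned by `s` to chains spanned by `t` if it does so for the
tuples in `s`. -/
theorem map_mem_supported {s : Set (List K)} {M : Submodule F (List L →₀ F)}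
    (f : (List K →₀ F) →ₗ[F] (List L →₀ F)) (h : ∀ v ∈ s, f (Finsupp.single v 1) ∈ M)
    {c : List K →₀ F} (hc : c ∈ Finsupp.supported F F s) : f c ∈ M := by
  rw [Finsupp.supported_eq_span_single] at hc
  induction hc using Submodule.span_induction with
  | mem x hx => obtain ⟨v, hv, rfl⟩ := hx; exact h v hv
  | zero => simp
  | add x y _ _ hx hy => rw [map_add]; exact add_mem hx hy
  | smul r x _ hx => rw [map_smul]; exact M.smul_mem r hx

end TupleChain

/-! ### Affine simplices in a standard simplex -/

namespace SingularSimplex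

/-- The standard `n`-simplex. -/
abbrev Std (n : ℕ) : Type := stdSimplex ℝ (Fin (n + 1))

/-- The affine simplex `Δᵖ → Δⁿ` whose `i`-th vertex is the `i`-th entry of the list `v`; missing
entries are replaced by the vertex `0`. -/
noncomputable def affine {n : ℕ} (v : List (Std n)) (p : ℕ) : SingularSimplex (Std n) p where
  toFun t := ⟨fun k => ∑ i : Fin (p + 1), t i * (v.getD i (stdSimplex.vertex 0)) k, by
    refine ⟨fun k => Finset.sum_nonneg fun i _ =>
      mul_nonneg (stdSimplex.zero_le _ _) (stdSimplex.zero_le _ _), ?_⟩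
    rw [Finset.sum_comm]
    simp_rw [← Finset.mul_sum, stdSimplex.sum_eq_one, mul_one]
    exact stdSimplex.sum_eq_one t⟩
  continuous_toFun := by
    refine Continuous.subtype_mk (continuous_pi fun k => continuous_finsetSum _ fun i _ => ?_) _
    exact ((continuous_apply i).comp continuous_subtype_val).mul continuous_const

theorem affine_apply {n : ℕ} (v : List (Std n)) (p : ℕ) (t : Std p) (k : Fin (n + 1)) :
    (affine v p t) k = ∑ i : Fin (p + 1), t i * (v.getD i (stdSimplex.vertex 0)) k := rfl

theorem reindex_affine {n : ℕ} (v : List (Std n)) (p m : ℕ) (g : ℕ → ℕ) (t : Std m)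
    (k : Fin (n + 1)) : ((affine v p).reindex m g t) k =
      ∑ i : Fin (m + 1), t i * (v.getD (min (g i) p) (stdSimplex.vertex 0)) k := by
  change (affine v p (stdSimplex.map _ t)) k = _
  rw [affine_apply]
  simp_rw [stdSimplex.map_coe, FunOnFinite.linearMap_apply_apply, Finset.sum_mul]
  rw [← Finset.sum_fiberwise Finset.univ
    (fun i : Fin (m + 1) => (⟨min (g i) p, by omega⟩ : Fin (p + 1)))]
  refine Finset.sum_congr rfl fun j _ => ?_
  refine Finset.sum_congr rfl fun i hi => ?_
  simp only [Finset.mem_filter, Finset.mem_univ, true_and] at hi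
  rw [← hi]

theorem face_affine {n : ℕ} (v : List (Std n)) (p i : ℕ) :
    (affine v (p + 1)).face i = affine (v.eraseIdx i) p := by
  ext t k
  rw [face, reindex_affine, affine_apply]
  refine Finset.sum_congr rfl fun j _ => ?_
  congr 2
  rw [List.getD_eq_getElem?_getD, List.getD_eq_getElem?_getD, List.getElem?_eraseIdx]
  have := j.2
  split_ifs
  · rw [min_eq_left (by omega)]
  · rw [min_eq_left (by omega)]

theorem affine_comp {n m : ℕ} (v : List (Std n)) (p : ℕ) (w : List (Std p))
    (hw : m < w.length) :
    (affine v p).comp (affine w m) = affine (w.map (affine v p)) m := by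
  ext t k
  change (affine v p (affine w m t)) k = _
  rw [affine_apply, affine_apply]
  simp_rw [affine_apply, Finset.sum_mul]
  rw [Finset.sum_comm]
  refine Finset.sum_congr rfl fun i _ => ?_
  have hi : (i : ℕ) < w.length := by omega
  rw [List.getD_eq_getElem _ _ hi, List.getD_eq_getElem _ _ (by simpa using hi), List.getElem_map,
    affine_apply, Finset.mul_sum]
  exact Finset.sum_congr rfl fun j _ => by ring

/-- The vertices of the standard simplex. -/
noncomputable def vertices (n : ℕ) : List (Std n) :=
  List.ofFn fun i : Fin (n + 1) => stdSimplex.vertex i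

@[simp] theorem length_vertices (n : ℕ) : (vertices n).length = n + 1 := by simp [vertices]

theorem getD_vertices {n : ℕ} (i : Fin (n + 1)) (d : Std n) :
    (vertices n).getD i d = stdSimplex.vertex i := by
  rw [List.getD_eq_getElem _ _ (by rw [length_vertices]; exact i.2)]
  exact List.getElem_ofFn _

theorem affine_vertices (n : ℕ) : affine (vertices n) n = ContinuousMap.id _ := by
  ext t k
  rw [affine_apply]
  rw [Finset.sum_eq_single k]
  · rw [getD_vertices]
    simp
  · intro i _ hi
    rw [getD_vertices]
    simp [hi.symm]
  · simp

theorem affine_vertex {n p : ℕ} (v : List (Std n)) (i : Fin (p + 1)) :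
    affine v p (stdSimplex.vertex i) = v.getD i (stdSimplex.vertex 0) := by
  ext k
  rw [affine_apply, Finset.sum_eq_single i]
  · simp
  · intro j _ hj
    simp [hj]
  · simp

theorem map_affine_vertices {n p : ℕ} {v : List (Std n)} (hv : v.length = p + 1) :
    (vertices p).map (affine v p) = v := by
  refine List.ext_getElem (by simp [hv]) fun i h1 h2 => ?_
  rw [List.getElem_map]
  simp only [vertices, List.getElem_ofFn]
  rw [affine_vertex, List.getD_eq_getElem]

/-- The barycenter of a nonempty list of points of the standard simplex. -/
noncomputable def bary {n : ℕ} (v : List (Std n)) : Std n :=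
  affine v (v.length - 1) stdSimplex.barycenter

theorem bary_eq {n p : ℕ} {v : List (Std n)} (hv : v.length = p + 1) :
    bary v = affine v p stdSimplex.barycenter := by
  obtain rfl : p = v.length - 1 := by omega
  rfl

theorem affine_bary {n p : ℕ} (v : List (Std n)) (w : List (Std p)) (hw : w ≠ []) :
    affine v p (bary w) = bary (w.map (affine v p)) := by
  have h := List.length_pos_iff.mpr hw
  have h1 : w.length = w.length - 1 + 1 := by omega
  rw [bary_eq h1, bary_eq ((List.length_map _).trans h1), ← affine_comp v p w (by omega)]
  rfl

theorem affine_mem_convexHull {n p : ℕ} {v : List (Std n)} (hv : v.length = p + 1) (t : Std p) :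
    (affine v p t).1 ∈ convexHull ℝ (Subtype.val '' {a | a ∈ v}) := by
  have : (affine v p t).1 =
      ∑ i : Fin (p + 1), t i • (v.getD i (stdSimplex.vertex 0)).1 := by
    ext k
    rw [Finset.sum_apply]
    exact affine_apply v p t k
  rw [this]
  refine Convex.sum_mem (convex_convexHull ℝ _) (fun i _ => stdSimplex.zero_le t i)
    (stdSimplex.sum_eq_one t) fun i _ => subset_convexHull ℝ _ ⟨_, ?_, rfl⟩
  rw [List.getD_eq_getElem _ _ (by omega)]
  exact List.getElem_mem _

/-- The barycenter of a `p`-simplex of diameter at most `d` has distance at most `p / (p + 1) * d`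
from the points of the simplex. -/
theorem dist_bary_le {n p : ℕ} {v : List (Std n)} (hv : v.length = p + 1) {d : ℝ}
    (hd : ∀ a ∈ v, ∀ b ∈ v, dist a b ≤ d) {y : Std n}
    (hy : y.1 ∈ convexHull ℝ (Subtype.val '' {a | a ∈ v})) :
    dist (bary v) y ≤ (p / (p + 1) : ℝ) * d := by
  have hb : (bary v).1 = ∑ i : Fin (p + 1), (1 / (p + 1) : ℝ) •
      (v.getD i (stdSimplex.vertex 0)).1 := by
    ext k
    rw [Finset.sum_apply]
    rw [bary_eq hv]
    refine (affine_apply v p _ k).trans (Finset.sum_congr rfl fun i _ => ?_)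
    have h3 : (stdSimplex.barycenter : Std p) i = 1 / (p + 1 : ℝ) := by
      refine (stdSimplex.barycenter_apply i).trans ?_
      simp
    rw [h3]
    rfl
  have hvert : ∀ a ∈ v, dist a.1 (bary v).1 ≤ (p / (p + 1) : ℝ) * d := by
    intro a ha
    obtain ⟨j, hj, rfl⟩ := List.getElem_of_mem ha
    have hp : (0 : ℝ) < p + 1 := by positivity
    have hdiff : v[j].1 - (bary v).1 = ∑ i : Fin (p + 1), (1 / (p + 1) : ℝ) •
        (v[j].1 - (v.getD i (stdSimplex.vertex 0)).1) := by
      simp_rw [smul_sub]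
      rw [Finset.sum_sub_distrib, ← hb, Finset.sum_const, Finset.card_univ, Fintype.card_fin,
        ← Nat.cast_smul_eq_nsmul ℝ, smul_smul]
      congr 1
      push_cast
      rw [mul_one_div_cancel hp.ne', one_smul]
    rw [dist_eq_norm, hdiff]
    have hjp : j < p + 1 := by omega
    calc ‖∑ i : Fin (p + 1), (1 / (p + 1) : ℝ) •
          (v[j].1 - (v.getD i (stdSimplex.vertex 0)).1)‖
        ≤ ∑ i : Fin (p + 1), (1 / (p + 1) : ℝ) * (if i = ⟨j, hjp⟩ then 0 else d) := by
          refine (norm_sum_le _ _).trans (Finset.sum_le_sum fun i _ => ?_)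
          rw [norm_smul, Real.norm_of_nonneg (by positivity)]
          refine mul_le_mul_of_nonneg_left ?_ (by positivity)
          split_ifs with h
          · subst h
            rw [List.getD_eq_getElem _ _ (by omega), sub_self, norm_zero]
          · rw [List.getD_eq_getElem _ _ (by omega), ← dist_eq_norm]
            exact hd _ (List.getElem_mem _) _ (List.getElem_mem _)
      _ = (p / (p + 1) : ℝ) * d := by
          rw [← Finset.mul_sum, Finset.sum_ite, Finset.sum_const_zero, zero_add, Finset.sum_const,
            Finset.filter_ne', Finset.card_erase_of_mem (Finset.mem_univ _), Finset.card_univ,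
            Fintype.card_fin, nsmul_eq_mul]
          simp only [Nat.add_sub_cancel]
          ring
  have hsub : convexHull ℝ (Subtype.val '' {a | a ∈ v}) ⊆
      Metric.closedBall (bary v).1 ((p / (p + 1) : ℝ) * d) := by
    refine convexHull_min ?_ (convex_closedBall _ _)
    rintro _ ⟨a, ha, rfl⟩
    exact hvert a ha
  have := hsub hy
  rw [Metric.mem_closedBall, dist_comm] at this
  exact this

end SingularSimplex

namespace TupleChain
open SingularSimplex
variable {F : Type v} [Field F]

/-- Lists of at most `N` points, in the convex hull of the set `C`, with mutual distances at most
`d`. -/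
def smallTuples {n : ℕ} (N : ℕ) (d : ℝ) (C : Set (Std n)) : Set (List (Std n)) :=
  {v | v.length ≤ N ∧ (∀ a ∈ v, ∀ b ∈ v, dist a b ≤ d) ∧
    ∀ a ∈ v, a.1 ∈ convexHull ℝ (Subtype.val '' C)}

theorem smallTuples_mono {n N M : ℕ} {d e : ℝ} {C D : Set (Std n)} (hN : N ≤ M) (hd : d ≤ e)
    (hC : C ⊆ D) : smallTuples N d C ⊆ smallTuples M e D := fun _ hv =>
  ⟨hv.1.trans hN, fun a ha b hb => (hv.2.1 a ha b hb).trans hd,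
    fun a ha => convexHull_mono (Set.image_mono hC) (hv.2.2 a ha)⟩

/-- Barycentric subdivision of a tuple of at most `N + 1` points of mutual distance at most `d`
yields tuples of points at mutual distance at most `N / (N + 1) * d`. -/
theorem subdivide_mem_supported {n N : ℕ} {d : ℝ} (hd0 : 0 ≤ d) (v : List (Std n))
    (hv : v.length ≤ N + 1) (hd : ∀ a ∈ v, ∀ b ∈ v, dist a b ≤ d) :
    subdivide (F := F) bary v ∈ Finsupp.supported F F
      (smallTuples (v.length) ((N / (N + 1) : ℝ) * d) {a | a ∈ v}) := by
  induction hk : v.length using Nat.strong_induction_on generalizing v with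
  | _ k ih =>
    subst hk
    by_cases h0 : v = []
    · subst h0
      rw [subdivide]
      exact Finsupp.single_mem_supported F 1 ⟨le_rfl, by simp, by simp⟩
    · obtain ⟨p, hp⟩ : ∃ p, v.length = p + 1 :=
        ⟨v.length - 1, by have := List.length_pos_iff.mpr h0; omega⟩
      have hκ : (p / (p + 1) : ℝ) * d ≤ (N / (N + 1) : ℝ) * d := by
        refine mul_le_mul_of_nonneg_right ?_ hd0
        rw [div_le_div_iff₀ (by positivity) (by positivity)]
        have : (p : ℝ) ≤ N := by exact_mod_cast (by omega : p ≤ N)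
        nlinarith
      rw [subdivide_of_ne _ h0, boundary_single, map_sum]
      refine map_mem_supported (s := smallTuples p ((N / (N + 1) : ℝ) * d) {a | a ∈ v}) _ ?_ ?_
      · intro w hw
        rw [cone_single]
        refine Finsupp.single_mem_supported F 1 ⟨by simpa [hp] using hw.1, ?_, ?_⟩
        · have hb : ∀ y ∈ w, dist (bary v) y ≤ (N / (N + 1) : ℝ) * d := fun y hy =>
            (dist_bary_le hp hd (hw.2.2 y hy)).trans hκ
          intro a ha b hb'
          rcases List.mem_cons.mp ha with rfl | ha
          · rcases List.mem_cons.mp hb' with rfl | hb'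
            · rw [dist_self]; positivity
            · exact hb b hb'
          · rcases List.mem_cons.mp hb' with rfl | hb'
            · rw [dist_comm]; exact hb a ha
            · exact hw.2.1 a ha b hb'
        · intro a ha
          rcases List.mem_cons.mp ha with rfl | ha
          · rw [bary]
            exact affine_mem_convexHull (by omega) _
          · exact hw.2.2 a ha
      · refine Submodule.sum_mem _ fun i _ => ?_
        rw [map_smul, subdivideL_single]
        refine Submodule.smul_mem _ _ ?_
        have hlen : (v.eraseIdx i).length = p := by
          rw [List.length_eraseIdx_of_lt i.2]; omega
        have hsub : ∀ a ∈ v.eraseIdx i, a ∈ v := fun a ha => List.mem_of_mem_eraseIdx ha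
        have := ih (v.eraseIdx i).length (by omega) (v.eraseIdx i) (by omega)
          (fun a ha b hb => hd a (hsub a ha) b (hsub b hb)) rfl
        exact Finsupp.supported_mono (smallTuples_mono hlen.le le_rfl hsub) this

theorem subdivideL_iterate_mem_supported {n N : ℕ} {d : ℝ} (hd0 : 0 ≤ d) {c : List (Std n) →₀ F}
    (hc : c ∈ Finsupp.supported F F (smallTuples (N + 1) d Set.univ)) (m : ℕ) :
    (subdivideL bary)^[m] c ∈ Finsupp.supported F F
      (smallTuples (N + 1) ((N / (N + 1) : ℝ) ^ m * d) Set.univ) := by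
  induction m with
  | zero => simpa using hc
  | succ m ih =>
    rw [Function.iterate_succ_apply']
    refine map_mem_supported _ (fun v hv => ?_) ih
    rw [subdivideL_single]
    refine Finsupp.supported_mono ?_
      (subdivide_mem_supported (by positivity) v hv.1 hv.2.1)
    exact smallTuples_mono hv.1 (by rw [pow_succ]; linarith) (Set.subset_univ _)

/-- Every chain has only finitely many tuples, which are bounded in length and diameter. -/
theorem exists_mem_supported_smallTuples {n : ℕ} (c : List (Std n) →₀ F) :
    ∃ N : ℕ, c ∈ Finsupp.supported F F (smallTuples (N + 1) 1 Set.univ) := by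
  refine ⟨c.support.sup List.length, fun v hv => ⟨?_, fun a _ b _ => ?_, fun a _ => ?_⟩⟩
  · exact (Finset.le_sup (f := List.length) hv).trans (Nat.le_succ _)
  · exact (Metric.dist_le_diam_of_mem (bounded_stdSimplex _) a.2 b.2).trans
      diam_stdSimplex_le
  · exact subset_convexHull ℝ _ ⟨a, trivial, rfl⟩

end TupleChain

/-! ### Cochains that vanish on small simplices -/

namespace SingularCochain
open SingularSimplex TupleChain
variable {F : Type v} [Field F] {X : Type u} [TopologicalSpace X]

/-- The value of the cochain `x` on the image under `σ` of a chain of affine simplices; the empty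
tuple has value `0`. -/
noncomputable def evalChain (x : SingularCochain F X) {n : ℕ} (σ : SingularSimplex X n) :
    (List (Std n) →₀ F) →ₗ[F] F :=
  Finsupp.linearCombination F
    fun v => if v = [] then 0 else x (v.length - 1) (σ.comp (affine v (v.length - 1)))

variable (x : SingularCochain F X) {n : ℕ} (σ : SingularSimplex X n)

theorem evalChain_nil : evalChain x σ (Finsupp.single [] 1) = 0 := by simp [evalChain]

theorem evalChain_single {v : List (Std n)} {p : ℕ} (hv : v.length = p + 1) :
    evalChain x σ (Finsupp.single v 1) = x p (σ.comp (affine v p)) := by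
  obtain rfl : p = v.length - 1 := by omega
  have : v ≠ [] := by rintro rfl; simp at hv
  simp [evalChain, this]

theorem evalChain_vertices : evalChain x σ (Finsupp.single (vertices n) 1) = x n σ := by
  rw [evalChain_single x σ (length_vertices n), affine_vertices, ContinuousMap.comp_id]

theorem evalChain_comp_affine {p : ℕ} {v : List (Std n)} (c : List (Std p) →₀ F) :
    evalChain x (σ.comp (affine v p)) c = evalChain x σ (TupleChain.map (affine v p) c) := by
  have : evalChain x (σ.comp (affine v p)) =
      (evalChain x σ).comp (TupleChain.map (affine v p)) := by
    refine Finsupp.lhom_ext' fun w => LinearMap.ext_ring ?_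
    simp only [LinearMap.comp_apply, Finsupp.lsingle_apply]
    rw [map_single]
    by_cases h0 : w = []
    · subst h0
      rw [List.map_nil, evalChain_nil, evalChain_nil]
    · have h1 := List.length_pos_iff.mpr h0
      have h2 : w.length = w.length - 1 + 1 := by omega
      rw [evalChain_single _ _ h2, evalChain_single _ _ ((List.length_map _).trans h2),
        ← affine_comp v p w (by omega)]
      rfl
  exact LinearMap.congr_fun this c

theorem evalChain_coboundary (c : List (Std n) →₀ F) :
    evalChain (coboundary x) σ c = evalChain x σ (boundary c) := by
  have : evalChain (coboundary x) σ = (evalChain x σ).comp boundary := by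
    refine Finsupp.lhom_ext' fun w => LinearMap.ext_ring ?_
    simp only [LinearMap.comp_apply, Finsupp.lsingle_apply]
    rw [boundary_single]
    rcases h : w with _ | ⟨a, _ | ⟨b, w'⟩⟩
    · rw [evalChain_nil]; simp
    · rw [evalChain_single _ _ (p := 0) rfl, coboundary_zero]
      simp [evalChain_nil]
    · rw [evalChain_single _ _ (p := w'.length + 1) rfl, coboundary_succ, map_sum,
        Finset.sum_range]
      refine Finset.sum_congr rfl fun i _ => ?_
      have hl : ((a :: b :: w').eraseIdx i).length = w'.length + 1 := by
        rw [List.length_eraseIdx_of_lt i.2]; simp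
      rw [map_smul, smul_eq_mul, evalChain_single _ _ hl, ← face_affine]
      rfl
  exact LinearMap.congr_fun this c

theorem coboundary_coboundary : coboundary (coboundary x) = 0 := by
  ext n σ
  refine (evalChain_vertices _ σ).symm.trans ?_
  rw [evalChain_coboundary, evalChain_coboundary, boundary_boundary, map_zero]
  rfl

/-- The barycentric subdivision operator on cochains. -/
noncomputable def subdivision : SingularCochain F X :=
  fun n σ => evalChain x σ (subdivideL bary (Finsupp.single (vertices n) 1))

/-- The cochain homotopy between barycentric subdivision and the identity. -/
noncomputable def subdivisionHomotopy : SingularCochain F X :=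
  fun n σ => evalChain x σ (homotopyL bary (Finsupp.single (vertices n) 1))

theorem evalChain_subdivision (c : List (Std n) →₀ F) :
    evalChain (subdivision x) σ c = evalChain x σ (subdivideL bary c) := by
  have : evalChain (subdivision x) σ = (evalChain x σ).comp (subdivideL bary) := by
    refine Finsupp.lhom_ext' fun w => LinearMap.ext_ring ?_
    simp only [LinearMap.comp_apply, Finsupp.lsingle_apply]
    by_cases h0 : w = []
    · subst h0
      rw [evalChain_nil, subdivideL_single, subdivide, evalChain_nil]
    · have h1 := List.length_pos_iff.mpr h0
      have h2 : w.length = w.length - 1 + 1 := by omega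
      rw [evalChain_single _ _ h2, subdivision, evalChain_comp_affine,
        map_subdivide (β' := bary) _ (affine_bary w), map_single, map_affine_vertices h2]
  exact LinearMap.congr_fun this c

theorem evalChain_subdivisionHomotopy (c : List (Std n) →₀ F) :
    evalChain (subdivisionHomotopy x) σ c = evalChain x σ (homotopyL bary c) := by
  have : evalChain (subdivisionHomotopy x) σ = (evalChain x σ).comp (homotopyL bary) := by
    refine Finsupp.lhom_ext' fun w => LinearMap.ext_ring ?_
    simp only [LinearMap.comp_apply, Finsupp.lsingle_apply]
    by_cases h0 : w = []
    · subst h0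
      rw [evalChain_nil, homotopyL_single, homotopy, map_zero]
    · have h1 := List.length_pos_iff.mpr h0
      have h2 : w.length = w.length - 1 + 1 := by omega
      rw [evalChain_single _ _ h2, subdivisionHomotopy, evalChain_comp_affine,
        map_homotopy (β' := bary) _ (affine_bary w), map_single, map_affine_vertices h2]
  exact LinearMap.congr_fun this c

theorem evalChain_iterate_subdivision (m : ℕ) (c : List (Std n) →₀ F) :
    evalChain (subdivision^[m] x) σ c = evalChain x σ ((subdivideL bary)^[m] c) := by
  induction m generalizing c with
  | zero => rfl
  | succ m ih =>
    rw [Function.iterate_succ_apply', evalChain_subdivision, ih, ← Function.iterate_succ_apply]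

theorem coboundary_subdivision : coboundary (subdivision x) = subdivision (coboundary x) := by
  ext n σ
  refine (evalChain_vertices _ σ).symm.trans ?_
  rw [evalChain_coboundary, evalChain_subdivision, ← boundary_subdivide, ← evalChain_coboundary]
  rfl

theorem coboundary_subdivisionHomotopy (hx : coboundary x = 0) :
    coboundary (subdivisionHomotopy x) = x - subdivision x := by
  ext n σ
  have h := congrArg (evalChain x σ)
    (boundary_homotopy bary (Finsupp.single (vertices n) (1 : F)))
  rw [map_add, ← evalChain_coboundary, hx, map_sub, evalChain_vertices] at h
  have h0 : evalChain (0 : SingularCochain F X) σ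
      (homotopyL bary (Finsupp.single (vertices n) 1)) = 0 := by
    simp [evalChain, Finsupp.linearCombination_apply]
  rw [h0, zero_add, ← evalChain_subdivisionHomotopy, ← evalChain_coboundary,
    evalChain_vertices] at h
  rw [h, sub_eq_add_neg, sub_eq_add_neg]
  rfl

/-- A cochain that vanishes on the simplices contained in one of two open sets covering `X`
vanishes on the sufficiently often subdivided chains. -/
theorem eventually_evalChain_iterate_eq_zero {U V : Set X} (hU : IsOpen U) (hV : IsOpen V)
    (hUV : U ∪ V = Set.univ)
    (hx : ∀ n (σ : SingularSimplex X n), Set.range σ ⊆ U ∨ Set.range σ ⊆ V → x n σ = 0)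
    (c : List (Std n) →₀ F) :
    ∃ M : ℕ, ∀ m ≥ M, evalChain x σ ((subdivideL bary)^[m] c) = 0 := by
  obtain ⟨N, hN⟩ := exists_mem_supported_smallTuples c
  obtain ⟨ε, hε, hball⟩ := lebesgue_number_lemma_of_metric (s := (Set.univ : Set (Std n)))
    (c := fun b : Bool => σ ⁻¹' (if b then U else V)) isCompact_univ
    (fun b => by
      cases b
      · exact hV.preimage σ.continuous
      · exact hU.preimage σ.continuous)
    (fun t _ => by
      have : σ t ∈ U ∪ V := hUV ▸ Set.mem_univ _
      rw [Set.mem_iUnion]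
      rcases this with h | h
      · exact ⟨true, h⟩
      · exact ⟨false, h⟩)
  have hlim : Tendsto (fun m : ℕ => ((N / (N + 1) : ℝ) ^ m * 1)) atTop (𝓝 (0 * 1)) := by
    refine (tendsto_pow_atTop_nhds_zero_of_lt_one (by positivity) ?_).mul_const 1
    rw [div_lt_one (by positivity)]
    linarith
  rw [zero_mul] at hlim
  obtain ⟨M, hM⟩ := (hlim.eventually (gt_mem_nhds hε)).exists_forall_of_atTop
  refine ⟨M, fun m hm => ?_⟩
  have hsupp := subdivideL_iterate_mem_supported zero_le_one hN m
  have hzero : evalChain x σ ((subdivideL bary)^[m] c) ∈ (⊥ : Submodule F F) := by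
    rw [Finsupp.supported_eq_span_single] at hsupp
    generalize (subdivideL bary)^[m] c = e at hsupp
    induction hsupp using Submodule.span_induction with
    | zero => simp
    | add y z _ _ hy hz => rw [map_add]; exact add_mem hy hz
    | smul r y _ hy => rw [map_smul]; exact Submodule.smul_mem _ r hy
    | mem y hy =>
      obtain ⟨v, hv, rfl⟩ := hy
      dsimp only
      rw [Submodule.mem_bot]
      by_cases h0 : v = []
      · subst h0; exact evalChain_nil x σ
      · have h1 := List.length_pos_iff.mpr h0
        have h2 : v.length = v.length - 1 + 1 := by omega
        rw [evalChain_single _ _ h2]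
        obtain ⟨a, ha⟩ := List.exists_mem_of_ne_nil v h0
        obtain ⟨b, hb⟩ := hball a (Set.mem_univ a)
        have hrange : Set.range (σ.comp (affine v (v.length - 1))) ⊆ if b then U else V := by
          rintro _ ⟨t, rfl⟩
          refine hb (a := affine v (v.length - 1) t) ?_
          -- a closed ball is convex, so it contains the hull of the vertices
          have hsub : convexHull ℝ (Subtype.val '' {e | e ∈ v}) ⊆
              Metric.closedBall a.1 ((N / (N + 1) : ℝ) ^ m * 1) := by
            refine convexHull_min ?_ (convex_closedBall _ _)
            rintro _ ⟨e, he, rfl⟩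
            exact hv.2.1 e he a ha
          exact (hsub (affine_mem_convexHull h2 t)).trans_lt (hM m hm)
        refine hx _ _ ?_
        cases b
        · exact Or.inr hrange
        · exact Or.inl hrange
  simpa using hzero

/-- A cocycle that vanishes on all the simplices contained in one of two open sets covering `X` is
a coboundary. -/
theorem exists_coboundary_eq_of_vanishing {U V : Set X} (hU : IsOpen U) (hV : IsOpen V)
    (hUV : U ∪ V = Set.univ)
    (hx : ∀ n (σ : SingularSimplex X n), Set.range σ ⊆ U ∨ Set.range σ ⊆ V → x n σ = 0)
    (hd : coboundary x = 0) : ∃ y : SingularCochain F X, coboundary y = x := by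
  have hev := fun {n : ℕ} (σ : SingularSimplex X n) =>
    eventually_evalChain_iterate_eq_zero x σ hU hV hUV hx
  have hd' : ∀ m : ℕ, coboundary (subdivision^[m] x) = 0 := by
    intro m
    induction m with
    | zero => exact hd
    | succ m ih =>
      rw [Function.iterate_succ_apply', coboundary_subdivision, ih]
      ext n σ
      simp [subdivision, evalChain, Finsupp.linearCombination_apply]
  have hy : ∀ (n : ℕ) (σ : SingularSimplex X n), ∃ M : ℕ, ∀ m ≥ M,
      subdivisionHomotopy (subdivision^[m] x) n σ = 0 := by
    intro n σ
    obtain ⟨M, hM⟩ := hev σ (homotopyL bary (Finsupp.single (vertices n) 1))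
    exact ⟨M, fun m hm => (evalChain_iterate_subdivision x σ m _).trans (hM m hm)⟩
  choose M hM using hy
  -- the telescoping sum of the homotopies, which is finite on every simplex
  let y : ℕ → SingularCochain F X := fun k =>
    ∑ m ∈ range k, subdivisionHomotopy (subdivision^[m] x)
  have hsum : ∀ (k n : ℕ) (σ : SingularSimplex X n), y k n σ =
      ∑ m ∈ range k, subdivisionHomotopy (subdivision^[m] x) n σ := by
    intro k n σ
    induction k with
    | zero => rfl
    | succ k ih =>
      simp only [y, Finset.sum_range_succ] at ih ⊢
      rw [add_apply, ih]
  have hstab : ∀ (k n : ℕ) (σ : SingularSimplex X n), M n σ ≤ k → y k n σ = y (M n σ) n σ := by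
    intro k n σ hk
    rw [hsum, hsum]
    refine (Finset.sum_subset (Finset.range_mono hk) fun m _ hm => ?_).symm
    exact hM n σ m (by simpa using hm)
  have hδ : ∀ k, coboundary (y k) = x - subdivision^[k] x := by
    intro k
    induction k with
    | zero => simp [y]
    | succ k ih =>
      have : y (k + 1) = y k + subdivisionHomotopy (subdivision^[k] x) :=
        Finset.sum_range_succ _ _
      rw [this, map_add, ih, coboundary_subdivisionHomotopy _ (hd' k),
        Function.iterate_succ_apply']
      abel
  let y' : SingularCochain F X := fun n σ => y (M n σ) n σ
  refine ⟨y', ?_⟩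
  ext n σ
  -- on the finitely many faces of `σ` the sum has stabilized at a common stage `k`
  obtain ⟨K, hK⟩ := hev σ (Finsupp.single (vertices n) 1)
  obtain ⟨k, hk, hyk⟩ : ∃ k ≥ K, coboundary y' n σ = coboundary (y k) n σ := by
    rcases n with _ | n
    · exact ⟨K, le_rfl, rfl⟩
    · refine ⟨K + (range (n + 2)).sup (fun i => M n (σ.face i)), Nat.le_add_right _ _, ?_⟩
      rw [coboundary_succ, coboundary_succ]
      refine Finset.sum_congr rfl fun i hi => ?_
      rw [hstab (K + _) n (σ.face i)
        ((Finset.le_sup (f := fun i => M n (σ.face i)) hi).trans (Nat.le_add_left _ _))]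
  rw [hyk, hδ, sub_eq_add_neg, add_apply, neg_apply, ← evalChain_vertices (subdivision^[k] x),
    evalChain_iterate_subdivision, hK k hk, neg_zero, add_zero]

theorem sgn_sgn : sgn (sgn x) = x := by
  ext n σ
  simp only [sgn, ← mul_assoc, ← mul_pow]
  simp

end SingularCochain

section Support
open SingularCochain
variable {F : Type v} [Field F] {X : Type u} [TopologicalSpace X]

theorem cohomologyClass_eq_zero {z : singularCocycles F X} :
    cohomologyClass F X z = 0 ↔ ∃ y : SingularCochain F X, coboundary y = z := by
  exact Ideal.Quotient.eq_zero_iff_mem (I := singularCoboundaries F X)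

theorem cohomologyRestrict_class_eq_zero {U : Set X} {z : singularCocycles F X} :
    cohomologyRestrict U (cohomologyClass F X z) = 0 ↔
      ∃ y : SingularCochain F U, coboundary y =
        SingularCochain.comap ⟨((↑) : U → X), continuous_subtype_val⟩ z.1 :=
  cohomologyClass_eq_zero

/-- A class that vanishes on `U` is represented by a cochain that vanishes on the simplices
in `U`. -/
theorem exists_vanishing_representative {U : Set X} {z : SingularCochain F X}
    (h : ∃ y : SingularCochain F U, coboundary y =
      SingularCochain.comap ⟨((↑) : U → X), continuous_subtype_val⟩ z) :
    ∃ y : SingularCochain F X, ∀ n (σ : SingularSimplex X n), Set.range σ ⊆ U →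
      (z - coboundary y) n σ = 0 := by
  classical
  obtain ⟨y, hy⟩ := h
  let y' : SingularCochain F X := fun n σ =>
    if h : ∀ t, σ t ∈ U then y n ⟨fun t => ⟨σ t, h t⟩, by fun_prop⟩ else 0
  have hy' : SingularCochain.comap ⟨((↑) : U → X), continuous_subtype_val⟩ y' = y := by
    ext n τ
    exact dif_pos fun t => (τ t).2
  refine ⟨y', fun n σ hσ => ?_⟩
  have hσ' : ∀ t, σ t ∈ U := fun t => hσ ⟨t, rfl⟩
  have h2 := coboundary_comap (⟨((↑) : U → X), continuous_subtype_val⟩ : C(U, X)) y'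
  rw [hy', hy] at h2
  have h3 : z n σ = coboundary y' n σ :=
    congrFun (congrFun h2 n) (⟨fun t => ⟨σ t, hσ' t⟩, by fun_prop⟩ : SingularSimplex U n)
  rw [sub_eq_add_neg, SingularCochain.add_apply, SingularCochain.neg_apply, h3, add_neg_cancel]

/-- If `a` vanishes on the open set `U` and `b` on the open set `V`, then `a ∧ b` vanishes on
`U ∪ V`. -/
theorem cohomologyRestrict_union_mul {U V : Set X} (hU : IsOpen U) (hV : IsOpen V)
    {a b : SingularCohomology F X} (ha : cohomologyRestrict U a = 0)
    (hb : cohomologyRestrict V b = 0) : cohomologyRestrict (U ∪ V) (a * b) = 0 := by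
  obtain ⟨α, rfl⟩ := cohomologyClass_surjective F X a
  obtain ⟨β, rfl⟩ := cohomologyClass_surjective F X b
  rw [cohomologyRestrict_class_eq_zero] at ha hb
  obtain ⟨y, hy⟩ := exists_vanishing_representative ha
  obtain ⟨w, hw⟩ := exists_vanishing_representative hb
  rw [← map_mul, cohomologyRestrict_class_eq_zero]
  -- `α'` and `β'` vanish on the simplices in `U` and in `V`, hence `α' * β'` on both
  set α' := α.1 - coboundary y with hα'
  set β' := β.1 - coboundary w with hβ'
  have dα' : coboundary α' = 0 := by rw [hα', map_sub, α.2.1, coboundary_coboundary, sub_zero]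
  have dβ' : coboundary β' = 0 := by rw [hβ', map_sub, β.2.1, coboundary_coboundary, sub_zero]
  have sgn_zero : sgn (0 : SingularCochain F X) = 0 := by ext n σ; simp [sgn]
  have hprod : (α * β : singularCocycles F X).1 =
      α' * β' + coboundary (y * β.1 + sgn α' * w) := by
    rw [map_add, coboundary_mul, coboundary_mul, coboundary_sgn, dα', β.2.1, sgn_zero, neg_zero,
      zero_mul, zero_add, mul_zero, add_zero, sgn_sgn]
    change α.1 * β.1 = _
    rw [hα', hβ']
    noncomm_ring
  let ι : C(((U ∪ V : Set X)), X) := ⟨Subtype.val, continuous_subtype_val⟩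
  obtain ⟨r, hr⟩ := exists_coboundary_eq_of_vanishing (comap ι (α' * β'))
    (hU.preimage ι.continuous) (hV.preimage ι.continuous)
    (Set.eq_univ_of_forall fun t => t.2)
    (fun n σ hσ => by
      rw [SingularCochain.comap_mul, mul_apply]
      refine Finset.sum_eq_zero fun pq _ => ?_
      rcases hσ with hσ | hσ
      · have : SingularCochain.comap ι α' pq.1 (σ.front pq.1) = 0 := by
          refine hy _ _ ?_
          rintro _ ⟨t, rfl⟩
          exact hσ ⟨_, rfl⟩
        rw [this, zero_mul]
      · have : SingularCochain.comap ι β' pq.2 (σ.back pq.2) = 0 := by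
          refine hw _ _ ?_
          rintro _ ⟨t, rfl⟩
          exact hσ ⟨_, rfl⟩
        rw [this, mul_zero])
    (by
      rw [coboundary_comap, coboundary_mul, dα', dβ', zero_mul, mul_zero, add_zero]
      rfl)
  refine ⟨r + SingularCochain.comap ι (y * β.1 + sgn α' * w), ?_⟩
  rw [map_add, hr, coboundary_comap, hprod]
  rfl

/-- The support of a cup product is contained in the intersection of the supports. -/
theorem mul_mem_supportedIn {O O' : Set X} {a b : SingularCohomology F X}
    (ha : a ∈ supportedIn O) (hb : b ∈ supportedIn O') : a * b ∈ supportedIn (O ∩ O') := by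
  obtain ⟨U, hU, hOU, ha⟩ := ha
  obtain ⟨V, hV, hOV, hb⟩ := hb
  refine ⟨U ∪ V, hU.union hV, ?_, cohomologyRestrict_union_mul hU hV ha hb⟩
  rw [Set.eq_univ_iff_forall] at hOU hOV ⊢
  intro x
  have := hOU x
  have := hOV x
  simp only [Set.mem_union, Set.mem_inter_iff] at *
  tauto

theorem supportedIn_mono {O O' : Set X} (h : O ⊆ O') :
    (supportedIn O : Submodule F (SingularCohomology F X)) ≤ supportedIn O' := by
  rintro a ⟨U, hU, hOU, ha⟩
  exact ⟨U, hU, Set.eq_univ_of_univ_subset (hOU ▸ Set.union_subset_union_left U h), ha⟩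

end Support

/-! ### The grading of singular cohomology -/

namespace SingularCochain
variable {F : Type v} [Field F] {X : Type u} [TopologicalSpace X]

/-- The homogeneous component of degree `n` of a family of cochains. -/
def component (n : ℕ) : SingularCochain F X →ₗ[F] SingularCochain F X where
  toFun x m σ := if m = n then x m σ else 0
  map_add' x y := by
    ext m σ
    change (if m = n then x m σ + y m σ else 0) =
      (if m = n then x m σ else 0) + if m = n then y m σ else 0
    split_ifs
    · rfl
    · rw [add_zero]
  map_smul' r x := by
    ext m σ
    change (if m = n then r * x m σ else 0) = r * if m = n then x m σ else 0
    split_ifs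
    · rfl
    · rw [mul_zero]

theorem component_apply (n : ℕ) (x : SingularCochain F X) (m : ℕ) (σ : SingularSimplex X m) :
    component n x m σ = if m = n then x m σ else 0 := rfl

theorem coboundary_component (n : ℕ) (x : SingularCochain F X) :
    coboundary (component n x) = component (n + 1) (coboundary x) := by
  ext m σ
  rcases m with _ | m
  · rw [component_apply, coboundary_zero, coboundary_zero, ite_self]
  · rw [component_apply, coboundary_succ, coboundary_succ]
    simp only [component_apply, Nat.add_right_cancel_iff]
    split_ifs <;> simp

theorem sgn_mul (x y : SingularCochain F X) : sgn (x * y) = sgn x * sgn y := by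
  ext n σ
  rw [mul_apply]
  simp only [sgn]
  rw [mul_apply, Finset.mul_sum]
  refine Finset.sum_congr rfl fun pq h => ?_
  have hn : (-1 : F) ^ n = (-1) ^ pq.1 * (-1) ^ pq.2 := by
    rw [← pow_add, HasAntidiagonal.mem_antidiagonal.mp h]
  rw [hn]
  ring

end SingularCochain

section Grading
open SingularCochain
variable {F : Type v} [Field F] {X : Type u} [TopologicalSpace X]

/-- The map on cohomology induced by a linear map on cocycles that vanishes on coboundaries. -/
noncomputable def cohomologyLift {M : Type*} [AddCommGroup M] [Module F M]
    (f : singularCocycles F X →ₗ[F] M)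
    (h : ∀ z, cohomologyClass F X z = 0 → f z = 0) : SingularCohomology F X →ₗ[F] M :=
  (Submodule.liftQ (LinearMap.ker (cohomologyClass F X).toLinearMap) f h).comp
    ((cohomologyClass F X).toLinearMap.quotKerEquivOfSurjective
      (cohomologyClass_surjective F X)).symm.toLinearMap

theorem cohomologyLift_class {M : Type*} [AddCommGroup M] [Module F M]
    (f : singularCocycles F X →ₗ[F] M)
    (h : ∀ z, cohomologyClass F X z = 0 → f z = 0) (z : singularCocycles F X) :
    cohomologyLift f h (cohomologyClass F X z) = f z := by
  have : ((cohomologyClass F X).toLinearMap.quotKerEquivOfSurjective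
      (cohomologyClass_surjective F X)).symm (cohomologyClass F X z) =
      Submodule.Quotient.mk z := by
    rw [LinearEquiv.symm_apply_eq]
    rfl
  simp only [cohomologyLift, LinearMap.comp_apply, LinearEquiv.coe_coe, this]
  rfl

/-- The homogeneous component of degree `n` of a cocycle. -/
noncomputable def cocycleComponent (n : ℕ) : singularCocycles F X →ₗ[F] singularCocycles F X where
  toFun z := ⟨component n z.1, by rw [coboundary_component, z.2.1, map_zero], by
    obtain ⟨N, hN⟩ := z.2.2
    refine ⟨N, fun m hm σ => ?_⟩
    rw [component_apply, hN m hm, ite_self]⟩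
  map_add' a b := Subtype.ext (map_add (component n) a.1 b.1)
  map_smul' r a := Subtype.ext (map_smul (component n) r a.1)

/-- The cocycle `z` with the component of degree `n` multiplied by `(-1)ⁿ`. -/
noncomputable def cocycleSign : singularCocycles F X →ₗ[F] singularCocycles F X where
  toFun z := ⟨sgn z.1, by
    rw [coboundary_sgn, z.2.1]
    ext n σ
    simp [sgn], by
    obtain ⟨N, hN⟩ := z.2.2
    exact ⟨N, fun m hm σ => by simp [sgn, hN m hm]⟩⟩
  map_add' a b := Subtype.ext (SingularCochain.ext fun n σ => mul_add _ _ _)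
  map_smul' r a := Subtype.ext (SingularCochain.ext fun n σ => mul_left_comm _ _ _)

/-- The projection of `H^⋆(X; F)` to its homogeneous part of degree `n`. -/
noncomputable def degreeComponent (n : ℕ) : SingularCohomology F X →ₗ[F] SingularCohomology F X :=
  cohomologyLift ((cohomologyClass F X).toLinearMap.comp (cocycleComponent n)) fun z hz => by
    rw [cohomologyClass_eq_zero] at hz
    obtain ⟨y, hy⟩ := hz
    refine cohomologyClass_eq_zero.mpr ?_
    rcases n with _ | n
    · refine ⟨0, ?_⟩
      rw [map_zero]
      ext m σ
      change 0 = if m = 0 then z.1 m σ else 0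
      split_ifs with h
      · subst h
        rw [← hy, coboundary_zero]
      · rfl
    · exact ⟨component n y, by rw [coboundary_component, hy]; rfl⟩

/-- The grading involution of `H^⋆(X; F)`, multiplication by `(-1)ⁿ` in degree `n`. -/
noncomputable def gradeSign : SingularCohomology F X →ₗ[F] SingularCohomology F X :=
  cohomologyLift ((cohomologyClass F X).toLinearMap.comp cocycleSign) fun z hz => by
    rw [cohomologyClass_eq_zero] at hz
    obtain ⟨y, hy⟩ := hz
    refine cohomologyClass_eq_zero.mpr ⟨-sgn y, ?_⟩
    rw [map_neg, coboundary_sgn, neg_neg, hy]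
    rfl

theorem degreeComponent_class (n : ℕ) (z : singularCocycles F X) :
    degreeComponent n (cohomologyClass F X z) = cohomologyClass F X (cocycleComponent n z) :=
  cohomologyLift_class _ _ z

theorem gradeSign_class (z : singularCocycles F X) :
    gradeSign (cohomologyClass F X z) = cohomologyClass F X (cocycleSign z) :=
  cohomologyLift_class _ _ z

theorem exists_of_mem_homogeneousPart {n : ℕ} {a : SingularCohomology F X}
    (h : a ∈ homogeneousPart F X n) :
    ∃ z : singularCocycles F X, (∀ m, m ≠ n → ∀ σ, z.1 m σ = 0) ∧ cohomologyClass F X z = a := h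

theorem degreeComponent_mem (n : ℕ) (a : SingularCohomology F X) :
    degreeComponent n a ∈ homogeneousPart F X n := by
  obtain ⟨z, rfl⟩ := cohomologyClass_surjective F X a
  rw [degreeComponent_class]
  exact ⟨_, fun m hm σ => if_neg hm, rfl⟩

theorem degreeComponent_of_mem {n : ℕ} {a : SingularCohomology F X}
    (h : a ∈ homogeneousPart F X n) (m : ℕ) :
    degreeComponent m a = if m = n then a else 0 := by
  obtain ⟨z, hz, rfl⟩ := exists_of_mem_homogeneousPart h
  rw [degreeComponent_class]
  split_ifs with hm
  · subst hm
    congr 1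
    refine Subtype.ext (SingularCochain.ext fun k σ => ?_)
    change (if k = m then z.1 k σ else 0) = z.1 k σ
    split_ifs with hk
    · rfl
    · exact (hz k hk σ).symm
  · have : cocycleComponent m z = 0 := by
      refine Subtype.ext (SingularCochain.ext fun k σ => ?_)
      change (if k = m then z.1 k σ else 0) = 0
      split_ifs with hk
      · exact hz k (by omega) σ
      · rfl
    rw [this, map_zero]

theorem exists_eq_sum_degreeComponent (a : SingularCohomology F X) :
    ∃ N, a = ∑ n ∈ range N, degreeComponent n a := by
  obtain ⟨z, rfl⟩ := cohomologyClass_surjective F X a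
  obtain ⟨N, hN⟩ := z.2.2
  refine ⟨N, ?_⟩
  simp_rw [degreeComponent_class]
  rw [← map_sum]
  congr 1
  have hsum : ∀ M : ℕ, ∀ m σ, (∑ n ∈ range M, cocycleComponent n z).1 m σ =
      if m < M then z.1 m σ else 0 := by
    intro M m σ
    induction M with
    | zero => rfl
    | succ M ih =>
      rw [Finset.sum_range_succ]
      refine (SingularCochain.add_apply _ _ _ _).trans ?_
      rw [ih]
      change _ + (if m = M then z.1 m σ else 0) = _
      rcases lt_trichotomy m M with h | h | h
      · rw [if_pos h, if_neg h.ne, if_pos (by omega), add_zero]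
      · subst h
        simp
      · rw [if_neg (by omega), if_neg h.ne', if_neg (by omega), add_zero]
  refine Subtype.ext (SingularCochain.ext fun m σ => ?_)
  rw [hsum]
  split_ifs with h
  · rfl
  · exact hN m (by omega) σ

theorem mul_mem_homogeneousPart {p q : ℕ} {a b : SingularCohomology F X}
    (ha : a ∈ homogeneousPart F X p) (hb : b ∈ homogeneousPart F X q) :
    a * b ∈ homogeneousPart F X (p + q) := by
  obtain ⟨x, hx, rfl⟩ := exists_of_mem_homogeneousPart ha
  obtain ⟨y, hy, rfl⟩ := exists_of_mem_homogeneousPart hb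
  refine ⟨x * y, fun m hm σ => ?_, map_mul (cohomologyClass F X) x y⟩
  change (x.1 * y.1) m σ = 0
  rw [SingularCochain.mul_apply]
  refine Finset.sum_eq_zero fun ij hij => ?_
  have h := HasAntidiagonal.mem_antidiagonal.mp hij
  by_cases h1 : ij.1 = p
  · rw [hy _ (by omega), mul_zero]
  · rw [hx _ h1, zero_mul]

theorem cohomologyMap_degreeComponent {Y : Type u} [TopologicalSpace Y] (φ : C(X, Y)) (n : ℕ)
    (a : SingularCohomology F Y) :
    cohomologyMap F φ (degreeComponent n a) = degreeComponent n (cohomologyMap F φ a) := by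
  obtain ⟨z, rfl⟩ := cohomologyClass_surjective F Y a
  rw [degreeComponent_class]
  refine Eq.trans ?_ (degreeComponent_class n _).symm
  rfl

theorem gradeSign_of_mem {n : ℕ} {a : SingularCohomology F X} (h : a ∈ homogeneousPart F X n) :
    gradeSign a = (-1 : F) ^ n • a := by
  obtain ⟨z, hz, rfl⟩ := exists_of_mem_homogeneousPart h
  rw [gradeSign_class, ← map_smul]
  congr 1
  refine Subtype.ext (SingularCochain.ext fun k σ => ?_)
  change (-1) ^ k * z.1 k σ = (-1) ^ n * z.1 k σ
  by_cases hk : k = n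
  · subst hk
    rfl
  · rw [hz k hk, mul_zero, mul_zero]

theorem gradeSign_mul (a b : SingularCohomology F X) :
    gradeSign (a * b) = gradeSign a * gradeSign b := by
  obtain ⟨x, rfl⟩ := cohomologyClass_surjective F X a
  obtain ⟨y, rfl⟩ := cohomologyClass_surjective F X b
  rw [← map_mul, gradeSign_class, gradeSign_class, gradeSign_class, ← map_mul]
  congr 1
  exact Subtype.ext (sgn_mul x.1 y.1)

theorem gradeSign_gradeSign (a : SingularCohomology F X) : gradeSign (gradeSign a) = a := by
  obtain ⟨x, rfl⟩ := cohomologyClass_surjective F X a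
  rw [gradeSign_class, gradeSign_class]
  congr 1
  exact Subtype.ext (sgn_sgn x.1)

/-- A subspace of the cohomology is graded if it contains the homogeneous components of its
elements. -/
def IsGraded (W : Submodule F (SingularCohomology F X)) : Prop :=
  ∀ n, ∀ a ∈ W, degreeComponent n a ∈ W

theorem isGradedSubalgebra_iff {A : NonUnitalSubalgebra F (SingularCohomology F X)} :
    IsGradedSubalgebra A ↔ IsGraded A.toSubmodule := by
  constructor
  · intro h n a ha
    have ha' := h ha
    induction ha' using Submodule.iSup_induction' with
    | mem i x hx =>
      rw [degreeComponent_of_mem hx.2]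
      split_ifs
      · exact hx.1
      · exact zero_mem _
    | zero => rw [map_zero]; exact zero_mem _
    | add x y hx hy hx' hy' =>
      have hle : (⨆ n : ℕ, A.toSubmodule ⊓ homogeneousPart F X n) ≤ A.toSubmodule :=
        iSup_le fun n => inf_le_left
      rw [map_add]
      exact add_mem (hx' (hle hx)) (hy' (hle hy))
  · intro h a ha
    obtain ⟨N, hN⟩ := exists_eq_sum_degreeComponent a
    rw [hN]
    exact Submodule.sum_mem _ fun n _ =>
      Submodule.mem_iSup_of_mem n ⟨h n a ha, degreeComponent_mem n a⟩

namespace IsGraded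
variable {V W : Submodule F (SingularCohomology F X)}

theorem inf (hV : IsGraded V) (hW : IsGraded W) : IsGraded (V ⊓ W) :=
  fun n a ha => ⟨hV n a ha.1, hW n a ha.2⟩

theorem sup (hV : IsGraded V) (hW : IsGraded W) : IsGraded (V ⊔ W) := by
  intro n a ha
  obtain ⟨x, hx, y, hy, rfl⟩ := Submodule.mem_sup.mp ha
  rw [map_add]
  exact add_mem (Submodule.mem_sup_left (hV n x hx)) (Submodule.mem_sup_right (hW n y hy))

/-- To prove a closed property for the elements of a graded subspace, it suffices to consider the
homogeneous ones. -/
theorem induction (hV : IsGraded V) {P : SingularCohomology F X → Prop} (h0 : P 0)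
    (hadd : ∀ a b, P a → P b → P (a + b))
    (h : ∀ n, ∀ a ∈ V, a ∈ homogeneousPart F X n → P a) {a : SingularCohomology F X}
    (ha : a ∈ V) : P a := by
  obtain ⟨N, hN⟩ := exists_eq_sum_degreeComponent a
  rw [hN]
  exact Finset.sum_induction _ P hadd h0 fun n _ =>
    h n _ (hV n a ha) (degreeComponent_mem n a)

theorem mul (hV : IsGraded V) (hW : IsGraded W) : IsGraded (V * W) := by
  intro n c hc
  induction hc using Submodule.mul_induction_on' with
  | add x _ y _ hx hy => rw [map_add]; exact add_mem hx hy
  | mem_mul_mem a ha b hb =>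
    refine hV.induction (P := fun a => degreeComponent n (a * b) ∈ V * W) ?_ ?_ ?_ ha
    · simp
    · intro x y hx hy
      rw [add_mul, map_add]
      exact add_mem hx hy
    · intro p a ha hap
      refine hW.induction (P := fun b => degreeComponent n (a * b) ∈ V * W) ?_ ?_ ?_ hb
      · simp
      · intro x y hx hy
        rw [mul_add, map_add]
        exact add_mem hx hy
      · intro q b hb hbq
        rw [degreeComponent_of_mem (mul_mem_homogeneousPart hap hbq)]
        split_ifs
        · exact Submodule.mul_mem_mul ha hb
        · exact zero_mem _

theorem gradeSign_mem (hV : IsGraded V) {a : SingularCohomology F X} (ha : a ∈ V) :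
    gradeSign a ∈ V := by
  refine hV.induction (P := fun a => gradeSign a ∈ V) ?_ ?_ ?_ ha
  · simp
  · intro x y hx hy
    rw [map_add]
    exact add_mem hx hy
  · intro n a ha hn
    rw [gradeSign_of_mem hn]
    exact V.smul_mem _ ha

theorem iterate_gradeSign_mem (hV : IsGraded V) {a : SingularCohomology F X} (ha : a ∈ V)
    (n : ℕ) : gradeSign^[n] a ∈ V := by
  induction n with
  | zero => exact ha
  | succ n ih => rw [Function.iterate_succ_apply']; exact hV.gradeSign_mem ih

end IsGraded

theorem isGraded_supportedIn (O : Set X) :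
    IsGraded (supportedIn O : Submodule F (SingularCohomology F X)) := by
  rintro n a ⟨U, hU, hOU, ha⟩
  refine ⟨U, hU, hOU, ?_⟩
  refine (cohomologyMap_degreeComponent _ n a).trans ?_
  have : cohomologyMap F ⟨((↑) : U → X), continuous_subtype_val⟩ a = 0 := ha
  rw [this, map_zero]

theorem degreeBetween_mono {p q p' q' : ℝ} (hp : p' ≤ p) (hq : q ≤ q') :
    (degreeBetween p q : Submodule F (SingularCohomology F X)) ≤ degreeBetween p' q' :=
  iSup₂_le fun n hn => le_iSup₂_of_le (f := fun (n : ℕ) (_ : p' < n ∧ n < q') =>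
    homogeneousPart F X n) n ⟨hp.trans_lt hn.1, hn.2.trans_le hq⟩ le_rfl

theorem mul_mem_degreeBetween {p q p' q' : ℝ} {a b : SingularCohomology F X}
    (ha : a ∈ degreeBetween p q) (hb : b ∈ degreeBetween p' q') :
    a * b ∈ degreeBetween (p + p') (q + q') := by
  have h : (degreeBetween p q : Submodule F (SingularCohomology F X)) * degreeBetween p' q' ≤
      degreeBetween (p + p') (q + q') := by
    simp only [degreeBetween, Submodule.iSup_mul, Submodule.mul_iSup, iSup_le_iff]
    intro m hm n hn
    refine Submodule.mul_le.mpr fun x hx y hy => ?_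
    refine Submodule.mem_iSup_of_mem (n + m) (Submodule.mem_iSup_of_mem ?_ ?_)
    · push_cast
      constructor <;> linarith [hn.1, hn.2, hm.1, hm.2]
    · exact mul_mem_homogeneousPart hx hy
  exact h (Submodule.mul_mem_mul ha hb)

theorem cohomologyMap_mem_homogeneousPart {Y : Type u} [TopologicalSpace Y] (φ : C(X, Y)) {n : ℕ}
    {a : SingularCohomology F Y} (ha : a ∈ homogeneousPart F Y n) :
    cohomologyMap F φ a ∈ homogeneousPart F X n := by
  have h := degreeComponent_of_mem ha n
  rw [if_pos rfl] at h
  rw [← h, cohomologyMap_degreeComponent]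
  exact degreeComponent_mem n _

theorem cohomologyMap_mem_degreeBetween {Y : Type u} [TopologicalSpace Y] (φ : C(X, Y)) {p q : ℝ}
    {a : SingularCohomology F Y} (ha : a ∈ degreeBetween p q) :
    cohomologyMap F φ a ∈ degreeBetween p q := by
  have h : (degreeBetween p q : Submodule F (SingularCohomology F Y)) ≤
      (degreeBetween p q : Submodule F (SingularCohomology F X)).comap
        (cohomologyMap F φ).toLinearMap :=
    iSup₂_le fun n hn x hx => Submodule.mem_iSup_of_mem n
      (Submodule.mem_iSup_of_mem hn (cohomologyMap_mem_homogeneousPart φ hx))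
  exact h ha

end Grading

/-! ### Graded commutativity of the cup product -/

namespace SingularCochain
open SingularSimplex
variable {F : Type v} [Field F] {X : Type u} [TopologicalSpace X]

theorem mul_apply_of_concentrated {p q : ℕ} {x y : SingularCochain F X}
    (hx : ∀ m, m ≠ p → ∀ σ, x m σ = 0) (σ : SingularSimplex X (p + q)) :
    (x * y) (p + q) σ = x p (σ.front p) * y q (σ.back q) := by
  rw [mul_apply, Finset.sum_eq_single (p, q)]
  · rintro ⟨i, j⟩ h hne
    have h' := HasAntidiagonal.mem_antidiagonal.mp h
    have : i ≠ p := by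
      rintro rfl
      exact hne (by simp at h'; simp [h'])
    rw [hx _ this, zero_mul]
  · intro h
    exact absurd (HasAntidiagonal.mem_antidiagonal.mpr (rfl : (p, q).1 + (p, q).2 = p + q)) h

theorem mul_apply_eq_zero_of_concentrated {p q n : ℕ} {x y : SingularCochain F X}
    (hx : ∀ m, m ≠ p → ∀ σ, x m σ = 0) (hy : ∀ m, m ≠ q → ∀ σ, y m σ = 0) (hn : n ≠ p + q)
    (σ : SingularSimplex X n) : (x * y) n σ = 0 := by
  rw [mul_apply]
  refine Finset.sum_eq_zero fun ij hij => ?_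
  have h := HasAntidiagonal.mem_antidiagonal.mp hij
  by_cases h1 : ij.1 = p
  · rw [hy _ (by omega), mul_zero]
  · rw [hx _ h1, zero_mul]

/-- Steenrod's cup-1 product of cochains of degrees `p` and `q`:
the sum over `i < p` of `± x(0, …, i, i + q, …, p + q - 1) y(i, …, i + q)`. -/
noncomputable def cupOne (p q : ℕ) (x y : SingularCochain F X) : SingularCochain F X :=
  fun m τ => if m + 1 = p + q then ∑ i ∈ range p, ((-1) ^ (q + 1)) ^ i *
    (x p (τ.reindex p (fun k => if k ≤ i then k else k + q - 1)) *
      y q (τ.reindex q (fun k => i + k))) else 0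

theorem sum_telescope_sign (e : F) (he : e * e = 1) (G : ℕ → F) (p : ℕ) :
    ∑ i ∈ range p, e ^ i * (G (i + 1) - e * G i) = e * (e ^ p * G p - G 0) := by
  induction p with
  | zero => simp
  | succ p ih =>
    rw [Finset.sum_range_succ, ih]
    have : e ^ p = e * (e ^ (p + 1)) := by rw [pow_succ']; linear_combination (-e ^ p) * he
    linear_combination G (p + 1) * this

/-- The coboundary of the cup-1 product of cocycles measures the failure of the cup product of
cochains to be commutative. -/
theorem coboundary_cupOne {p q : ℕ} {x y : SingularCochain F X} (hx : coboundary x = 0)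
    (hy : coboundary y = 0) {m : ℕ} (hm : m + 1 = p + q) (σ : SingularSimplex X (m + 1)) :
    coboundary (cupOne p q x y) (m + 1) σ = (-1) ^ (q + 1) *
      ((-1) ^ (p * q) * (x p (σ.front p) * y q (σ.back q)) -
        y q (σ.front q) * x p (σ.back p)) := by
  -- the simplices `(0, …, j, j + q, …, p + q)` and `(i, …, i + q + 1)`, on whose faces `x` and `y`
  -- are evaluated
  let w : ℕ → SingularSimplex X (p + 1) := fun j =>
    σ.reindex (p + 1) (fun s => if s ≤ j then s else s + q - 1)
  let u : ℕ → SingularSimplex X (q + 1) := fun i => σ.reindex (q + 1) (fun k => i + k)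
  let X' : ℕ → F := fun j => x p (σ.reindex p (fun k => if k < j then k else k + q))
  let Y : ℕ → F := fun j => y q (σ.reindex q (fun k => j + k))
  -- the front part and the back part of the coboundary of `x` on `w j`
  let P : ℕ → F := fun j => ∑ s ∈ range j, (-1) ^ s * x p ((w j).face s)
  let Q : ℕ → F := fun j => ∑ t ∈ range (p - j), (-1) ^ (j + t) * x p ((w j).face (j + 2 + t))
  have R1 : ∀ j ≤ p, P j + (-1) ^ j * X' j - (-1) ^ j * X' (j + 1) + Q j = 0 := by
    intro j hj
    have h : coboundary x (p + 1) (w j) = 0 := by rw [hx]; rfl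
    have hr : p + 2 = (j + 1 + 1) + (p - j) := by omega
    rw [coboundary_succ, hr, sum_range_add, sum_range_succ, sum_range_succ] at h
    have e1 : (w j).face j = σ.reindex p (fun k => if k < j then k else k + q) := by
      simp only [w, face, reindex_reindex]
      exact reindex_congr _ (by intros; split_ifs <;> omega)
    have e2 : (w j).face (j + 1) = σ.reindex p (fun k => if k < j + 1 then k else k + q) := by
      simp only [w, face, reindex_reindex]
      exact reindex_congr _ (by intros; split_ifs <;> omega)
    rw [e1, e2] at h
    have hQ : ∑ t ∈ range (p - j), (-1) ^ (j + 1 + 1 + t) * x p ((w j).face (j + 1 + 1 + t)) =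
        Q j := by
      refine Finset.sum_congr rfl fun t _ => ?_
      rw [show j + 1 + 1 + t = j + 2 + t by ring]
      ring
    rw [hQ] at h
    simp only [P, X']
    linear_combination h
  have R2 : ∀ i < p, Y (i + 1) + ∑ t ∈ range q, (-1) ^ (t + 1) * y q ((u i).face (t + 1)) +
      (-1) ^ (q + 1) * Y i = 0 := by
    intro i hi
    have h : coboundary y (q + 1) (u i) = 0 := by rw [hy]; rfl
    rw [coboundary_succ, sum_range_succ, sum_range_succ'] at h
    have e1 : (u i).face 0 = σ.reindex q (fun k => i + 1 + k) := by
      simp only [u, face, reindex_reindex]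
      exact reindex_congr _ (by intros; split_ifs <;> omega)
    have e2 : (u i).face (q + 1) = σ.reindex q (fun k => i + k) := by
      simp only [u, face, reindex_reindex]
      exact reindex_congr _ (by intros; split_ifs <;> omega)
    rw [e1, e2] at h
    simp only [Y]
    linear_combination h
  -- by the cocycle conditions `R1` and `R2`, the terms of the coboundary with a given `i` add up to
  -- a difference of consecutive values of `G`, up to sign
  let G : ℕ → F := fun i => Y i * P i + (-1) ^ i * (Y i * X' i)
  have hterm : ∀ i < p, ∑ k ∈ range (m + 2), (-1) ^ k *
      (x p ((σ.face k).reindex p (fun k => if k ≤ i then k else k + q - 1)) *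
        y q ((σ.face k).reindex q (fun k => i + k))) =
      G (i + 1) - (-1) ^ (q + 1) * G i := by
    intro i hi
    have hr : m + 2 = (i + 1) + (q + (p - i)) := by omega
    rw [hr, sum_range_add _ (i + 1), sum_range_add _ q]
    -- faces before the block `i, …, i + q + 1` belong to `x`, interior faces of the block to `y`,
    -- and faces after it to `x` again
    have p1 : ∑ k ∈ range (i + 1), (-1) ^ k *
        (x p ((σ.face k).reindex p (fun k => if k ≤ i then k else k + q - 1)) *
          y q ((σ.face k).reindex q (fun k => i + k))) = Y (i + 1) * P (i + 1) := by
      simp only [P, Finset.mul_sum]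
      refine Finset.sum_congr rfl fun k hk => ?_
      rw [Finset.mem_range] at hk
      have e1 : (σ.face k).reindex p (fun k => if k ≤ i then k else k + q - 1) =
          (w (i + 1)).face k := by
        simp only [w, face, reindex_reindex]
        exact reindex_congr _ (by intros; split_ifs <;> omega)
      have e2 : (σ.face k).reindex q (fun k => i + k) =
          σ.reindex q (fun k => i + 1 + k) := by
        simp only [face, reindex_reindex]
        exact reindex_congr _ (by intros; split_ifs <;> omega)
      rw [e1, e2]
      ring
    have p2 : ∑ t ∈ range q, (-1) ^ (i + 1 + t) *
        (x p ((σ.face (i + 1 + t)).reindex p (fun k => if k ≤ i then k else k + q - 1)) *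
          y q ((σ.face (i + 1 + t)).reindex q (fun k => i + k))) =
        (-1) ^ i * X' (i + 1) *
          ∑ t ∈ range q, (-1) ^ (t + 1) * y q ((u i).face (t + 1)) := by
      rw [Finset.mul_sum]
      refine Finset.sum_congr rfl fun t ht => ?_
      rw [Finset.mem_range] at ht
      have e1 : (σ.face (i + 1 + t)).reindex p (fun k => if k ≤ i then k else k + q - 1) =
          σ.reindex p (fun k => if k < i + 1 then k else k + q) := by
        simp only [face, reindex_reindex]
        exact reindex_congr _ (by intros; split_ifs <;> omega)
      have e2 : (σ.face (i + 1 + t)).reindex q (fun k => i + k) = (u i).face (t + 1) := by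
        simp only [u, face, reindex_reindex]
        exact reindex_congr _ (by intros; split_ifs <;> omega)
      rw [e1, e2]
      simp only [X']
      ring
    have p3 : ∑ t ∈ range (p - i), (-1) ^ (i + 1 + (q + t)) *
        (x p ((σ.face (i + 1 + (q + t))).reindex p (fun k => if k ≤ i then k else k + q - 1)) *
          y q ((σ.face (i + 1 + (q + t))).reindex q (fun k => i + k))) =
        (-1) ^ (q + 1) * (Y i * Q i) := by
      simp only [Q, Finset.mul_sum]
      refine Finset.sum_congr rfl fun t ht => ?_
      rw [Finset.mem_range] at ht
      have e1 : (σ.face (i + 1 + (q + t))).reindex p (fun k => if k ≤ i then k else k + q - 1) =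
          (w i).face (i + 2 + t) := by
        simp only [w, face, reindex_reindex]
        exact reindex_congr _ (by intros; split_ifs <;> omega)
      have e2 : (σ.face (i + 1 + (q + t))).reindex q (fun k => i + k) =
          σ.reindex q (fun k => i + k) := by
        simp only [face, reindex_reindex]
        exact reindex_congr _ (by intros; split_ifs <;> omega)
      rw [e1, e2]
      simp only [Y]
      ring
    rw [p1, p2, p3]
    have r1 := R1 i hi.le
    have r2 := R2 i hi
    simp only [G]
    linear_combination ((-1) ^ (q + 1) * Y i) * r1 + ((-1) ^ i * X' (i + 1)) * r2
  have hcob : coboundary (cupOne p q x y) (m + 1) σ =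
      ∑ i ∈ range p, ((-1) ^ (q + 1)) ^ i * (G (i + 1) - (-1) ^ (q + 1) * G i) := by
    rw [coboundary_succ]
    simp only [cupOne, if_pos hm, Finset.mul_sum]
    rw [Finset.sum_comm]
    refine Finset.sum_congr rfl fun i hi => ?_
    rw [← hterm i (Finset.mem_range.mp hi), Finset.mul_sum]
    exact Finset.sum_congr rfl fun k _ => mul_left_comm _ _ _
  have hG0 : G 0 = y q (σ.front q) * x p (σ.back p) := by
    have e1 : σ.reindex q (fun k => 0 + k) = σ.front q :=
      reindex_congr _ (by intros; omega)
    have e2 : σ.reindex p (fun k => if k < 0 then k else k + q) = σ.back p :=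
      reindex_congr _ (by intros; split_ifs <;> omega)
    simp only [G, P, Y, X', e1, e2, Finset.range_zero, Finset.sum_empty]
    ring
  have hGp : G p = (-1) ^ p * (x p (σ.front p) * y q (σ.back q)) := by
    have e1 : σ.reindex q (fun k => p + k) = σ.back q :=
      reindex_congr _ (by intros; omega)
    have e2 : σ.reindex p (fun k => if k < p + 1 then k else k + q) = σ.front p :=
      reindex_congr _ (by intros; split_ifs <;> omega)
    have r1 := R1 p le_rfl
    have hQ : Q p = 0 := by simp [Q]
    have hY : Y p = y q (σ.back q) := by simp only [Y, e1]
    have hX : X' (p + 1) = x p (σ.front p) := by simp only [X', e2]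
    rw [hQ, hX] at r1
    simp only [G]
    rw [← hY]
    linear_combination Y p * r1
  have he : ((-1 : F) ^ (q + 1)) * (-1) ^ (q + 1) = 1 := by rw [← mul_pow]; simp
  rw [hcob, sum_telescope_sign _ he, hG0, hGp, ← pow_mul]
  have hs : (-1 : F) ^ ((q + 1) * p) * (-1) ^ p = (-1) ^ (p * q) := by
    rw [← pow_add, show (q + 1) * p + p = p * q + 2 * p by ring, pow_add, pow_mul (-1 : F) 2]
    simp
  linear_combination ((-1) ^ (q + 1) * (x p (σ.front p) * y q (σ.back q))) * hs

end SingularCochain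

section Commutativity
open SingularCochain
variable {F : Type v} [Field F] {X : Type u} [TopologicalSpace X]

/-- The cup product is graded commutative. -/
theorem mul_comm_of_mem_homogeneousPart {p q : ℕ} {a b : SingularCohomology F X}
    (ha : a ∈ homogeneousPart F X p) (hb : b ∈ homogeneousPart F X q) :
    b * a = (-1 : F) ^ (p * q) • (a * b) := by
  obtain ⟨x, hx, rfl⟩ := exists_of_mem_homogeneousPart ha
  obtain ⟨y, hy, rfl⟩ := exists_of_mem_homogeneousPart hb
  rw [← sub_eq_zero, ← map_mul, ← map_mul, ← map_smul, ← map_sub, cohomologyClass_eq_zero]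
  refine ⟨(-1 : F) ^ q • cupOne p q x.1 y.1, ?_⟩
  rw [map_smul]
  have hqq : (-1 : F) ^ q * (-1) ^ q = 1 := by rw [← mul_pow]; simp
  ext n σ
  have hrhs : (y * x - (-1 : F) ^ (p * q) • (x * y) : singularCocycles F X).1 n σ =
      (y.1 * x.1) n σ - (-1) ^ (p * q) * (x.1 * y.1) n σ := rfl
  rw [SingularCochain.smul_apply, hrhs]
  by_cases hn : n = p + q
  · rcases n with _ | m
    · obtain rfl : p = 0 := by omega
      obtain rfl : q = 0 := by omega
      have h1 := mul_apply_of_concentrated (p := 0) (q := 0) (y := y.1) hx σ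
      have h2 := mul_apply_of_concentrated (p := 0) (q := 0) (y := x.1) hy σ
      have h3 : σ.front 0 = σ.back 0 :=
        SingularSimplex.reindex_congr _ (by intros; omega)
      rw [coboundary_zero]
      change (x.1 * y.1) 0 σ = _ at h1
      change (y.1 * x.1) 0 σ = _ at h2
      rw [h1, h2, h3]
      ring
    · rw [coboundary_cupOne x.2.1 y.2.1 hn]
      have h1 : (x.1 * y.1) (m + 1) σ = x.1 p (σ.front p) * y.1 q (σ.back q) := by
        generalize m + 1 = k at hn σ
        subst hn
        exact mul_apply_of_concentrated hx σ
      have h2 : (y.1 * x.1) (m + 1) σ = y.1 q (σ.front q) * x.1 p (σ.back p) := by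
        rw [add_comm p q] at hn
        generalize m + 1 = k at hn σ
        subst hn
        exact mul_apply_of_concentrated hy σ
      rw [h1, h2]
      linear_combination (y.1 q (σ.front q) * x.1 p (σ.back p) -
        (-1) ^ (p * q) * (x.1 p (σ.front p) * y.1 q (σ.back q))) * hqq
  · rw [mul_apply_eq_zero_of_concentrated hx hy hn,
      mul_apply_eq_zero_of_concentrated hy hx (by omega)]
    rcases n with _ | n
    · rw [coboundary_zero]; ring
    · rw [coboundary_succ]
      simp [cupOne, hn]

/-- A class of degree `q` commutes with every class up to the `q`-th power of the grading
involution. -/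
theorem mul_eq_mul_iterate_gradeSign {q : ℕ} (a : SingularCohomology F X)
    {b : SingularCohomology F X} (hb : b ∈ homogeneousPart F X q) :
    a * b = b * gradeSign^[q] a := by
  have hadd : ∀ (q : ℕ) (a b : SingularCohomology F X),
      gradeSign^[q] (a + b) = gradeSign^[q] a + gradeSign^[q] b := fun q a b =>
    iterate_map_add gradeSign q a b
  have htop : IsGraded (⊤ : Submodule F (SingularCohomology F X)) := fun _ _ _ => trivial
  refine htop.induction (P := fun a => a * b = b * gradeSign^[q] a) ?_ ?_ ?_ trivial
  · rw [iterate_map_zero]; simp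
  · intro x y hx hy
    rw [add_mul, hx, hy, hadd, mul_add]
  · intro p a _ hap
    have hit : ∀ q : ℕ, gradeSign^[q] a = (-1 : F) ^ (p * q) • a := by
      intro q
      induction q with
      | zero => simp
      | succ q ih =>
        rw [Function.iterate_succ_apply', ih, map_smul, gradeSign_of_mem hap, smul_smul, ← pow_add]
        congr 2
    rw [hit, mul_smul_comm, mul_comm_of_mem_homogeneousPart hap hb, smul_smul, ← mul_pow]
    simp

end Commutativity

/-! ### Algebras generated by finite-dimensional graded subalgebras -/

section GradedAlgebras
variable {F : Type v} [Field F] {X : Type u} [TopologicalSpace X]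

theorem IsGraded.mul_comm {V W : Submodule F (SingularCohomology F X)} (hV : IsGraded V)
    (hW : IsGraded W) : V * W = W * V := by
  have key : ∀ {V W : Submodule F (SingularCohomology F X)}, IsGraded V → IsGraded W →
      V * W ≤ W * V := by
    intro V W hV hW
    refine Submodule.mul_le.mpr fun a ha b hb => ?_
    refine hW.induction (P := fun b => a * b ∈ W * V) ?_ ?_ ?_ hb
    · simp
    · intro x y hx hy
      rw [mul_add]
      exact add_mem hx hy
    · intro q b hb hbq
      rw [mul_eq_mul_iterate_gradeSign a hbq]
      exact Submodule.mul_mem_mul hb (hV.iterate_gradeSign_mem ha q)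
  exact le_antisymm (key hV hW) (key hW hV)

/-- By graded commutativity, the algebra generated by two graded subalgebras `A` and `B` is
spanned by `A`, `B` and the products of an element of `A` with an element of `B`. -/
theorem toSubmodule_sup_of_isGraded {A B : NonUnitalSubalgebra F (SingularCohomology F X)}
    (hA : IsGraded A.toSubmodule) (hB : IsGraded B.toSubmodule) :
    (A ⊔ B).toSubmodule =
      A.toSubmodule ⊔ B.toSubmodule ⊔ A.toSubmodule * B.toSubmodule := by
  set a := A.toSubmodule with ha
  set b := B.toSubmodule with hb
  have haa : a * a ≤ a := Submodule.mul_le.mpr fun x hx y hy => A.mul_mem hx hy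
  have hbb : b * b ≤ b := Submodule.mul_le.mpr fun x hx y hy => B.mul_mem hx hy
  have hba : b * a = a * b := hB.mul_comm hA
  have hA1 : a ≤ a ⊔ b ⊔ a * b := le_sup_left.trans le_sup_left
  have hB1 : b ≤ a ⊔ b ⊔ a * b := le_sup_right.trans le_sup_left
  have hAB1 : a * b ≤ a ⊔ b ⊔ a * b := le_sup_right
  have hmul : (a ⊔ b ⊔ a * b) * (a ⊔ b ⊔ a * b) ≤ a ⊔ b ⊔ a * b := by
    simp only [Submodule.sup_mul, Submodule.mul_sup, sup_le_iff]
    have e1 : a * (a * b) ≤ a * b := by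
      rw [← mul_assoc]; exact mul_le_mul' haa le_rfl
    have e2 : b * (a * b) ≤ a * b := by
      rw [← mul_assoc, hba, mul_assoc]; exact mul_le_mul' le_rfl hbb
    have e3 : a * b * a ≤ a * b := by rw [mul_assoc, hba]; exact e1
    have e4 : a * b * b ≤ a * b := by
      rw [mul_assoc]; exact mul_le_mul' le_rfl hbb
    have e5 : a * b * (a * b) ≤ a * b := by
      rw [mul_assoc]; exact (mul_le_mul' le_rfl e2).trans e1
    constructorm* _ ∧ _
    · exact haa.trans hA1
    · exact hba.le.trans hAB1
    · exact e3.trans hAB1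
    · exact hAB1
    · exact hbb.trans hB1
    · exact e4.trans hAB1
    · exact e1.trans hAB1
    · exact e2.trans hAB1
    · exact e5.trans hAB1
  apply le_antisymm
  · have : A ⊔ B ≤ Submodule.toNonUnitalSubalgebra (a ⊔ b ⊔ a * b)
        (fun x y hx hy => hmul (Submodule.mul_mem_mul hx hy)) :=
      sup_le (fun x hx => hA1 hx) (fun x hx => hB1 hx)
    exact fun x hx => this hx
  · have h1 : a ≤ (A ⊔ B).toSubmodule := fun x hx => (le_sup_left : A ≤ A ⊔ B) hx
    have h2 : b ≤ (A ⊔ B).toSubmodule := fun x hx => (le_sup_right : B ≤ A ⊔ B) hx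
    exact sup_le (sup_le h1 h2) (Submodule.mul_le.mpr fun x hx y hy =>
      (A ⊔ B).mul_mem (h1 hx) (h2 hy))

/-- Graded subalgebras of finite dimension. -/
def IsFiniteGraded (A : NonUnitalSubalgebra F (SingularCohomology F X)) : Prop :=
  IsGraded A.toSubmodule ∧ FiniteDimensional F A.toSubmodule

theorem IsFiniteGraded.sup {A B : NonUnitalSubalgebra F (SingularCohomology F X)}
    (hA : IsFiniteGraded A) (hB : IsFiniteGraded B) : IsFiniteGraded (A ⊔ B) := by
  have := hA.2
  have := hB.2
  rw [IsFiniteGraded, toSubmodule_sup_of_isGraded hA.1 hB.1]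
  refine ⟨(hA.1.sup hB.1).sup (hA.1.mul hB.1), ?_⟩
  have h : (A.toSubmodule * B.toSubmodule).FG :=
    Submodule.FG.mul (Module.Finite.iff_fg.mp hA.2) (Module.Finite.iff_fg.mp hB.2)
  have := Module.Finite.iff_fg.mpr h
  infer_instance

theorem isFiniteGraded_bot :
    IsFiniteGraded (⊥ : NonUnitalSubalgebra F (SingularCohomology F X)) := by
  have h : (⊥ : NonUnitalSubalgebra F (SingularCohomology F X)).toSubmodule = ⊥ := by
    ext x
    exact NonUnitalAlgebra.mem_bot
  rw [IsFiniteGraded, h]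
  refine ⟨fun n a ha => ?_, inferInstance⟩
  rw [(Submodule.mem_bot F).mp ha, map_zero]
  exact zero_mem _

theorem isFiniteGradedIn_iff {𝔞 A : NonUnitalSubalgebra F (SingularCohomology F X)} :
    IsFiniteGradedIn 𝔞 A ↔ A ≤ 𝔞 ∧ IsFiniteGraded A :=
  ⟨fun h => ⟨h.le, isGradedSubalgebra_iff.mp h.graded, h.finite⟩,
    fun h => ⟨h.1, isGradedSubalgebra_iff.mpr h.2.1, h.2.2⟩⟩

theorem IsFiniteGradedIn.sup {𝔞 A B : NonUnitalSubalgebra F (SingularCohomology F X)}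
    (hA : IsFiniteGradedIn 𝔞 A) (hB : IsFiniteGradedIn 𝔞 B) : IsFiniteGradedIn 𝔞 (A ⊔ B) := by
  rw [isFiniteGradedIn_iff] at *
  exact ⟨sup_le hA.1 hB.1, hA.2.sup hB.2⟩

theorem cohomologyMap_mem_supportedIn {Y : Type u} [TopologicalSpace Y] (φ : C(X, Y)) {O : Set Y}
    {a : SingularCohomology F Y} (ha : a ∈ supportedIn O) :
    cohomologyMap F φ a ∈ supportedIn (φ ⁻¹' O) := by
  obtain ⟨U, hU, hOU, ha⟩ := ha
  refine ⟨φ ⁻¹' U, hU.preimage φ.continuous, by rw [← Set.preimage_union, hOU]; rfl, ?_⟩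
  have h1 := cohomologyMap_comp (F := F) φ
    (⟨((↑) : (φ ⁻¹' U : Set X) → X), continuous_subtype_val⟩ : C((φ ⁻¹' U : Set X), X)) a
  have h2 := cohomologyMap_comp (F := F)
    (⟨((↑) : U → Y), continuous_subtype_val⟩ : C(U, Y))
    (⟨fun x => ⟨φ x.1, x.2⟩, by fun_prop⟩ : C((φ ⁻¹' U : Set X), U)) a
  have h3 : cohomologyMap F (⟨((↑) : U → Y), continuous_subtype_val⟩ : C(U, Y)) a = 0 := ha
  rw [h3, map_zero] at h2
  exact h1.symm.trans h2

end GradedAlgebras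

section Translates
variable {Γ : Type*} [Group Γ] {X : Type u} [TopologicalSpace X] {F : Type v} [Field F]
  [MulAction Γ X] [ContinuousConstSMul Γ X]

theorem cohomologyPush_mul (γ η : Γ) (a : SingularCohomology F X) :
    cohomologyPush (γ * η) a = cohomologyPush γ (cohomologyPush η a) := by
  rw [cohomologyPush, cohomologyPush, cohomologyPush, ← cohomologyMap_comp]
  congr 2
  ext x
  simp [mul_smul]

theorem cohomologyPush_inv_cancel (γ : Γ) (a : SingularCohomology F X) :
    cohomologyPush γ (cohomologyPush γ⁻¹ a) = a := by
  rw [← cohomologyPush_mul, mul_inv_cancel]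
  obtain ⟨z, rfl⟩ := cohomologyClass_surjective F X a
  have : (⟨fun x => (1 : Γ)⁻¹ • x, continuous_const_smul _⟩ : C(X, X)) = ContinuousMap.id X := by
    ext x; simp
  rw [cohomologyPush, this]
  rfl

theorem cohomologyPush_mem_translatesAlgebra (γ : Γ)
    {A : NonUnitalSubalgebra F (SingularCohomology F X)} {S : Set Γ} {a : SingularCohomology F X}
    (ha : a ∈ translatesAlgebra A S) : cohomologyPush γ a ∈ translatesAlgebra A (γ • S) := by
  have h : translatesAlgebra A S ≤
      (translatesAlgebra A (γ • S)).comap (cohomologyPush γ) := by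
    refine NonUnitalAlgebra.adjoin_le fun x hx => ?_
    simp only [Set.mem_iUnion] at hx
    obtain ⟨η, hη, y, hy, rfl⟩ := hx
    refine NonUnitalAlgebra.subset_adjoin F ?_
    simp only [Set.mem_iUnion]
    exact ⟨γ * η, ⟨η, hη, rfl⟩, y, hy, cohomologyPush_mul γ η y⟩
  exact h ha

theorem translatesAlgebra_mono {A B : NonUnitalSubalgebra F (SingularCohomology F X)}
    (hAB : A ≤ B) {S T : Set Γ} (hST : S ⊆ T) : translatesAlgebra A S ≤ translatesAlgebra B T :=
  NonUnitalAlgebra.adjoin_mono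
    (Set.biUnion_mono hST fun _ _ => Set.image_mono hAB)

theorem translatesAlgebra_empty (A : NonUnitalSubalgebra F (SingularCohomology F X)) :
    translatesAlgebra A (∅ : Set Γ) = ⊥ := by
  rw [translatesAlgebra]
  simp

theorem translatesAlgebra_insert (A : NonUnitalSubalgebra F (SingularCohomology F X)) (γ : Γ)
    (S : Set Γ) :
    translatesAlgebra A (insert γ S) =
      A.map (cohomologyPush γ) ⊔ translatesAlgebra A S := by
  rw [translatesAlgebra, Set.biUnion_insert, NonUnitalAlgebra.adjoin_union]
  congr 1
  exact NonUnitalAlgebra.adjoin_eq (A.map (cohomologyPush γ))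

theorem IsFiniteGraded.map_cohomologyPush {A : NonUnitalSubalgebra F (SingularCohomology F X)}
    (hA : IsFiniteGraded A) (γ : Γ) : IsFiniteGraded (A.map (cohomologyPush γ)) := by
  have h : (A.map (cohomologyPush γ)).toSubmodule =
      A.toSubmodule.map (cohomologyPush γ).toLinearMap := rfl
  rw [IsFiniteGraded, h]
  refine ⟨?_, ?_⟩
  · rintro n _ ⟨a, ha, rfl⟩
    exact ⟨degreeComponent n a, hA.1 n a ha, cohomologyMap_degreeComponent _ n a⟩
  · have := hA.2
    infer_instance

/-- The algebras `A_S` of finite sets `S` are graded and of finite dimension if `A` is. -/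
theorem IsFiniteGraded.translatesAlgebra {A : NonUnitalSubalgebra F (SingularCohomology F X)}
    (hA : IsFiniteGraded A) {S : Set Γ} (hS : S.Finite) :
    IsFiniteGraded (translatesAlgebra A S) := by
  induction S, hS using Set.Finite.induction_on with
  | empty => rw [translatesAlgebra_empty]; exact isFiniteGraded_bot
  | @insert γ T _ _ ih => rw [translatesAlgebra_insert]; exact (hA.map_cohomologyPush γ).sup ih

theorem isGraded_supportedClasses {A : NonUnitalSubalgebra F (SingularCohomology F X)}
    (hA : IsFiniteGraded A) {S : Set Γ} (hS : S.Finite) (O : Set X) :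
    IsGraded (supportedClasses A S O) :=
  (hA.translatesAlgebra hS).1.inf (isGraded_supportedIn O)

theorem supportedClasses_mono {A B : NonUnitalSubalgebra F (SingularCohomology F X)}
    (hAB : A ≤ B) {S T : Set Γ} (hST : S ⊆ T) {O O' : Set X} (hO : O ⊆ O') :
    supportedClasses A S O ≤ supportedClasses B T O' :=
  inf_le_inf (fun _ hx => translatesAlgebra_mono hAB hST hx) (supportedIn_mono hO)

theorem mul_mem_supportedClasses {A : NonUnitalSubalgebra F (SingularCohomology F X)}
    {S T : Set Γ} {O O' : Set X} {a b : SingularCohomology F X} (ha : a ∈ supportedClasses A S O)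
    (hb : b ∈ supportedClasses A T O') : a * b ∈ supportedClasses A (S ∪ T) (O ∩ O') :=
  ⟨(translatesAlgebra A (S ∪ T)).mul_mem (translatesAlgebra_mono le_rfl Set.subset_union_left ha.1)
    (translatesAlgebra_mono le_rfl Set.subset_union_right hb.1), mul_mem_supportedIn ha.2 hb.2⟩

theorem cohomologyPush_mem_supportedClasses (γ : Γ)
    {A : NonUnitalSubalgebra F (SingularCohomology F X)} {S : Set Γ} {O : Set X}
    {a : SingularCohomology F X} (ha : a ∈ supportedClasses A S O) :
    cohomologyPush γ a ∈ supportedClasses A (γ • S) ((γ⁻¹ • ·) ⁻¹' O) :=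
  ⟨cohomologyPush_mem_translatesAlgebra γ ha.1,
    cohomologyMap_mem_supportedIn ⟨fun x => γ⁻¹ • x, continuous_const_smul γ⁻¹⟩ ha.2⟩

end Translates

/-! ### Superadditivity of the rank of the cup product pairing -/

section Pairing
variable {F : Type v} [Field F] {X : Type u} [TopologicalSpace X]

/-- The functionals `b ↦ a i ∧ b` on `R` are linearly independent. -/
def PairingIndependent {ι : Type*} [Fintype ι] (a : ι → SingularCohomology F X)
    (R : Submodule F (SingularCohomology F X)) : Prop :=
  ∀ t : ι → F, (∀ b ∈ R, (∑ i, t i • a i) * b = 0) → t = 0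

theorem PairingIndependent.mono {ι : Type*} [Fintype ι] {a : ι → SingularCohomology F X}
    {R R' : Submodule F (SingularCohomology F X)} (h : PairingIndependent a R) (hR : R ≤ R') :
    PairingIndependent a R' :=
  fun t ht => h t fun b hb => ht b (hR hb)

/-- If the multiplication `M ⊗ N → H^⋆` is injective, a functional may be applied to the second
factors of a vanishing sum of products. -/
theorem sum_smul_eq_zero_of_injective_mulMap {M N : Submodule F (SingularCohomology F X)}
    (hMN : Function.Injective (Submodule.mulMap M N)) {ι : Type*} [Fintype ι]
    {u w : ι → SingularCohomology F X} (hu : ∀ i, u i ∈ M) (hw : ∀ i, w i ∈ N)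
    (h : ∑ i, u i * w i = 0) (g : SingularCohomology F X →ₗ[F] F) :
    ∑ i, g (w i) • u i = 0 := by
  have h1 : ∑ i, TensorProduct.tmul F (⟨u i, hu i⟩ : M) (⟨w i, hw i⟩ : N) = 0 := by
    apply hMN
    rw [map_sum, map_zero, ← h]
    exact Finset.sum_congr rfl fun i _ => Submodule.mulMap_tmul M N _ _
  have h2 := congrArg (fun z => M.subtype (TensorProduct.rid F M
    (LinearMap.lTensor M (g.comp N.subtype) z))) h1
  simpa using h2

theorem iterate_gradeSign_iterate (q : ℕ) (a : SingularCohomology F X) :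
    gradeSign^[q] (gradeSign^[q] a) = a := by
  induction q generalizing a with
  | zero => rfl
  | succ q ih =>
    rw [Function.iterate_succ_apply, Function.iterate_succ_apply', gradeSign_gradeSign, ih]

theorem iterate_gradeSign_mul (q : ℕ) (a b : SingularCohomology F X) :
    gradeSign^[q] (a * b) = gradeSign^[q] a * gradeSign^[q] b := by
  induction q with
  | zero => rfl
  | succ q ih => simp only [Function.iterate_succ_apply', ih, gradeSign_mul]

/-- Products of independent functionals are independent if the cup product is injective on the
tensor product of the algebras in which they live. -/
theorem PairingIndependent.mul {A B : NonUnitalSubalgebra F (SingularCohomology F X)}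
    (hAB : Function.Injective (Submodule.mulMap A.toSubmodule B.toSubmodule))
    (hB : IsGraded B.toSubmodule) {ι κ : Type*} [Fintype ι] [Fintype κ]
    {a : ι → SingularCohomology F X} {b : κ → SingularCohomology F X}
    {R S T : Submodule F (SingularCohomology F X)} (hRA : R ≤ A.toSubmodule)
    (hSB : S ≤ B.toSubmodule) (hR : IsGraded R) (hS : IsGraded S)
    (ha : ∀ i, a i ∈ A) (hb : ∀ j, b j ∈ B)
    (haR : PairingIndependent a R) (hbS : PairingIndependent b S)
    (hT : ∀ x ∈ R, ∀ y ∈ S, x * y ∈ T) :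
    PairingIndependent (fun ij : ι × κ => a ij.1 * b ij.2) T := by
  intro t ht
  have key : ∀ y ∈ S, ∀ g : SingularCohomology F X →ₗ[F] F, ∀ x ∈ R,
      (∑ i, (∑ j, t (i, j) * g (b j * y)) • a i) * x = 0 := by
    intro y hy g x hx
    refine hR.induction (P := fun x =>
      (∑ i, (∑ j, t (i, j) * g (b j * y)) • a i) * x = 0) (mul_zero _) ?_ ?_ hx
    · intro x x' hx hx'
      rw [mul_add, hx, hx', add_zero]
    · intro q x hx hxq
      -- moving `x` past `b j` twists `b j` by a power of the grading involution; the twist is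
      -- absorbed by replacing `y` and `g` by their twists
      have h0 := ht (x * gradeSign^[q] y) (hT x hx _ (hS.iterate_gradeSign_mem hy q))
      have h1 : ∑ ij : ι × κ, (t ij • (a ij.1 * x)) * gradeSign^[q] (b ij.2 * y) = 0 := by
        rw [← h0, Finset.sum_mul]
        refine Finset.sum_congr rfl fun ij _ => ?_
        rw [iterate_gradeSign_mul, smul_mul_assoc, smul_mul_assoc]
        congr 1
        rw [mul_assoc (a ij.1), mul_assoc (a ij.1), ← mul_assoc (b ij.2),
          mul_eq_mul_iterate_gradeSign (b ij.2) hxq, mul_assoc x]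
      have h2 := sum_smul_eq_zero_of_injective_mulMap hAB
        (u := fun ij : ι × κ => t ij • (a ij.1 * x))
        (w := fun ij : ι × κ => gradeSign^[q] (b ij.2 * y))
        (fun ij => A.smul_mem _ (A.mul_mem (ha ij.1) (hRA hx)))
        (fun ij => hB.iterate_gradeSign_mem (B.mul_mem (hb ij.2) (hSB hy)) q) h1
        (g.comp (gradeSign ^ q))
      rw [Finset.sum_mul, ← h2, Fintype.sum_prod_type]
      refine Finset.sum_congr rfl fun i _ => ?_
      rw [Finset.sum_smul, Finset.sum_mul]
      refine Finset.sum_congr rfl fun j _ => ?_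
      rw [LinearMap.comp_apply, Module.End.pow_apply, iterate_gradeSign_iterate, smul_mul_assoc,
        smul_smul, mul_comm]
  ext ⟨i, j⟩
  have h1 : (fun j => t (i, j)) = 0 := by
    refine hbS _ fun y hy => ?_
    rw [← Module.forall_dual_apply_eq_zero_iff F]
    intro g
    have := congrFun (haR _ (key y hy g)) i
    rw [Finset.sum_mul, map_sum]
    simpa using this
  exact congrFun h1 j

end Pairing

section Rank
variable {F V E : Type*} [Field F] [AddCommGroup V] [Module F V] [FiniteDimensional F V]
  [AddCommMonoid E] [Module F E]

/-- A linear map of rank `r` is injective on the span of `r` suitable vectors. -/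
theorem exists_independent_of_finrank_range (f : V →ₗ[F] E) :
    ∃ a : Fin (Module.finrank F (LinearMap.range f)) → V,
      ∀ t : Fin (Module.finrank F (LinearMap.range f)) → F,
        ∑ i, t i • f (a i) = 0 → t = 0 := by
  let _ : AddCommGroup E := Module.addCommMonoidToAddCommGroup F
  let e := Module.finBasis F (LinearMap.range f)
  choose a ha using fun i => (e i).2
  refine ⟨a, fun t ht => funext fun i => ?_⟩
  refine Fintype.linearIndependent_iff.mp e.linearIndependent t (Subtype.ext ?_) i
  rw [Submodule.coe_sum, Submodule.coe_zero, ← ht]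
  exact Finset.sum_congr rfl fun i _ => by rw [Submodule.coe_smul, ha]

theorem le_finrank_range_of_independent (f : V →ₗ[F] E) {k : ℕ} (a : Fin k → V)
    (h : ∀ t : Fin k → F, ∑ i, t i • f (a i) = 0 → t = 0) :
    k ≤ Module.finrank F (LinearMap.range f) := by
  let _ : AddCommGroup E := Module.addCommMonoidToAddCommGroup F
  have hlin : LinearIndependent F (fun i => LinearMap.rangeRestrict f (a i)) := by
    rw [Fintype.linearIndependent_iff]
    intro t ht i
    refine congrFun (h t ?_) i
    have h3 := congrArg Subtype.val ht
    rw [Submodule.coe_sum, Submodule.coe_zero] at h3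
    exact h3
  simpa using hlin.fintype_card_le_finrank

end Rank

section HasPairing
variable {Γ : Type*} [Group Γ] {X : Type u} [TopologicalSpace X] {F : Type v} [Field F]
  [MulAction Γ X] [ContinuousConstSMul Γ X]

/-- The cup product pairing between the classes of `A_S` supported in `O` with degrees in `(p, q)`
and the classes of `A_S` supported in `O'` has rank at least `k`. -/
def HasPairing (A : NonUnitalSubalgebra F (SingularCohomology F X)) (S : Set Γ) (O O' : Set X)
    (p q : ℝ) (k : ℕ) : Prop :=
  ∃ a : Fin k → SingularCohomology F X,
    (∀ i, a i ∈ supportedClasses A S O ⊓ degreeBetween p q) ∧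
      PairingIndependent a (supportedClasses A S O')

variable {A B : NonUnitalSubalgebra F (SingularCohomology F X)} {S T : Set Γ} {O O' : Set X}
  {p q : ℝ} {k : ℕ}

theorem HasPairing.mono (h : HasPairing A S O O' p q k) (hAB : A ≤ B) (hST : S ⊆ T)
    {U U' : Set X} (hO : O ⊆ U) (hO' : O' ⊆ U') {p' q' : ℝ} (hp : p' ≤ p) (hq : q ≤ q') :
    HasPairing B T U U' p' q' k := by
  obtain ⟨a, ha, hind⟩ := h
  exact ⟨a, fun i => ⟨supportedClasses_mono hAB hST hO (ha i).1,
    degreeBetween_mono hp hq (ha i).2⟩, hind.mono (supportedClasses_mono hAB hST hO')⟩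

/-- The ranks of the pairings are supermultiplicative. -/
theorem HasPairing.mul (hA : IsFiniteGraded A) (hS : S.Finite) (hT : T.Finite)
    (hinj : Function.Injective (Submodule.mulMap (translatesAlgebra A S).toSubmodule
      (translatesAlgebra A T).toSubmodule)) {U U' : Set X} {p' q' : ℝ} {l : ℕ}
    (h : HasPairing A S O O' p q k) (h' : HasPairing A T U U' p' q' l) :
    HasPairing A (S ∪ T) (O ∩ U) (O' ∩ U') (p + p') (q + q') (k * l) := by
  obtain ⟨a, ha, hind⟩ := h
  obtain ⟨b, hb, hind'⟩ := h'
  have hmul := PairingIndependent.mul hinj (hA.translatesAlgebra hT).1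
    (inf_le_left : supportedClasses A S O' ≤ _) (inf_le_left : supportedClasses A T U' ≤ _)
    (isGraded_supportedClasses hA hS O') (isGraded_supportedClasses hA hT U')
    (fun i => (ha i).1.1) (fun j => (hb j).1.1) hind hind'
    (T := supportedClasses A (S ∪ T) (O' ∩ U'))
    (fun x hx y hy => mul_mem_supportedClasses hx hy)
  refine ⟨fun i => a (finProdFinEquiv.symm i).1 * b (finProdFinEquiv.symm i).2, fun i =>
    ⟨mul_mem_supportedClasses (ha _).1 (hb _).1, mul_mem_degreeBetween (ha _).2 (hb _).2⟩,
    fun t ht => ?_⟩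
  have := hmul (fun ij => t (finProdFinEquiv ij)) fun c hc => by
    rw [← ht c hc]
    congr 1
    exact Fintype.sum_equiv finProdFinEquiv _ _ fun ij => by simp
  ext i
  have h := congrFun this (finProdFinEquiv.symm i)
  rwa [Equiv.apply_symm_apply] at h

theorem HasPairing.smul (γ : Γ) (h : HasPairing A S O O' p q k) :
    HasPairing A (γ • S) ((γ⁻¹ • ·) ⁻¹' O) ((γ⁻¹ • ·) ⁻¹' O') p q k := by
  obtain ⟨a, ha, hind⟩ := h
  refine ⟨fun i => cohomologyPush γ (a i), fun i =>
    ⟨cohomologyPush_mem_supportedClasses γ (ha i).1, cohomologyMap_mem_degreeBetween _ (ha i).2⟩,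
    fun t ht => hind t fun b hb => ?_⟩
  have h1 := ht _ (cohomologyPush_mem_supportedClasses γ hb)
  have h2 : cohomologyPush γ ((∑ i, t i • a i) * b) = 0 := by
    rw [← h1, map_mul, map_sum]
    simp only [map_smul]
  have h3 := congrArg (cohomologyPush γ⁻¹) h2
  rw [map_zero] at h3
  have h4 := cohomologyPush_inv_cancel γ⁻¹ ((∑ i, t i • a i) * b)
  rw [inv_inv] at h4
  exact h4.symm.trans h3

theorem finiteDimensional_supportedClasses_inf (hA : IsFiniteGraded A) (hS : S.Finite)
    (O : Set X) (p q : ℝ) :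
    FiniteDimensional F ↥(supportedClasses A S O ⊓ degreeBetween p q) :=
  have := (hA.translatesAlgebra hS).2
  Submodule.finiteDimensional_of_le
    (inf_le_left.trans inf_le_left : _ ≤ (translatesAlgebra A S).toSubmodule)

theorem le_finrank_of_hasPairing (hA : IsFiniteGraded A) (hS : S.Finite)
    (h : HasPairing A S O O' p q k) :
    k ≤ Module.finrank F (LinearMap.range
      ((LinearMap.mul F (SingularCohomology F X)).domRestrict₁₂
        (supportedClasses A S O ⊓ degreeBetween p q) (supportedClasses A S O'))) := by
  obtain ⟨a, ha, hind⟩ := h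
  have := finiteDimensional_supportedClasses_inf hA hS O p q
  refine le_finrank_range_of_independent _ (fun i => ⟨a i, ha i⟩)
    fun t ht => hind t fun b hb => ?_
  have h3 := LinearMap.congr_fun ht ⟨b, hb⟩
  rw [LinearMap.sum_apply] at h3
  rw [Finset.sum_mul]
  refine Eq.trans (Finset.sum_congr rfl fun i _ => ?_) h3
  exact smul_mul_assoc _ _ _

theorem hasPairing_finrank (hA : IsFiniteGraded A) (hS : S.Finite) (O O' : Set X) (p q : ℝ) :
    HasPairing A S O O' p q (Module.finrank F (LinearMap.range
      ((LinearMap.mul F (SingularCohomology F X)).domRestrict₁₂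
        (supportedClasses A S O ⊓ degreeBetween p q) (supportedClasses A S O')))) := by
  have := finiteDimensional_supportedClasses_inf hA hS O p q
  obtain ⟨a, ha⟩ := exists_independent_of_finrank_range
    ((LinearMap.mul F (SingularCohomology F X)).domRestrict₁₂
      (supportedClasses A S O ⊓ degreeBetween p q) (supportedClasses A S O'))
  refine ⟨fun i => (a i).1, fun i => (a i).2, fun t ht => ha t (LinearMap.ext fun b => ?_)⟩
  rw [LinearMap.sum_apply]
  have h4 := ht b.1 b.2
  rw [Finset.sum_mul] at h4
  exact Eq.trans (Finset.sum_congr rfl fun i _ => (smul_mul_assoc (t i) (a i).1 b.1).symm) h4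

end HasPairing

/-! ### Interiors and amenable sequences -/

section Metric
variable {Γ : Type*} [MetricSpace Γ]

theorem setDist_le_edist {S T : Set Γ} {x y : Γ} (hx : x ∈ S) (hy : y ∈ T) :
    setDist S T ≤ edist x y :=
  (iInf₂_le (f := fun x (_ : x ∈ S) => ⨅ y ∈ T, edist x y) x hx).trans
    (iInf₂_le (f := fun y (_ : y ∈ T) => edist x y) y hy)

theorem setDist_anti {S S' T T' : Set Γ} (hS : S' ⊆ S) (hT : T' ⊆ T) :
    setDist S T ≤ setDist S' T' :=
  le_iInf₂ fun _ hx => le_iInf₂ fun _ hy => setDist_le_edist (hS hx) (hT hy)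

theorem mem_rInterior {r : ℝ≥0} {Ω : Set Γ} {x : Γ} :
    x ∈ rInterior r Ω ↔ x ∈ Ω ∧ (r : ℝ≥0∞) < setDist {x} Ωᶜ := by
  constructor
  · rintro ⟨hx, hb⟩
    refine ⟨hx, not_le.mp fun h => hb ⟨?_, h⟩⟩
    have : setDist {x} Ω ≤ edist x x := setDist_le_edist rfl hx
    rw [edist_self] at this
    exact this.trans zero_le
  · rintro ⟨hx, h⟩
    exact ⟨hx, fun hb => absurd hb.2 (not_le.mpr h)⟩

theorem rInterior_subset (r : ℝ≥0) (Ω : Set Γ) : rInterior r Ω ⊆ Ω := fun _ h => h.1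

/-- The interior of `Ω`, as a finite set. -/
noncomputable def interiorFinset (r : ℝ≥0) (Ω : Finset Γ) : Finset Γ :=
  (finite_rInterior r Ω).toFinset

theorem coe_interiorFinset (r : ℝ≥0) (Ω : Finset Γ) :
    (interiorFinset r Ω : Set Γ) = rInterior r (Ω : Set Γ) := (finite_rInterior r Ω).coe_toFinset

theorem interiorFinset_subset (r : ℝ≥0) (Ω : Finset Γ) : interiorFinset r Ω ⊆ Ω := by
  rw [← Finset.coe_subset, coe_interiorFinset]
  exact rInterior_subset r _

/-- Points near the boundary of the interior of `Ω` are near the boundary of `Ω`. -/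
theorem rBoundary_rInterior_subset (D R : ℝ≥0) (Ω : Set Γ) :
    rBoundary D (rInterior R Ω) ⊆ rBoundary (D + R) Ω := by
  rintro γ ⟨h1, h2⟩
  constructor
  · refine (setDist_anti subset_rfl (rInterior_subset R Ω)).trans (h1.trans ?_)
    exact_mod_cast le_self_add
  · have hle : setDist {γ} Ωᶜ ≤ setDist {γ} (rInterior R Ω)ᶜ + R := by
      rw [setDist, setDist, ENNReal.iInf_add]
      refine le_iInf fun x => ?_
      rw [ENNReal.iInf_add]
      refine le_iInf fun hx => ?_
      rw [ENNReal.iInf_add]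
      refine le_iInf fun y => ?_
      rw [ENNReal.iInf_add]
      refine le_iInf fun hy => ?_
      refine (iInf₂_le (f := fun x (_ : x ∈ ({γ} : Set Γ)) => ⨅ y ∈ Ωᶜ, edist x y) x hx).trans ?_
      by_cases hyΩ : y ∈ Ω
      · -- `y` is within `R` of the complement of `Ω`
        have hyR : setDist {y} Ωᶜ ≤ R := by
          by_contra h
          exact hy (mem_rInterior.mpr ⟨hyΩ, not_le.mp h⟩)
        refine le_trans ?_ (add_le_add_right hyR (edist x y))
        rw [setDist, _root_.iInf_singleton, ENNReal.add_iInf]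
        refine le_iInf fun z => ?_
        rw [ENNReal.add_iInf]
        exact le_iInf fun hz => (iInf₂_le z hz).trans (edist_triangle x y z)
      · exact (iInf₂_le y hyΩ).trans le_self_add
    refine hle.trans ?_
    rw [ENNReal.coe_add]
    exact add_le_add_left h2 _

theorem smul_rInterior_subset [Group Γ] [IsIsometricSMul Γ Γ] [DecidableEq Γ] (γ : Γ) (r : ℝ≥0)
    (Ω : Finset Γ) : γ • rInterior r (Ω : Set Γ) ⊆ rInterior r ((γ • Ω : Finset Γ) : Set Γ) := by
  rintro _ ⟨x, hx, rfl⟩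
  rw [mem_rInterior] at hx ⊢
  rw [Finset.coe_smul_finset]
  refine ⟨Set.smul_mem_smul_set hx.1, hx.2.trans_le ?_⟩
  refine le_iInf₂ fun z hz => le_iInf₂ fun y hy => ?_
  obtain rfl : z = γ • x := hz
  have hy' : γ⁻¹ • y ∈ ((Ω : Set Γ))ᶜ := fun h => hy (Set.mem_smul_set_iff_inv_smul_mem.mpr h)
  refine (setDist_le_edist (Set.mem_singleton x) hy').trans ?_
  rw [← edist_smul_left γ x, smul_inv_smul]

namespace IsAmenableSequence
variable {Ω : ℕ → Finset Γ}

theorem eventually_le_card [Infinite Γ] (hΩ : IsAmenableSequence Ω) (M : ℕ) :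
    ∀ᶠ i in atTop, M ≤ (Ω i).card := by
  classical
  obtain ⟨s, hs⟩ := Infinite.exists_subset_card_eq Γ M
  choose i hi using hΩ.exhausts
  filter_upwards [eventually_ge_atTop (s.sup i)] with k hk
  rw [← hs]
  exact Finset.card_le_card fun γ hγ => hΩ.mono ((Finset.le_sup hγ).trans hk) (hi γ)

theorem eventually_encard_le [Infinite Γ] (hΩ : IsAmenableSequence Ω) (r : ℝ≥0) {η : ℝ≥0∞}
    (hη : 0 < η) : ∀ᶠ i in atTop,
      ((rBoundary r (Ω i : Set Γ)).encard : ℝ≥0∞) ≤ η * ((Ω i).card : ℝ≥0∞) := by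
  filter_upwards [(hΩ.tendsto r).eventually (gt_mem_nhds hη), hΩ.eventually_le_card 1]
    with i hi h1
  have h0 : ((Ω i).card : ℝ≥0∞) ≠ 0 := by
    exact_mod_cast (by omega : (Ω i).card ≠ 0)
  exact (ENNReal.div_le_iff h0 (ENNReal.natCast_ne_top _)).mp hi.le

theorem eventually_card_interiorFinset [Infinite Γ] (hΩ : IsAmenableSequence Ω) (r : ℝ≥0) {η : ℝ}
    (hη : 0 < η) : ∀ᶠ i in atTop,
      (1 - η) * ((Ω i).card : ℝ) ≤ ((interiorFinset r (Ω i)).card : ℝ) := by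
  filter_upwards [hΩ.eventually_encard_le r (ENNReal.ofReal_pos.mpr hη)] with i hi
  classical
  have h1 : ((Ω i \ interiorFinset r (Ω i)).card : ℝ≥0∞) ≤
      ((rBoundary r (Ω i : Set Γ)).encard : ℝ≥0∞) := by
    have : ((Ω i \ interiorFinset r (Ω i) : Finset Γ) : Set Γ) ⊆ rBoundary r (Ω i : Set Γ) := by
      intro x hx
      rw [Finset.coe_sdiff, coe_interiorFinset] at hx
      by_contra h
      exact hx.2 ⟨hx.1, h⟩
    have h2 := Set.encard_le_encard this
    rw [Set.encard_coe_eq_coe_finsetCard] at h2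
    exact_mod_cast h2
  have h2 := h1.trans hi
  have h3 : ((Ω i \ interiorFinset r (Ω i)).card : ℝ) ≤ η * ((Ω i).card : ℝ) := by
    rw [← ENNReal.ofReal_natCast, ← ENNReal.ofReal_natCast,
      ← ENNReal.ofReal_mul hη.le] at h2
    exact (ENNReal.ofReal_le_ofReal_iff (by positivity)).mp h2
  have h4 : ((Ω i \ interiorFinset r (Ω i)).card : ℝ) + (interiorFinset r (Ω i)).card =
      (Ω i).card := by
    exact_mod_cast Finset.card_sdiff_add_card_eq_card (interiorFinset_subset r (Ω i))
  linarith

theorem eventually_amenabilityRatio_interiorFinset [Infinite Γ] (hΩ : IsAmenableSequence Ω)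
    (r : ℝ≥0) (T : Finset Γ) {η : ℝ≥0∞} (hη : 0 < η) :
    ∀ᶠ i in atTop, amenabilityRatio (interiorFinset r (Ω i)) T < η := by
  obtain ⟨η', hη', hlt⟩ := exists_between hη
  have hη2 : 0 < η' / 2 := ENNReal.half_pos hη'.ne'
  filter_upwards [
    hΩ.eventually_encard_le ((Metric.diam (T : Set Γ)).toNNReal + r) hη2,
    hΩ.eventually_card_interiorFinset r (η := 1 / 2) (by norm_num),
    hΩ.eventually_le_card 1] with i hi h2 h1
  have h1' : (1 : ℝ) ≤ (Ω i).card := by exact_mod_cast h1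
  have hpos : 0 < ((interiorFinset r (Ω i)).card : ℝ) := by linarith
  have h0 : ((interiorFinset r (Ω i)).card : ℝ≥0∞) ≠ 0 := by
    exact_mod_cast (Nat.cast_pos.mp hpos).ne'
  refine lt_of_le_of_lt ?_ hlt
  rw [amenabilityRatio, ENNReal.div_le_iff h0 (ENNReal.natCast_ne_top _), coe_interiorFinset]
  have h3 : ((Ω i).card : ℝ≥0∞) ≤ 2 * ((interiorFinset r (Ω i)).card : ℝ≥0∞) := by
    have : (Ω i).card ≤ 2 * (interiorFinset r (Ω i)).card := by
      have : ((Ω i).card : ℝ) ≤ 2 * ((interiorFinset r (Ω i)).card : ℝ) := by linarith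
      exact_mod_cast this
    exact_mod_cast this
  calc ((rBoundary _ (rInterior r (Ω i : Set Γ))).encard : ℝ≥0∞)
      ≤ ((rBoundary ((Metric.diam (T : Set Γ)).toNNReal + r) (Ω i : Set Γ)).encard : ℝ≥0∞) := by
        exact_mod_cast Set.encard_le_encard (rBoundary_rInterior_subset _ _ _)
    _ ≤ η' / 2 * ((Ω i).card : ℝ≥0∞) := hi
    _ ≤ η' / 2 * (2 * ((interiorFinset r (Ω i)).card : ℝ≥0∞)) := by gcongr
    _ = η' * ((interiorFinset r (Ω i)).card : ℝ≥0∞) := by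
        rw [← mul_assoc, ENNReal.div_mul_cancel (by norm_num) (by norm_num)]

end IsAmenableSequence

end Metric

/-- A subfamily of prescribed total weight, up to the maximal weight of a member. -/
theorem exists_subset_sum_near {τ : Type*} (I : Finset τ) (w : τ → ℝ) {M x : ℝ}
    (hw : ∀ t ∈ I, w t ≤ M) (hM : 0 ≤ M) (hx : 0 ≤ x) (hxI : x ≤ ∑ t ∈ I, w t) :
    ∃ J ⊆ I, ∑ t ∈ J, w t ≤ x ∧ x - M ≤ ∑ t ∈ J, w t := by
  classical
  have key : ∀ I : Finset τ, (∀ t ∈ I, w t ≤ M) →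
      ∃ J ⊆ I, ∑ t ∈ J, w t ≤ x ∧ (x - M ≤ ∑ t ∈ J, w t ∨ J = I) := by
    intro I
    induction I using Finset.induction_on with
    | empty => exact fun _ => ⟨∅, subset_rfl, by simpa using hx, Or.inr rfl⟩
    | insert a I ha ih =>
      intro hw
      obtain ⟨J, hJ, h1, h2⟩ := ih fun t ht => hw t (Finset.mem_insert_of_mem ht)
      by_cases h : x - M ≤ ∑ t ∈ J, w t
      · exact ⟨J, hJ.trans (Finset.subset_insert a I), h1, Or.inl h⟩
      · obtain rfl := h2.resolve_left h
        refine ⟨insert a J, subset_rfl, ?_, Or.inr rfl⟩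
        rw [Finset.sum_insert ha]
        have := hw a (Finset.mem_insert_self a J)
        linarith
  obtain ⟨J, hJ, h1, h2⟩ := key I hw
  refine ⟨J, hJ, h1, h2.elim id ?_⟩
  rintro rfl
  linarith

/-! ### Classes on disjoint tiles -/

theorem orbitAverage_smul {Γ : Type*} [Group Γ] [DecidableEq Γ] {X : Type*} [MulAction Γ X]
    (f : X → ℝ) (γ : Γ) (Ω : Finset Γ) (x : X) :
    orbitAverage f (γ • Ω) x = orbitAverage f Ω (γ⁻¹ • x) := by
  rw [orbitAverage, orbitAverage, Finset.card_smul_finset, Finset.smul_finset_def,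
    Finset.sum_image fun a _ b _ h => smul_left_cancel γ h]
  simp only [smul_eq_mul, mul_inv_rev, mul_smul]

section Tiles
variable {Γ : Type*} [Group Γ] [MetricSpace Γ]
  {X : Type u} [TopologicalSpace X] [MulAction Γ X] [ContinuousConstSMul Γ X]
  {F : Type v} [Field F]

/-- The homological measure of `Ω` at level `c` and degrees `ℓ |Ω|` is at least `exp (h |Ω|)`, up to
the tolerances `δ` and `ν`. -/
def HasGrowth (f : X → ℝ) (A : NonUnitalSubalgebra F (SingularCohomology F X)) (r : ℝ≥0)
    (ℓ c ν δ h : ℝ) (Ω : Finset Γ) : Prop :=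
  ∃ k : ℕ, Real.exp (h * Ω.card) ≤ k ∧
    HasPairing A (rInterior r (Ω : Set Γ)) (orbitAverage f Ω ⁻¹' Set.Iio (c + δ))
      (orbitAverage f Ω ⁻¹' Set.Ioi (c - δ)) ((ℓ - ν) * Ω.card) ((ℓ + ν) * Ω.card) k

/-- Growth is invariant under left translation of the set. -/
theorem HasGrowth.smul [DecidableEq Γ] [IsIsometricSMul Γ Γ] {f : X → ℝ}
    {A : NonUnitalSubalgebra F (SingularCohomology F X)} {r : ℝ≥0} {ℓ c ν δ h : ℝ} {Ω : Finset Γ}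
    (H : HasGrowth f A r ℓ c ν δ h Ω) (γ : Γ) :
    HasGrowth f A r ℓ c ν δ h (γ • Ω) := by
  obtain ⟨k, hk, hp⟩ := H
  refine ⟨k, by rwa [Finset.card_smul_finset], ?_⟩
  rw [Finset.card_smul_finset]
  refine (hp.smul γ).mono le_rfl (smul_rInterior_subset γ r Ω) ?_ ?_ le_rfl le_rfl
  · intro x hx
    simp only [Set.mem_preimage] at hx ⊢
    rwa [orbitAverage_smul]
  · intro x hx
    simp only [Set.mem_preimage] at hx ⊢
    rwa [orbitAverage_smul]

/-- The ranks of the pairings multiply over disjoint tiles: the radius `ρ(A)` is such that the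
interiors of the tiles are far enough from each other for the cup product to be injective. -/
theorem HasPairing.prod {𝔞 A : NonUnitalSubalgebra F (SingularCohomology F X)}
    {N ρ : NonUnitalSubalgebra F (SingularCohomology F X) → ℝ≥0}
    (hN : IsProductLike Γ 𝔞 N) (hρ : IsSeparatingRadius Γ 𝔞 N ρ) (hA : IsFiniteGradedIn 𝔞 A)
    {τ : Type*} {I : Finset τ} (hI : I.Nonempty) (T : τ → Finset Γ) (O O' : τ → Set X)
    (p q : τ → ℝ) (k : τ → ℕ)
    (hdisj : ∀ t ∈ I, ∀ t' ∈ I, t ≠ t' → Disjoint (T t) (T t'))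
    (h : ∀ t ∈ I, HasPairing A (rInterior (ρ A) (T t : Set Γ)) (O t) (O' t) (p t) (q t) (k t)) :
    HasPairing A (⋃ t ∈ I, rInterior (ρ A) (T t : Set Γ)) (⋂ t ∈ I, O t) (⋂ t ∈ I, O' t)
      (∑ t ∈ I, p t) (∑ t ∈ I, q t) (∏ t ∈ I, k t) := by
  classical
  induction hI using Finset.Nonempty.cons_induction with
  | singleton a =>
    have := h a (Finset.mem_singleton_self a)
    simpa using this
  | cons a s ha hs ih =>
    have ih' := ih
      (fun t ht t' ht' => hdisj t (Finset.mem_cons_of_mem ht) t' (Finset.mem_cons_of_mem ht'))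
      (fun t ht => h t (Finset.mem_cons_of_mem ht))
    have h1 := h a (Finset.mem_cons_self a s)
    have hfin1 := finite_rInterior (ρ A) (T a)
    have hfin2 : (⋃ t ∈ s, rInterior (ρ A) (T t : Set Γ)).Finite :=
      s.finite_toSet.biUnion fun t _ => finite_rInterior (ρ A) (T t)
    have hsep : (N A : ℝ≥0∞) < setDist (rInterior (ρ A) (T a : Set Γ))
        (⋃ t ∈ s, rInterior (ρ A) (T t : Set Γ)) := by
      refine lt_setDist_of_forall hfin1 hfin2 fun x hx y hy => ?_
      simp only [Set.mem_iUnion] at hy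
      obtain ⟨t, ht, hy⟩ := hy
      refine (hρ A hA (T a) (T t) ?_).trans_le (setDist_le_edist hx hy)
      exact hdisj a (Finset.mem_cons_self a s) t (Finset.mem_cons_of_mem ht)
        (fun h => ha (h ▸ ht))
    have hinj := hN.injective A hA hfin1.toFinset hfin2.toFinset
      (by rwa [hfin1.coe_toFinset, hfin2.coe_toFinset])
    rw [hfin1.coe_toFinset, hfin2.coe_toFinset] at hinj
    have h2 := HasPairing.mul (isFiniteGradedIn_iff.mp hA).2 hfin1 hfin2 hinj h1 ih'
    simp only [Finset.sum_cons, Finset.prod_cons]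
    refine h2.mono le_rfl ?_ ?_ ?_ le_rfl le_rfl
    · refine Set.union_subset (fun x hx => ?_) (fun x hx => ?_)
      · exact Set.mem_biUnion (Finset.mem_cons_self a s) hx
      · simp only [Set.mem_iUnion] at hx ⊢
        obtain ⟨t, ht, hx⟩ := hx
        exact ⟨t, Finset.mem_cons_of_mem ht, hx⟩
    · intro x hx
      simp only [Set.mem_iInter, Finset.mem_cons] at *
      rintro t (rfl | ht)
      · exact hx.1
      · exact (Set.mem_iInter₂.mp hx.2) t ht
    · intro x hx
      simp only [Set.mem_iInter, Finset.mem_cons] at *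
      rintro t (rfl | ht)
      · exact hx.1
      · exact (Set.mem_iInter₂.mp hx.2) t ht

/-- Growth on disjoint tiles in the interior of `Ω` implies growth on `Ω`, with the weighted
averages of the parameters. As `0 ≤ f ≤ 1`, a point of `Ω` outside the tiles adds at
most `1` to the sum that defines the average over `Ω`, and at least `0`. -/
theorem HasGrowth.of_tiles {𝔞 A C : NonUnitalSubalgebra F (SingularCohomology F X)}
    {N ρ : NonUnitalSubalgebra F (SingularCohomology F X) → ℝ≥0}
    (hN : IsProductLike Γ 𝔞 N) (hρ : IsSeparatingRadius Γ 𝔞 N ρ) (hA : IsFiniteGradedIn 𝔞 A)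
    (hAC : A ≤ C) {f : X → ℝ} (hf : ∀ x, f x ∈ Set.Icc (0 : ℝ) 1)
    {τ : Type*} {I : Finset τ} (hI : I.Nonempty) (T : τ → Finset Γ)
    (hT : ∀ t ∈ I, (T t).Nonempty)
    (hdisj : ∀ t ∈ I, ∀ t' ∈ I, t ≠ t' → Disjoint (T t) (T t'))
    (Ω : Finset Γ) (r : ℝ≥0) (hsub : ∀ t ∈ I, T t ⊆ interiorFinset r Ω)
    (ℓ c h : τ → ℝ) {ν δ ℓ₀ c₀ h₀ ν₀ δ₀ : ℝ}
    (hg : ∀ t ∈ I, HasGrowth f A (ρ A) (ℓ t) (c t) ν δ (h t) (T t))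
    (hup : ∑ t ∈ I, (c t + δ) * (T t).card + (Ω.card - ∑ t ∈ I, ((T t).card : ℝ)) ≤
      (c₀ + δ₀) * Ω.card)
    (hlow : (c₀ - δ₀) * Ω.card ≤ ∑ t ∈ I, (c t - δ) * (T t).card)
    (hp : (ℓ₀ - ν₀) * Ω.card ≤ ∑ t ∈ I, (ℓ t - ν) * (T t).card)
    (hq : ∑ t ∈ I, (ℓ t + ν) * (T t).card ≤ (ℓ₀ + ν₀) * Ω.card)
    (hh : h₀ * Ω.card ≤ ∑ t ∈ I, h t * (T t).card) :
    HasGrowth f C r ℓ₀ c₀ ν₀ δ₀ h₀ Ω := by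
  classical
  have hg' : ∀ t, ∃ k : ℕ, t ∈ I → Real.exp (h t * (T t).card) ≤ k ∧
      HasPairing A (rInterior (ρ A) (T t : Set Γ)) (orbitAverage f (T t) ⁻¹' Set.Iio (c t + δ))
        (orbitAverage f (T t) ⁻¹' Set.Ioi (c t - δ)) ((ℓ t - ν) * (T t).card)
        ((ℓ t + ν) * (T t).card) k := by
    intro t
    by_cases ht : t ∈ I
    · obtain ⟨k, hk⟩ := hg t ht
      exact ⟨k, fun _ => hk⟩
    · exact ⟨0, fun h => absurd h ht⟩
  choose k hk using hg'
  have hprod := HasPairing.prod hN hρ hA hI T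
    (fun t => orbitAverage f (T t) ⁻¹' Set.Iio (c t + δ))
    (fun t => orbitAverage f (T t) ⁻¹' Set.Ioi (c t - δ)) (fun t => (ℓ t - ν) * (T t).card)
    (fun t => (ℓ t + ν) * (T t).card) k hdisj (fun t ht => (hk t ht).2)
  have hUsub : I.biUnion T ⊆ Ω := Finset.biUnion_subset.mpr fun t ht =>
    (hsub t ht).trans (interiorFinset_subset r Ω)
  have hpd : (I : Set τ).PairwiseDisjoint T := fun t ht t' ht' hne => hdisj t ht t' ht' hne
  have hcard : ((I.biUnion T).card : ℝ) = ∑ t ∈ I, ((T t).card : ℝ) := by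
    rw [Finset.card_biUnion hdisj, Nat.cast_sum]
  obtain ⟨t₀, ht₀⟩ := hI
  have hΩ0 : (0 : ℝ) < Ω.card := by
    obtain ⟨γ, hγ⟩ := hT t₀ ht₀
    exact_mod_cast Finset.card_pos.mpr ⟨γ, hUsub (Finset.mem_biUnion.mpr ⟨t₀, ht₀, hγ⟩)⟩
  have hT0 : ∀ t ∈ I, (0 : ℝ) < (T t).card := fun t ht => by
    exact_mod_cast Finset.card_pos.mpr (hT t ht)
  have hsplit : ∀ x : X, ∑ γ ∈ Ω, f (γ⁻¹ • x) =
      ∑ t ∈ I, ∑ γ ∈ T t, f (γ⁻¹ • x) + ∑ γ ∈ Ω \ I.biUnion T, f (γ⁻¹ • x) := by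
    intro x
    rw [← Finset.sum_biUnion hpd, add_comm, Finset.sum_sdiff hUsub]
  have hrest : ∀ x : X, 0 ≤ ∑ γ ∈ Ω \ I.biUnion T, f (γ⁻¹ • x) ∧
      ∑ γ ∈ Ω \ I.biUnion T, f (γ⁻¹ • x) ≤ Ω.card - ∑ t ∈ I, ((T t).card : ℝ) := by
    intro x
    refine ⟨Finset.sum_nonneg fun γ _ => (hf _).1, ?_⟩
    have h1 : ((Ω \ I.biUnion T).card : ℝ) + (I.biUnion T).card = Ω.card := by
      exact_mod_cast Finset.card_sdiff_add_card_eq_card hUsub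
    have h2 := Finset.sum_le_card_nsmul (Ω \ I.biUnion T) (fun γ => f (γ⁻¹ • x)) 1
      fun γ _ => (hf _).2
    rw [nsmul_eq_mul, mul_one] at h2
    linarith
  refine ⟨∏ t ∈ I, k t, ?_, hprod.mono hAC ?_ ?_ ?_ hp hq⟩
  · calc Real.exp (h₀ * Ω.card) ≤ Real.exp (∑ t ∈ I, h t * (T t).card) := Real.exp_le_exp.mpr hh
      _ = ∏ t ∈ I, Real.exp (h t * (T t).card) := Real.exp_sum _ _
      _ ≤ ∏ t ∈ I, (k t : ℝ) :=
        Finset.prod_le_prod (fun t _ => (Real.exp_pos _).le) fun t ht => (hk t ht).1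
      _ = ((∏ t ∈ I, k t : ℕ) : ℝ) := by rw [Nat.cast_prod]
  · refine Set.iUnion₂_subset fun t ht => (rInterior_subset _ _).trans ?_
    rw [← coe_interiorFinset]
    exact Finset.coe_subset.mpr (hsub t ht)
  · intro x hx
    rw [Set.mem_preimage, Set.mem_Iio, orbitAverage, div_lt_iff₀ hΩ0, hsplit x]
    refine lt_of_lt_of_le ?_ hup
    refine add_lt_add_of_lt_of_le (Finset.sum_lt_sum_of_nonempty ⟨t₀, ht₀⟩ fun t ht => ?_)
      (hrest x).2
    have := Set.mem_iInter₂.mp hx t ht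
    rwa [Set.mem_preimage, Set.mem_Iio, orbitAverage, div_lt_iff₀ (hT0 t ht)] at this
  · intro x hx
    rw [Set.mem_preimage, Set.mem_Ioi, orbitAverage, lt_div_iff₀ hΩ0, hsplit x]
    refine lt_of_le_of_lt hlow ?_
    refine lt_of_lt_of_le (Finset.sum_lt_sum_of_nonempty ⟨t₀, ht₀⟩ fun t ht => ?_)
      (le_add_of_nonneg_right (hrest x).1)
    have := Set.mem_iInter₂.mp hx t ht
    rwa [Set.mem_preimage, Set.mem_Ioi, orbitAverage, lt_div_iff₀ (hT0 t ht)] at this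

end Tiles

/-! ### Mixing two kinds of tiles -/

theorem sum_ite_mul_of_subset {τ : Type*} [DecidableEq τ] {I J : Finset τ} (h : J ⊆ I)
    (w : τ → ℝ) (x y : ℝ) :
    ∑ t ∈ I, (if t ∈ J then x else y) * w t =
      x * ∑ t ∈ J, w t + y * (∑ t ∈ I, w t - ∑ t ∈ J, w t) := by
  rw [← Finset.sum_sdiff h, ← Finset.sum_sdiff (f := w) h, add_comm, Finset.mul_sum,
    add_sub_cancel_right, Finset.mul_sum]
  congr 1
  · exact Finset.sum_congr rfl fun t ht => by rw [if_pos ht]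
  · exact Finset.sum_congr rfl fun t ht => by rw [if_neg (Finset.mem_sdiff.mp ht).2]

/-- If `V₁ ≈ α n` and `V₂ ≈ (1 - α) n`, then `x V₁ + y V₂ ≈ (α x + (1 - α) y) n`. -/
theorem abs_mixture_sub_le {α η n V₁ V₂ x y K : ℝ} (h₁ : |V₁ - α * n| ≤ η * n)
    (h₂ : |V₂ - (1 - α) * n| ≤ η * n) (hK : |x| + |y| ≤ K) (hη : 0 ≤ η * n) :
    |x * V₁ + y * V₂ - (α * x + (1 - α) * y) * n| ≤ K * (η * n) := by
  have e : x * V₁ + y * V₂ - (α * x + (1 - α) * y) * n =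
      x * (V₁ - α * n) + y * (V₂ - (1 - α) * n) := by ring
  rw [e]
  calc |x * (V₁ - α * n) + y * (V₂ - (1 - α) * n)|
      ≤ |x| * |V₁ - α * n| + |y| * |V₂ - (1 - α) * n| := by
        rw [← abs_mul, ← abs_mul]; exact abs_add_le _ _
    _ ≤ |x| * (η * n) + |y| * (η * n) := by gcongr
    _ = (|x| + |y|) * (η * n) := by ring
    _ ≤ K * (η * n) := mul_le_mul_of_nonneg_right hK hη

section Mixing
variable {Γ : Type*} [Group Γ] [Infinite Γ] [DecidableEq Γ] [MetricSpace Γ]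
  {X : Type u} [TopologicalSpace X] [MulAction Γ X]
  [ContinuousConstSMul Γ X] {F : Type v} [Field F]

/-- The interior of a large member of a tiling amenable sequence is disjointly tiled, up to a small
proportion, by translates of members of a subsequence, and the tiles can be divided into two kinds
with total volumes in any given proportion. -/
theorem IsTilingAmenableSequence.eventually_exists_tiles {Ω : ℕ → Finset Γ}
    (hΩ : IsTilingAmenableSequence Ω) (r : ℝ≥0) {φ : ℕ → ℕ} (hφ : StrictMono φ) {α : ℝ}
    (hα : α ∈ Set.Icc (0 : ℝ) 1) {η : ℝ} (hη : 0 < η) (hη1 : η ≤ 1) :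
    ∀ᶠ i in atTop, ∃ I J : Finset (Σ _ : ℕ, Γ), J ⊆ I ∧
      (∀ t ∈ I, t.2 • Ω (φ t.1) ⊆ interiorFinset r (Ω i)) ∧
      (∀ t ∈ I, ∀ t' ∈ I, t ≠ t' → Disjoint (t.2 • Ω (φ t.1)) (t'.2 • Ω (φ t'.1))) ∧
      (1 - 2 * η) * (Ω i).card ≤ ∑ t ∈ I, ((t.2 • Ω (φ t.1)).card : ℝ) ∧
      ∑ t ∈ I, ((t.2 • Ω (φ t.1)).card : ℝ) ≤ (Ω i).card ∧
      |∑ t ∈ J, ((t.2 • Ω (φ t.1)).card : ℝ) - α * (Ω i).card| ≤ 3 * η * (Ω i).card := by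
  obtain ⟨S, η', hη', htile⟩ := hΩ.tiles η hη φ hφ
  obtain ⟨M, hM⟩ : ∃ M : ℕ, ∀ j ∈ S, (Ω (φ j)).card ≤ M :=
    ⟨S.sup fun j => (Ω (φ j)).card, fun j hj => Finset.le_sup (f := fun j => (Ω (φ j)).card) hj⟩
  have hratio : ∀ᶠ i in atTop, ∀ j ∈ S,
      amenabilityRatio (interiorFinset r (Ω i)) (Ω (φ j)) < η' := by
    rw [Finset.eventually_all]
    exact fun j _ =>
      hΩ.toIsAmenableSequence.eventually_amenabilityRatio_interiorFinset r (Ω (φ j)) hη'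
  filter_upwards [hratio, hΩ.toIsAmenableSequence.eventually_card_interiorFinset r hη,
    hΩ.toIsAmenableSequence.eventually_le_card ⌈(M : ℝ) / η⌉₊] with i hi hint hcard
  obtain ⟨C, hsub, hdisj, hcov⟩ := htile _ hi
  set n : ℝ := ((Ω i).card : ℝ) with hn
  set w : (Σ _ : ℕ, Γ) → ℝ := fun t => ((t.2 • Ω (φ t.1)).card : ℝ) with hw
  have hMn : (M : ℝ) ≤ η * n := by
    have h1 : (M : ℝ) / η ≤ n := (Nat.le_ceil _).trans (by rw [hn]; exact_mod_cast hcard)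
    rw [div_le_iff₀ hη] at h1
    linarith
  have hn0 : 0 ≤ n := Nat.cast_nonneg _
  have hsub' : ∀ t ∈ S.sigma C, t.2 • Ω (φ t.1) ⊆ interiorFinset r (Ω i) := fun t ht =>
    hsub t.1 (Finset.mem_sigma.mp ht).1 t.2 (Finset.mem_sigma.mp ht).2
  have hdisj' : ∀ t ∈ S.sigma C, ∀ t' ∈ S.sigma C, t ≠ t' →
      Disjoint (t.2 • Ω (φ t.1)) (t'.2 • Ω (φ t'.1)) := by
    rintro ⟨j, γ⟩ ht ⟨j', γ'⟩ ht' hne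
    rw [Finset.mem_sigma] at ht ht'
    refine hdisj j ht.1 γ ht.2 j' ht'.1 γ' ht'.2 fun h => hne ?_
    rw [Prod.mk.injEq] at h
    rw [h.1, h.2]
  have hVle : ∑ t ∈ S.sigma C, w t ≤ n := by
    have h1 : ((S.sigma C).biUnion fun t => t.2 • Ω (φ t.1)).card ≤ (Ω i).card :=
      Finset.card_le_card (Finset.biUnion_subset.mpr fun t ht =>
        (hsub' t ht).trans (interiorFinset_subset r _))
    rw [Finset.card_biUnion hdisj'] at h1
    simp only [hn, hw]
    exact_mod_cast h1
  have hVge : (1 - 2 * η) * n ≤ ∑ t ∈ S.sigma C, w t := by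
    have h1 : ((S.biUnion fun j => (C j).biUnion fun γ => γ • Ω (φ j)).card : ℝ) ≤
        ∑ t ∈ S.sigma C, w t := by
      rw [Finset.sum_sigma]
      have : (S.biUnion fun j => (C j).biUnion fun γ => γ • Ω (φ j)).card ≤
          ∑ j ∈ S, ∑ γ ∈ C j, (γ • Ω (φ j)).card :=
        Finset.card_biUnion_le.trans (Finset.sum_le_sum fun j _ => Finset.card_biUnion_le)
      simp only [hw]
      exact_mod_cast this
    refine le_trans ?_ (hcov.trans h1)
    nlinarith
  obtain ⟨J, hJ, hJ1, hJ2⟩ := exists_subset_sum_near (S.sigma C) w (M := M)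
    (x := α * ∑ t ∈ S.sigma C, w t)
    (fun t ht => by
      simp only [hw, Finset.card_smul_finset]
      exact_mod_cast hM t.1 (Finset.mem_sigma.mp ht).1)
    (Nat.cast_nonneg _)
    (mul_nonneg hα.1 (Finset.sum_nonneg fun t _ => Nat.cast_nonneg _))
    (mul_le_of_le_one_left (Finset.sum_nonneg fun t _ => Nat.cast_nonneg _) hα.2)
  refine ⟨S.sigma C, J, hJ, hsub', hdisj', hVge, hVle, ?_⟩
  rw [abs_le]
  constructor
  · have h1 : α * ((1 - 2 * η) * n) ≤ α * ∑ t ∈ S.sigma C, w t :=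
      mul_le_mul_of_nonneg_left hVge hα.1
    have h2 : α * (2 * η * n) ≤ 1 * (2 * η * n) :=
      mul_le_mul_of_nonneg_right hα.2 (by positivity)
    linarith
  · have h1 : α * ∑ t ∈ S.sigma C, w t ≤ α * n := mul_le_mul_of_nonneg_left hVle hα.1
    have h2 : 0 ≤ 3 * η * n := by positivity
    linarith

/-- Growth of two kinds, present on all members of a subsequence, can be mixed in any proportion on
all large members of the sequence, and for a larger algebra with a different radius. The same tiles
serve for both kinds; only the classes placed on them differ. -/
theorem eventually_hasGrowth_mixture [IsIsometricSMul Γ Γ]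
    {𝔞 A C : NonUnitalSubalgebra F (SingularCohomology F X)}
    {N ρ : NonUnitalSubalgebra F (SingularCohomology F X) → ℝ≥0}
    (hN : IsProductLike Γ 𝔞 N) (hρ : IsSeparatingRadius Γ 𝔞 N ρ) (hA : IsFiniteGradedIn 𝔞 A)
    (hAC : A ≤ C) {f : X → ℝ} (hf : ∀ x, f x ∈ Set.Icc (0 : ℝ) 1) {Ω : ℕ → Finset Γ}
    (hΩ : IsTilingAmenableSequence Ω) (r : ℝ≥0) {φ : ℕ → ℕ} (hφ : StrictMono φ) {α : ℝ}
    (hα : α ∈ Set.Icc (0 : ℝ) 1) (ℓ₁ ℓ₂ : ℝ) {c₁ c₂ : ℝ} (hc₁ : c₁ ∈ Set.Icc (0 : ℝ) 1)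
    (hc₂ : c₂ ∈ Set.Icc (0 : ℝ) 1) (h₁ h₂ : ℝ) {ν δ ε : ℝ} (hν : 0 < ν) (hδ : 0 < δ) (hε : 0 < ε)
    (hne : ∀ j, (Ω (φ j)).Nonempty)
    (H₁ : ∀ j, HasGrowth f A (ρ A) ℓ₁ c₁ ν δ h₁ (Ω (φ j)))
    (H₂ : ∀ j, HasGrowth f A (ρ A) ℓ₂ c₂ ν δ h₂ (Ω (φ j))) :
    ∀ᶠ i in atTop, HasGrowth f C r (α * ℓ₁ + (1 - α) * ℓ₂) (α * c₁ + (1 - α) * c₂)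
      (2 * ν) (2 * δ) (α * h₁ + (1 - α) * h₂ - ε) (Ω i) := by
  set K : ℝ := 3 + |ℓ₁| + |ℓ₂| + |h₁| + |h₂| with hK
  have hℓ₁ := abs_nonneg ℓ₁
  have hℓ₂ := abs_nonneg ℓ₂
  have hh₁ := abs_nonneg h₁
  have hh₂ := abs_nonneg h₂
  have hK0 : 0 < K := by positivity
  -- the error terms below are at most `8 K η |Ω i|`
  obtain ⟨η, hη, hη4, hηδ, hην, hηε⟩ : ∃ η : ℝ, 0 < η ∧ η ≤ 1 / 4 ∧ 8 * K * η ≤ δ ∧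
      8 * K * η ≤ ν ∧ 8 * K * η ≤ ε := by
    refine ⟨min (1 / 4) (min δ (min ν ε) / (8 * K)), by positivity, min_le_left _ _, ?_⟩
    have h : 8 * K * min (1 / 4) (min δ (min ν ε) / (8 * K)) ≤ min δ (min ν ε) := by
      calc _ ≤ 8 * K * (min δ (min ν ε) / (8 * K)) := by gcongr; exact min_le_right _ _
        _ = _ := by field_simp
    exact ⟨h.trans (min_le_left _ _), h.trans ((min_le_right _ _).trans (min_le_left _ _)),
      h.trans ((min_le_right _ _).trans (min_le_right _ _))⟩
  filter_upwards [hΩ.eventually_exists_tiles r hφ hα hη (by linarith),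
    hΩ.toIsAmenableSequence.eventually_le_card 1] with i ⟨I, J, hJ, hsub, hdisj, hVge, hVle, hV₁⟩ h1
  classical
  set n : ℝ := ((Ω i).card : ℝ) with hn
  have hn1 : 1 ≤ n := by rw [hn]; exact_mod_cast h1
  set V := ∑ t ∈ I, ((t.2 • Ω (φ t.1)).card : ℝ) with hV
  set V₁ := ∑ t ∈ J, ((t.2 • Ω (φ t.1)).card : ℝ) with hV₁def
  have hηn : 0 < η * n := by positivity
  have hV₁' := abs_le.mp hV₁
  have hb₁ : |V₁ - α * n| ≤ 5 * η * n := hV₁.trans (by linarith)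
  have hb₂ : |(V - V₁) - (1 - α) * n| ≤ 5 * η * n := by
    rw [abs_le]
    constructor <;> linarith
  have hmix : ∀ x y : ℝ, |x| + |y| + 1 ≤ K →
      |x * V₁ + y * (V - V₁) - (α * x + (1 - α) * y) * n| ≤ (K - 1) * (5 * η * n) :=
    fun x y hxy => abs_mixture_sub_le hb₁ hb₂ (by linarith) (by positivity)
  have hKη : 8 * (η * n) ≤ 8 * K * η * n := by nlinarith
  have hδn : 8 * K * η * n ≤ δ * n := mul_le_mul_of_nonneg_right hηδ (by linarith)
  have hνn : 8 * K * η * n ≤ ν * n := mul_le_mul_of_nonneg_right hην (by linarith)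
  have hεn : 8 * K * η * n ≤ ε * n := mul_le_mul_of_nonneg_right hηε (by linarith)
  have hKηn : 0 < K * η * n := by positivity
  have hδV : δ * V ≤ δ * n := mul_le_mul_of_nonneg_left hVle hδ.le
  have hνV : ν * V ≤ ν * n := mul_le_mul_of_nonneg_left hVle hν.le
  have hI : I.Nonempty := by
    rw [Finset.nonempty_iff_ne_empty]
    rintro rfl
    rw [Finset.sum_empty] at hV
    rw [hV] at hVge
    nlinarith
  have hc := abs_le.mp (hmix c₁ c₂ (by
    rw [abs_of_nonneg hc₁.1, abs_of_nonneg hc₂.1]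
    linarith [hc₁.2, hc₂.2]))
  have hℓ := abs_le.mp (hmix ℓ₁ ℓ₂ (by linarith))
  have hh := abs_le.mp (hmix h₁ h₂ (by linarith))
  refine HasGrowth.of_tiles hN hρ hA hAC hf hI (fun t => t.2 • Ω (φ t.1))
    (fun t _ => (hne t.1).smul_finset) hdisj (Ω i) r hsub
    (fun t => if t ∈ J then ℓ₁ else ℓ₂) (fun t => if t ∈ J then c₁ else c₂)
    (fun t => if t ∈ J then h₁ else h₂) (ν := ν) (δ := δ) ?_ ?_ ?_ ?_ ?_ ?_
  · intro t _
    split_ifs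
    · exact (H₁ t.1).smul t.2
    · exact (H₂ t.1).smul t.2
  · simp only [add_mul, Finset.sum_add_distrib, sum_ite_mul_of_subset hJ, ← Finset.mul_sum]
    rw [← hV, ← hV₁def]
    linarith
  · simp only [sub_mul, Finset.sum_sub_distrib, sum_ite_mul_of_subset hJ, ← Finset.mul_sum]
    rw [← hV, ← hV₁def]
    linarith
  · simp only [sub_mul, Finset.sum_sub_distrib, sum_ite_mul_of_subset hJ, ← Finset.mul_sum]
    rw [← hV, ← hV₁def]
    linarith
  · simp only [add_mul, Finset.sum_add_distrib, sum_ite_mul_of_subset hJ, ← Finset.mul_sum]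
    rw [← hV, ← hV₁def]
    linarith
  · simp only [sum_ite_mul_of_subset hJ]
    rw [← hV, ← hV₁def]
    linarith

end Mixing

/-! ### Growth rates -/

section Growth
variable {Γ : Type*} [Group Γ] [MetricSpace Γ] {X : Type u} [TopologicalSpace X] [MulAction Γ X]
  [ContinuousConstSMul Γ X] {F : Type v} [Field F]

theorem coe_mul_card_le_log_iff {h : ℝ} {n k : ℕ} :
    ((h * n : ℝ) : EReal) ≤ ENNReal.log (k : ℝ≥0∞) ↔ Real.exp (h * n) ≤ k := by
  rw [← EReal.exp_le_exp_iff, ENNReal.exp_log, EReal.exp_coe, ← ENNReal.ofReal_natCast,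
    ENNReal.ofReal_le_ofReal_iff (Nat.cast_nonneg k)]

theorem coe_le_log_div_card_iff {h : ℝ} {n k : ℕ} (hn : 0 < n) :
    (h : EReal) ≤ ENNReal.log (k : ℝ≥0∞) / (n : EReal) ↔ Real.exp (h * n) ≤ k := by
  rw [EReal.le_div_iff_mul_le (by exact_mod_cast hn) (EReal.natCast_ne_top n),
    ← coe_mul_card_le_log_iff]
  norm_cast

theorem hasGrowth_iff {f : X → ℝ} {A : NonUnitalSubalgebra F (SingularCohomology F X)}
    (hA : IsFiniteGraded A) {r : ℝ≥0} {ℓ c ν δ h : ℝ} {Ω : Finset Γ} :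
    HasGrowth f A r ℓ c ν δ h Ω ↔
      Real.exp (h * Ω.card) ≤ homologicalMeasure f A (rInterior r (Ω : Set Γ)) Ω ℓ ν c δ := by
  constructor
  · rintro ⟨k, hk, hp⟩
    refine hk.trans ?_
    exact_mod_cast le_finrank_of_hasPairing hA (finite_rInterior r Ω) hp
  · exact fun h => ⟨_, h, hasPairing_finrank hA (finite_rInterior r Ω) _ _ _ _⟩

theorem le_measureGrowth [Infinite Γ] {f : X → ℝ}
    {A : NonUnitalSubalgebra F (SingularCohomology F X)} (hA : IsFiniteGraded A) {r : ℝ≥0}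
    {Ω : ℕ → Finset Γ} (hΩ : IsAmenableSequence Ω) {ℓ c ν δ h : ℝ}
    (H : ∀ᶠ i in atTop, HasGrowth f A r ℓ c ν δ h (Ω i)) :
    (h : EReal) ≤ measureGrowth f A r Ω ℓ ν c δ := by
  refine Filter.le_limsup_of_frequently_le' (Filter.Eventually.frequently ?_)
  filter_upwards [H, hΩ.eventually_le_card 1] with i hi h1
  exact (coe_le_log_div_card_iff h1).mpr ((hasGrowth_iff hA).mp hi)

theorem frequently_hasGrowth_of_lt [Infinite Γ] {f : X → ℝ}
    {A : NonUnitalSubalgebra F (SingularCohomology F X)} (hA : IsFiniteGraded A) {r : ℝ≥0}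
    {Ω : ℕ → Finset Γ} (hΩ : IsAmenableSequence Ω) {ℓ c ν δ h : ℝ}
    (H : (h : EReal) < measureGrowth f A r Ω ℓ ν c δ) :
    ∃ᶠ i in atTop, (Ω i).Nonempty ∧ HasGrowth f A r ℓ c ν δ h (Ω i) := by
  refine ((Filter.frequently_lt_of_lt_limsup (by isBoundedDefault) H).and_eventually
    (hΩ.eventually_le_card 1)).mono fun i hi => ?_
  exact ⟨Finset.card_pos.mp hi.2, (hasGrowth_iff hA).mpr
    ((coe_le_log_div_card_iff hi.2).mp hi.1.le)⟩

end Growth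

/-! ### Concavity of the entropy -/

section Concavity
variable {Γ : Type*} [Group Γ] [Infinite Γ] [DecidableEq Γ] [MetricSpace Γ]
  [IsIsometricSMul Γ Γ] {X : Type u} [TopologicalSpace X] [MulAction Γ X]
  [ContinuousConstSMul Γ X] {F : Type v} [Field F]
  {𝔞 : NonUnitalSubalgebra F (SingularCohomology F X)}
  {N ρ : NonUnitalSubalgebra F (SingularCohomology F X) → ℝ≥0} {f : X → ℝ} {Ω : ℕ → Finset Γ}

/-- Growth that occurs for arbitrarily large members of the sequence occurs for all large members,
also for a larger algebra: the large members are tiled by those on which it occurs. -/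
theorem eventually_hasGrowth_of_lt (hN : IsProductLike Γ 𝔞 N) (hρ : IsSeparatingRadius Γ 𝔞 N ρ)
    (hf : ∀ x, f x ∈ Set.Icc (0 : ℝ) 1) (hΩ : IsTilingAmenableSequence Ω)
    {A C : NonUnitalSubalgebra F (SingularCohomology F X)} (hA : IsFiniteGradedIn 𝔞 A)
    (hAC : A ≤ C) (r : ℝ≥0) {ℓ c h ν δ ε : ℝ} (hc : c ∈ Set.Icc (0 : ℝ) 1) (hν : 0 < ν)
    (hδ : 0 < δ) (hε : 0 < ε) (H : (h : EReal) < measureGrowth f A (ρ A) Ω ℓ ν c δ) :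
    ∀ᶠ i in atTop, HasGrowth f C r ℓ c (2 * ν) (2 * δ) (h - ε) (Ω i) := by
  obtain ⟨φ, hφ, hφH⟩ := extraction_of_frequently_atTop
    (frequently_hasGrowth_of_lt (isFiniteGradedIn_iff.mp hA).2 hΩ.toIsAmenableSequence H)
  have := eventually_hasGrowth_mixture hN hρ hA hAC hf hΩ r hφ (α := 1) ⟨zero_le_one, le_rfl⟩ ℓ ℓ
    hc hc h h hν hδ hε (fun j => (hφH j).1) (fun j => (hφH j).2) (fun j => (hφH j).2)
  simpa using this

/-- Concavity for real numbers below the two entropies. They are approached on two algebras and on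
two unrelated subsequences; `eventually_hasGrowth_of_lt` brings both growth rates to the join of the
algebras and to all large members of the sequence, where they can be mixed. -/
theorem mixture_le_bettiEntropy (hN : IsProductLike Γ 𝔞 N) (hρ : IsSeparatingRadius Γ 𝔞 N ρ)
    (hf : ∀ x, f x ∈ Set.Icc (0 : ℝ) 1) (hΩ : IsTilingAmenableSequence Ω)
    {ℓ ℓ' c c' h h' α : ℝ} (hc : c ∈ Set.Icc (0 : ℝ) 1) (hc' : c' ∈ Set.Icc (0 : ℝ) 1)
    (hα : α ∈ Set.Icc (0 : ℝ) 1) (H : (h : EReal) < bettiEntropy f 𝔞 ρ Ω ℓ c)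
    (H' : (h' : EReal) < bettiEntropy f 𝔞 ρ Ω ℓ' c') :
    ((α * h + (1 - α) * h' : ℝ) : EReal) ≤
      bettiEntropy f 𝔞 ρ Ω (α * ℓ + (1 - α) * ℓ') (α * c + (1 - α) * c') := by
  simp only [bettiEntropy, lt_iSup_iff] at H H'
  obtain ⟨A, hA, H⟩ := H
  obtain ⟨A', hA', H'⟩ := H'
  have hC := hA.sup hA'
  refine le_trans ?_ (le_iSup₂ (f := fun (A : NonUnitalSubalgebra F (SingularCohomology F X))
    (_ : IsFiniteGradedIn 𝔞 A) => ⨅ (ν : ℝ) (_ : 0 < ν) (δ : ℝ) (_ : 0 < δ),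
      measureGrowth f A (ρ A) Ω (α * ℓ + (1 - α) * ℓ') ν (α * c + (1 - α) * c') δ) (A ⊔ A') hC)
  refine le_iInf₂ fun ν hν => le_iInf₂ fun δ hδ => ?_
  have hν4 : 0 < ν / 4 := by positivity
  have hδ4 : 0 < δ / 4 := by positivity
  refine EReal.ge_of_forall_gt_iff_ge.mp fun z hz => ?_
  rw [EReal.coe_lt_coe_iff] at hz
  obtain ⟨ε, hε, hεz⟩ : ∃ ε : ℝ, 0 < ε ∧ z = α * h + (1 - α) * h' - 2 * ε :=
    ⟨(α * h + (1 - α) * h' - z) / 2, by linarith, by ring⟩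
  -- each of the two passages to larger sets doubles the tolerances, whence `ν / 4` and `δ / 4`
  have e1 := eventually_hasGrowth_of_lt hN hρ hf hΩ hA (le_sup_left : A ≤ A ⊔ A') (ρ (A ⊔ A')) hc
    hν4 hδ4 hε (H.trans_le ((iInf₂_le _ hν4).trans (iInf₂_le _ hδ4)))
  have e2 := eventually_hasGrowth_of_lt hN hρ hf hΩ hA' (le_sup_right : A' ≤ A ⊔ A')
    (ρ (A ⊔ A')) hc' hν4 hδ4 hε (H'.trans_le ((iInf₂_le _ hν4).trans (iInf₂_le _ hδ4)))
  obtain ⟨i₀, hi₀⟩ := ((e1.and e2).and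
    (hΩ.toIsAmenableSequence.eventually_le_card 1)).exists_forall_of_atTop
  have e3 := eventually_hasGrowth_mixture hN hρ hC le_rfl hf hΩ (ρ (A ⊔ A'))
    (φ := fun j => i₀ + j) (fun a b hab => Nat.add_lt_add_left hab i₀) hα ℓ ℓ' hc hc' (h - ε)
    (h' - ε) (by positivity) (by positivity) hε
    (fun j => Finset.card_pos.mp (hi₀ (i₀ + j) (Nat.le_add_right _ _)).2)
    (fun j => (hi₀ (i₀ + j) (Nat.le_add_right _ _)).1.1)
    (fun j => (hi₀ (i₀ + j) (Nat.le_add_right _ _)).1.2)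
  have e4 := le_measureGrowth (isFiniteGradedIn_iff.mp hC).2 hΩ.toIsAmenableSequence e3
  have h1 : α * (h - ε) + (1 - α) * (h' - ε) - ε = z := by rw [hεz]; ring
  rw [h1, show 2 * (2 * (ν / 4)) = ν by ring, show 2 * (2 * (δ / 4)) = δ by ring] at e4
  exact e4

end Concavity

theorem EReal.exists_coe_of_lt_coe_mul {α : ℝ} (hα : 0 < α) {a B : EReal}
    (h : a < (α : EReal) * B) (ha : a ≠ ⊥) :
    ∃ x : ℝ, (x : EReal) < B ∧ a = ((α * x : ℝ) : EReal) := by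
  lift a to ℝ using ⟨ne_top_of_lt h, ha⟩
  refine ⟨a / α, ?_, by rw [mul_div_cancel₀ _ hα.ne']⟩
  by_contra hle
  refine absurd h (not_lt.mpr ?_)
  calc (α : EReal) * B ≤ (α : EReal) * ((a / α : ℝ) : EReal) :=
        mul_le_mul_of_nonneg_left (not_lt.mp hle) (EReal.coe_nonneg.mpr hα.le)
    _ = a := by rw [← EReal.coe_mul, mul_div_cancel₀ _ hα.ne']

theorem mainTheorem2 {Γ : Type*} [Group Γ] [Countable Γ] [Infinite Γ] [DecidableEq Γ]
    [MetricSpace Γ] [IsIsometricSMul Γ Γ]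
    {X : Type u} [TopologicalSpace X] [CompactSpace X] [MulAction Γ X] [ContinuousConstSMul Γ X]
    {F : Type v} [Field F]
    (f : C(X, ℝ)) (hf : Set.range f = Set.Icc 0 1)
    (𝔞 : NonUnitalSubalgebra F (SingularCohomology F X))
    (N ρ : NonUnitalSubalgebra F (SingularCohomology F X) → ℝ≥0)
    (hN : IsProductLike Γ 𝔞 N) (hρ : IsSeparatingRadius Γ 𝔞 N ρ)
    (Ω : ℕ → Finset Γ) (hΩ : IsTilingAmenableSequence Ω)
    (ℓ ℓ' : ℝ) (hℓ : 0 ≤ ℓ) (hℓ' : 0 ≤ ℓ')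
    (c c' : ℝ) (hc : c ∈ Set.Icc (0 : ℝ) 1) (hc' : c' ∈ Set.Icc (0 : ℝ) 1)
    (α : ℝ) (hα : α ∈ Set.Icc (0 : ℝ) 1) :
    (α : EReal) * bettiEntropy f 𝔞 ρ Ω ℓ c +
        ((1 - α : ℝ) : EReal) * bettiEntropy f 𝔞 ρ Ω ℓ' c' ≤
      bettiEntropy f 𝔞 ρ Ω (α * ℓ + (1 - α) * ℓ') (α * c + (1 - α) * c') := by
  have hf' : ∀ x, f x ∈ Set.Icc (0 : ℝ) 1 := fun x => hf ▸ Set.mem_range_self x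
  rcases hα.1.eq_or_lt with rfl | h0
  · simp
  rcases hα.2.eq_or_lt with rfl | h1
  · simp
  -- for `0 < α < 1` both summands are approached from below by real numbers or are `⊥`
  refine EReal.add_le_of_forall_lt fun a ha b hb => ?_
  rcases eq_or_ne a ⊥ with rfl | ha'
  · rw [EReal.bot_add]
    exact bot_le
  rcases eq_or_ne b ⊥ with rfl | hb'
  · rw [EReal.add_bot]
    exact bot_le
  obtain ⟨x, hx, rfl⟩ := EReal.exists_coe_of_lt_coe_mul h0 ha ha'
  obtain ⟨y, hy, rfl⟩ := EReal.exists_coe_of_lt_coe_mul (sub_pos.mpr h1) hb hb'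
  rw [← EReal.coe_add]
  exact mixture_le_bettiEntropy hN hρ hf' hΩ hc hc' hα hx hy
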